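/- Let $G$ be a locally compact (Hausdorff) group with left Haar measure $dx$, and suppose that $G$ is an $[\mathrm{IN}]$ group, i.e. the identity has a compact neighbourhood invariant under all inner automorphisms. Let $w:G\to(0,\infty)$ be a weight, i.e. a Borel measurable function with $w(xy)\le w(x)w(y)$ for all $x,y\in G$, and assume that $w$ is constant on conjugacy classes or that $w\ge 1$ on $G$. Let $A$ be a complex Banach algebra (not necessarily unital) with centre $\mathcal Z(A)$, and assume that there is a bounded net $(a_\alpha)$ in $A$ with $a_\alpha z\to z$ for every $z\in\mathcal Z(A)$. For a Banach algebra $B$ let $L^1_w(G,B)$ be the Banach algebra of (classes of) Bochner measurable functions $f:G\to B$ with $\|f\|=\int_G\|f(x)\|\,w(x)\,dx<\infty$, with the convolution product $(f*g)(x)=\int_G f(xy)g(y^{-1})\,dy$; write $L^1_w(G)=L^1_w(G,\mathbb C)$. Let $L^1_{w,\mathrm{inv}}(G,B)\subseteq L^1_w(G,B)$ be the subspace of the classes which have a representative that is Bochner measurable with respect to the $\sigma$-algebra of conjugation invariant Borel sets. Let $\otimes^\gamma$ denote the Banach space projective tensor product (the completion of the algebraic tensor product in the projective norm), with the product determined by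 $(f\otimes z)(g\otimes z')=(f*g)\otimes zz'$. Then: (1) $L^1_{w,\mathrm{inv}}(G,\mathcal Z(A))$ consists exactly of the classes in $L^1_w(G,\mathcal Z(A))$ which have a (Bochner measurable) representative that is constant on conjugacy classes of $G$. (2) Regarding $\mathcal Z(A)$-valued functions as $A$-valued functions identifies $L^1_{w,\mathrm{inv}}(G,\mathcal Z(A))$ isometrically with $\mathcal Z\big(L^1_w(G,A)\big)$. (3) There is an isometric isomorphism of Banach algebras $$\mathcal Z\big(L^1_w(G)\big)\otimes^\gamma\mathcal Z(A)\;\cong\;L^1_{w,\mathrm{inv}}(G,\mathcal Z(A))=\mathcal Z\big(L^1_w(G,A)\big)$$ which sends $f\otimes z$ to the function $x\mapsto f(x)z$. -/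

import Mathlib

open MeasureTheory Filter Topology
open scoped ENNReal NNReal Pointwise TensorProduct

namespace Beurling

/-- A weight on `G`: a (Borel) measurable function `w : G → (0, ∞)` with
`w (x y) ≤ w x * w y` for all `x`, `y`. -/
structure Weight (G : Type*) [Group G] [MeasurableSpace G] where
  toFun : G → ℝ≥0
  measurable' : Measurable toFun
  pos' : ∀ x, 0 < toFun x
  mul_le' : ∀ x y, toFun (x * y) ≤ toFun x * toFun y

instance {G : Type*} [Group G] [MeasurableSpace G] : CoeFun (Weight G) (fun _ => G → ℝ≥0) :=
  ⟨Weight.toFun⟩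

/-- The measure `w(x) dx`. -/
noncomputable def wMeasure {G : Type*} [Group G] [MeasurableSpace G] (μ : Measure G)
    (w : Weight G) : Measure G :=
  μ.withDensity (fun x => (w x : ℝ≥0∞))

section Basic

variable {G : Type*} [Group G] [MeasurableSpace G] (μ : Measure G) (w : Weight G)

theorem wMeasure_ac : wMeasure μ w ≪ μ := withDensity_absolutelyContinuous _ _

theorem ac_wMeasure : μ ≪ wMeasure μ w :=
  withDensity_absolutelyContinuous' w.measurable'.coe_nnreal_ennreal.aemeasurable
    (Eventually.of_forall fun x => by simpa using (w.pos' x).ne')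

theorem lintegral_wMeasure (f : G → ℝ≥0∞) :
    ∫⁻ x, f x ∂(wMeasure μ w) = ∫⁻ x, w x * f x ∂μ :=
  lintegral_withDensity_eq_lintegral_mul_non_measurable μ
    w.measurable'.coe_nnreal_ennreal (Eventually.of_forall fun _ => ENNReal.coe_lt_top) f

end Basic

section Measure

variable {G : Type*} [Group G] [TopologicalSpace G] [IsTopologicalGroup G] [T2Space G]
  [LocallyCompactSpace G] [MeasurableSpace G] [BorelSpace G]
  (μ : Measure G) [μ.IsHaarMeasure] [μ.Regular] (w : Weight G)

theorem Weight.exists_nhds_one_bound : ∃ U ∈ 𝓝 (1 : G), ∃ C : ℝ≥0, ∀ x ∈ U, w x ≤ C := by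
  let μ : Measure G := Measure.haar
  obtain ⟨K, hK, hK1⟩ := exists_compact_mem_nhds (1 : G)
  let E : ℕ → Set G := fun n => {x | w x ≤ n ∧ w x⁻¹ ≤ n} ∩ K
  have hE : ∀ n, MeasurableSet (E n) := fun n =>
    ((measurableSet_le w.measurable' measurable_const).inter
      (measurableSet_le (w.measurable'.comp measurable_inv) measurable_const)).inter
        hK.measurableSet
  have hU : ⋃ n, E n = K := by
    apply Set.Subset.antisymm
    · exact Set.iUnion_subset fun n => Set.inter_subset_right
    · intro x hx
      obtain ⟨n, hn⟩ := exists_nat_ge (max (w x) (w x⁻¹))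
      exact Set.mem_iUnion.2 ⟨n, ⟨(le_max_left _ _).trans hn, (le_max_right _ _).trans hn⟩, hx⟩
  have hpos : 0 < μ K := Measure.measure_pos_of_mem_nhds μ hK1
  obtain ⟨n, hn⟩ : ∃ n, 0 < μ (E n) := by
    by_contra! h
    have : μ (⋃ n, E n) = 0 := measure_iUnion_null fun n => le_antisymm (h n) zero_le
    rw [hU] at this
    exact hpos.ne' this
  have hfin : μ (E n) ≠ ∞ :=
    ((measure_mono Set.inter_subset_right).trans_lt hK.measure_lt_top).ne
  refine ⟨E n / E n, Measure.div_mem_nhds_one_of_haar_pos_ne_top μ (E n) (hE n) hn hfin,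
    n * n, ?_⟩
  rintro x ⟨a, ha, b, hb, rfl⟩
  simp only [div_eq_mul_inv]
  exact (w.mul_le' _ _).trans (mul_le_mul' ha.1.1 hb.1.2)

theorem Weight.exists_bound {K : Set G} (hK : IsCompact K) : ∃ C : ℝ≥0, ∀ x ∈ K, w x ≤ C := by
  obtain ⟨U, hU, C, hC⟩ := w.exists_nhds_one_bound
  refine hK.induction_on (p := fun s => ∃ C : ℝ≥0, ∀ x ∈ s, w x ≤ C) ⟨0, by simp⟩ ?_ ?_ ?_
  · rintro s t hst ⟨C, h⟩
    exact ⟨C, fun x hx => h x (hst hx)⟩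
  · rintro s t ⟨C, h⟩ ⟨D, h'⟩
    refine ⟨max C D, ?_⟩
    rintro x (hx | hx)
    · exact (h x hx).trans (le_max_left _ _)
    · exact (h' x hx).trans (le_max_right _ _)
  · intro x _
    refine ⟨x • U, mem_nhdsWithin_of_mem_nhds ?_, w x * C, ?_⟩
    · simpa using smul_mem_nhds_smul x hU
    · rintro _ ⟨u, hu, rfl⟩
      exact (w.mul_le' _ _).trans (mul_le_mul_right (hC u hu) _)

instance : IsFiniteMeasureOnCompacts (wMeasure μ w) where
  lt_top_of_isCompact K hK := by
    obtain ⟨C, hC⟩ := w.exists_bound hK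
    rw [wMeasure, withDensity_apply _ hK.measurableSet]
    calc ∫⁻ x in K, (w x : ℝ≥0∞) ∂μ ≤ ∫⁻ x in K, (C : ℝ≥0∞) ∂μ :=
          setLIntegral_mono measurable_const fun x hx => by exact_mod_cast hC x hx
      _ = C * μ K := by simp
      _ < ∞ := ENNReal.mul_lt_top ENNReal.coe_lt_top hK.measure_lt_top

instance : (wMeasure μ w).InnerRegularCompactLTTop where
  innerRegular := by
    rintro A ⟨hA, hAfin⟩ r hr
    let B : ℕ → Set G := fun n => A ∩ {x | w x ≤ n ∧ (w x)⁻¹ ≤ n}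
    have hB : ∀ n, MeasurableSet (B n) := fun n => hA.inter
      ((measurableSet_le w.measurable' measurable_const).inter
        ((show Measurable fun x => (w x)⁻¹ from w.measurable'.inv)
          (measurableSet_Iic (a := (n : ℝ≥0)))))
    have hmono : Monotone B := fun m n hmn x hx =>
      ⟨hx.1, hx.2.1.trans (by exact_mod_cast hmn), hx.2.2.trans (by exact_mod_cast hmn)⟩
    have hU : ⋃ n, B n = A := by
      apply Set.Subset.antisymm
      · exact Set.iUnion_subset fun n => Set.inter_subset_left
      · intro x hx
        obtain ⟨n, hn⟩ := exists_nat_ge (max (w x) (w x)⁻¹)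
        exact Set.mem_iUnion.2 ⟨n, hx, (le_max_left _ _).trans hn, (le_max_right _ _).trans hn⟩
    have ht := tendsto_measure_iUnion_atTop (μ := wMeasure μ w) hmono
    rw [hU] at ht
    obtain ⟨n, hn⟩ := (ht.eventually (lt_mem_nhds hr)).exists
    have hBle : ∀ s ⊆ B n, MeasurableSet s → wMeasure μ w s ≤ n * μ s := by
      intro s hs hsm
      rw [wMeasure, withDensity_apply _ hsm]
      calc ∫⁻ x in s, (w x : ℝ≥0∞) ∂μ ≤ ∫⁻ x in s, (n : ℝ≥0∞) ∂μ :=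
            setLIntegral_mono measurable_const fun x hx => by exact_mod_cast (hs hx).2.1
        _ = n * μ s := by simp
    have hBge : μ (B n) ≤ n * wMeasure μ w (B n) := by
      rw [wMeasure, withDensity_apply _ (hB n), ← lintegral_const_mul _
        w.measurable'.coe_nnreal_ennreal]
      calc μ (B n) = ∫⁻ x in B n, 1 ∂μ := by simp
        _ ≤ _ := setLIntegral_mono (measurable_const.mul w.measurable'.coe_nnreal_ennreal)
          fun x hx => by
            have := hx.2.2
            have h1 : (1 : ℝ≥0) ≤ n * w x := by
              calc (1 : ℝ≥0) = (w x)⁻¹ * w x := (inv_mul_cancel₀ (w.pos' x).ne').symm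
                _ ≤ n * w x := mul_le_mul_left this _
            show (1 : ℝ≥0∞) ≤ (n : ℝ≥0∞) * (w x : ℝ≥0∞)
            exact_mod_cast h1
    have hfin : wMeasure μ w (B n) ≠ ∞ :=
      ((measure_mono Set.inter_subset_left).trans_lt hAfin.lt_top).ne
    have hfin' : μ (B n) ≠ ∞ :=
      (hBge.trans_lt (ENNReal.mul_lt_top (by simp) hfin.lt_top)).ne
    obtain ⟨δ, hδ, hδ'⟩ : ∃ δ : ℝ≥0∞, δ ≠ 0 ∧ r + n * δ ≤ wMeasure μ w (B n) := by
      refine ⟨(wMeasure μ w (B n) - r) / (n + 1), ?_, ?_⟩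
      · simp [ENNReal.div_eq_zero_iff, tsub_eq_zero_iff_le]
        exact hn
      · have : (n : ℝ≥0∞) * ((wMeasure μ w (B n) - r) / (n + 1)) ≤ wMeasure μ w (B n) - r := by
          rw [mul_comm, ENNReal.mul_comm_div, mul_comm]
          refine mul_le_of_le_one_left zero_le ?_
          exact ENNReal.div_le_of_le_mul (by simp)
        calc r + _ ≤ r + (wMeasure μ w (B n) - r) := by gcongr
          _ = _ := add_tsub_cancel_of_le hn.le
    obtain ⟨K, hKB, hK, hKd⟩ := (hB n).exists_isCompact_sdiff_lt hfin' hδ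
    refine ⟨K, hKB.trans Set.inter_subset_left, hK, ?_⟩
    by_contra! hcon
    have h1 : wMeasure μ w (B n) ≤ wMeasure μ w K + wMeasure μ w (B n \ K) := by
      rw [measure_add_sdiff hK.measurableSet.nullMeasurableSet]
      exact measure_mono Set.subset_union_right
    have h2 : wMeasure μ w (B n \ K) ≤ n * μ (B n \ K) :=
      hBle _ Set.sdiff_subset ((hB n).diff hK.measurableSet)
    rcases eq_or_ne n 0 with h0 | h0
    · subst h0
      simp only [Nat.cast_zero, zero_mul] at h2
      exact absurd (h1.trans (add_le_add hcon h2)) (by simpa using hn)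
    · have h3 : (n : ℝ≥0∞) * μ (B n \ K) < n * δ :=
        ENNReal.mul_lt_mul_right (by simpa using h0) (by simp) hKd
      have hrfin : r ≠ ∞ := hr.ne_top
      have := ENNReal.add_lt_add_of_le_of_lt (hcon.trans_lt hrfin.lt_top).ne hcon (h2.trans_lt h3)
      exact absurd (h1.trans_lt this) (not_lt.2 hδ')

end Measure
end Beurling

namespace Beurling
section Density

variable {G : Type*} [Group G] [TopologicalSpace G] [IsTopologicalGroup G] [T2Space G]
  [LocallyCompactSpace G] [MeasurableSpace G] [BorelSpace G]
  (μ : Measure G) [μ.IsHaarMeasure] [μ.Regular] (w : Weight G)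
  {E : Type*} [NormedAddCommGroup E] [NormedSpace ℝ E]

/-- Compactly supported continuous functions are dense in the weighted `L¹` space. -/
theorem exists_cc_approx {f : G → E} (hf : MemLp f 1 (wMeasure μ w)) {ε : ℝ≥0∞} (hε : ε ≠ 0) :
    ∃ g : G → E, eLpNorm (f - g) 1 (wMeasure μ w) ≤ ε ∧ Continuous g ∧ HasCompactSupport g := by
  refine hf.induction_dense (by simp) (fun g => Continuous g ∧ HasCompactSupport g) ?_ ?_ ?_ hε
  · intro c s hs hsfin ε hε
    obtain ⟨δ, hδ, hδε⟩ : ∃ δ : ℝ≥0∞, δ ≠ 0 ∧ ‖c‖ₑ * (δ + δ) ≤ ε := by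
      refine ⟨ε / (2 * (‖c‖ₑ + 1)), ?_, ?_⟩
      · have h1 : 2 * (‖c‖ₑ + 1) ≠ ∞ :=
          ENNReal.mul_ne_top (by simp) (by simp)
        simpa [ENNReal.div_eq_zero_iff, hε] using h1
      · rw [← two_mul, ← mul_assoc, mul_comm ‖c‖ₑ 2, ← mul_div_assoc, mul_comm, mul_div_assoc]
        refine mul_le_of_le_one_right zero_le (ENNReal.div_le_of_le_mul ?_)
        rw [one_mul]
        gcongr
        exact le_self_add
    obtain ⟨k, hks, hk, hkd⟩ := hs.exists_isCompact_sdiff_lt (μ := wMeasure μ w) hsfin.ne hδ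
    obtain ⟨V, hkV, hV, hVlt⟩ := hk.exists_isOpen_lt_add (μ := wMeasure μ w) hδ
    have hVd : wMeasure μ w (V \ k) ≤ δ := by
      rw [measure_sdiff hkV hk.measurableSet.nullMeasurableSet hk.measure_lt_top.ne]
      exact tsub_le_iff_left.2 hVlt.le
    obtain ⟨φ, h1, h0, hφs, hφ⟩ := exists_continuous_one_zero_of_isCompact hk
      hV.isClosed_compl (Set.disjoint_compl_right_iff_subset.2 hkV)
    refine ⟨fun x => φ x • c, ?_, φ.continuous.smul continuous_const, hφs.smul_right⟩
    rw [eLpNorm_one_eq_lintegral_enorm]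
    have hb : ∀ x, ‖((fun x => φ x • c) - s.indicator fun _ => c) x‖ₑ ≤
        (V \ k).indicator (fun _ => ‖c‖ₑ) x + (s \ k).indicator (fun _ => ‖c‖ₑ) x := by
      intro x
      have hle : ∀ t : ℝ, ‖t‖ ≤ 1 → ‖t • c‖ₑ ≤ ‖c‖ₑ := by
        intro t ht
        rw [enorm_smul]
        refine mul_le_of_le_one_left zero_le ?_
        rw [← ofReal_norm]
        exact ENNReal.ofReal_le_one.2 ht
      have hn1 : ‖φ x‖ ≤ 1 := by
        rw [Real.norm_eq_abs, abs_of_nonneg (hφ x).1]; exact (hφ x).2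
      by_cases hxk : x ∈ k
      · simp [hks hxk, h1 hxk]
      by_cases hxs : x ∈ s
      · have : φ x • c - c = (φ x - 1) • c := by rw [sub_smul, one_smul]
        simp only [Pi.sub_apply, Set.indicator_of_mem hxs, this,
          Set.indicator_of_mem (show x ∈ s \ k from ⟨hxs, hxk⟩)]
        refine (hle _ ?_).trans le_add_self
        rw [Real.norm_eq_abs, abs_le]
        constructor <;> linarith [(hφ x).1, (hφ x).2]
      by_cases hxV : x ∈ V
      · simp only [Pi.sub_apply, Set.indicator_of_notMem hxs, sub_zero,
          Set.indicator_of_mem (show x ∈ V \ k from ⟨hxV, hxk⟩)]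
        exact (hle _ hn1).trans le_self_add
      · have : φ x = 0 := h0 hxV
        simp [hxs, this]
    calc _ ≤ ∫⁻ x, ((V \ k).indicator (fun _ => ‖c‖ₑ) x + (s \ k).indicator (fun _ => ‖c‖ₑ) x)
          ∂(wMeasure μ w) := lintegral_mono hb
      _ = ‖c‖ₑ * wMeasure μ w (V \ k) + ‖c‖ₑ * wMeasure μ w (s \ k) := by
          have m1 := hV.measurableSet.diff hk.measurableSet
          have m2 := hs.diff hk.measurableSet
          rw [lintegral_add_left (measurable_const.indicator m1), lintegral_indicator m1,
            lintegral_indicator m2]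
          simp
      _ ≤ ‖c‖ₑ * (δ + δ) := by rw [← mul_add]; gcongr
      _ ≤ ε := hδε
  · rintro f g ⟨hf, hf'⟩ ⟨hg, hg'⟩
    exact ⟨hf.add hg, hf'.add hg'⟩
  · rintro f ⟨hf, hf'⟩
    exact (hf.stronglyMeasurable_of_hasCompactSupport hf').aestronglyMeasurable

/-- The inverse of a null set is locally null. -/
theorem inv_null_inter {N K : Set G} (hN : μ N = 0) (hK : IsCompact K) : μ.inv (N ∩ K) = 0 := by
  obtain ⟨g, hg1, -, hgs, hg01⟩ := exists_continuous_one_zero_of_isCompact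
    (isCompact_singleton (x := (1 : G))) isClosed_empty (Set.disjoint_empty _)
  have hg1 : g 1 = 1 := hg1 rfl
  have hg0 : 0 ≤ (g : G → ℝ) := fun x => (hg01 x).1
  let D : G → ℝ := fun y => ∫ z, g (z⁻¹ * y) ∂μ.inv
  have Dc : Continuous D := continuous_integral_apply_inv_mul g.continuous hgs
  have Dpos : ∀ y, 0 < D y := by
    intro x
    have C : Continuous (fun y ↦ g (y⁻¹ * x)) := by fun_prop
    apply (integral_pos_iff_support_of_nonneg _ _).2
    · apply C.isOpen_support.measure_pos μ.inv
      exact ⟨x, by simp [hg1]⟩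
    · exact fun y ↦ hg0 (y⁻¹ * x)
    · apply C.integrable_of_hasCompactSupport
      exact hgs.comp_homeomorph ((Homeomorph.inv G).trans (Homeomorph.mulRight x))
  let c : ℝ := ∫ x, g x ∂μ
  have hc : 0 < c := by
    apply (integral_pos_iff_support_of_nonneg hg0 _).2
    · exact g.continuous.isOpen_support.measure_pos μ ⟨1, by simp [hg1]⟩
    · exact g.continuous.integrable_of_hasCompactSupport hgs
  obtain ⟨L, hL, hKL⟩ := exists_compact_superset hK
  obtain ⟨M, hM⟩ : ∃ M, ∀ x ∈ L, D x ≤ M := by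
    obtain ⟨M, hM⟩ := hL.bddAbove_image Dc.continuousOn
    exact ⟨M, fun x hx => hM ⟨x, hx, rfl⟩⟩
  have key : ∀ U : Set G, IsOpen U → U ⊆ L → μ.inv U ≤ ENNReal.ofReal (|M| / c) * μ U := by
    intro U hU hUL
    rw [hU.measure_eq_iSup_isCompact]
    refine iSup₂_le fun k hkU => iSup_le fun hk => ?_
    obtain ⟨φ, h1, h0, hφs, hφ⟩ := exists_continuous_one_zero_of_isCompact hk
      hU.isClosed_compl (Set.disjoint_compl_right_iff_subset.2 hkU)
    have hUfin : μ U ≠ ∞ := ((measure_mono hUL).trans_lt hL.measure_lt_top).ne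
    have hcombo := Measure.integral_isMulLeftInvariant_isMulRightInvariant_combo
      (μ := μ) (ν := μ.inv) φ.continuous hφs g.continuous hgs hg0 (x₀ := 1) (by simp [hg1])
    have I1 : μ.inv.real k ≤ ∫ x, φ x ∂μ.inv := by
      rw [← integral_indicator_one hk.measurableSet]
      refine integral_mono_of_nonneg (Eventually.of_forall fun x => ?_)
        (φ.continuous.integrable_of_hasCompactSupport hφs) (Eventually.of_forall fun x => ?_)
      · exact Set.indicator_nonneg (fun _ _ => zero_le_one) x
      · by_cases hx : x ∈ k
        · simp [hx, h1 hx]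
        · simpa [hx] using (hφ x).1
    have I2 : ∫ x, φ x ∂μ.inv ≤ ∫ x, |M| * (φ x * (D x)⁻¹) ∂μ.inv := by
      refine integral_mono_of_nonneg (Eventually.of_forall fun x => (hφ x).1) ?_
        (Eventually.of_forall fun x => ?_)
      · refine Continuous.integrable_of_hasCompactSupport ?_ ?_
        · exact continuous_const.mul (φ.continuous.mul (Dc.inv₀ fun x => (Dpos x).ne'))
        · exact (hφs.mul_right).mul_left
      · by_cases hx : x ∈ U
        · have hDM : D x ≤ |M| := (hM x (hUL hx)).trans (le_abs_self M)
          have : 1 ≤ |M| * (D x)⁻¹ := by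
            rw [← div_eq_mul_inv, one_le_div (Dpos x)]; exact hDM
          calc φ x = φ x * 1 := (mul_one _).symm
            _ ≤ φ x * (|M| * (D x)⁻¹) := mul_le_mul_of_nonneg_left this (hφ x).1
            _ = _ := by ring
        · have : φ x = 0 := h0 hx
          simp [this]
    have I3 : ∫ x, φ x ∂μ ≤ μ.real U := by
      rw [← integral_indicator_one hU.measurableSet]
      refine integral_mono_of_nonneg (Eventually.of_forall fun x => (hφ x).1)
        ((integrable_indicator_iff hU.measurableSet).2 
          (show IntegrableOn (fun _ => (1 : ℝ)) U μ from integrableOn_const hUfin))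
        (Eventually.of_forall fun x => ?_)
      by_cases hx : x ∈ U
      · simpa [hx] using (hφ x).2
      · have : φ x = 0 := h0 hx
        simp [this, hx]
    have I4 : ∫ x, φ x * (D x)⁻¹ ∂μ.inv = (∫ x, φ x ∂μ) / c := by
      rw [hcombo, mul_div_assoc, div_self hc.ne', mul_one]
    rw [integral_const_mul, I4] at I2
    have I5 : μ.inv.real k ≤ |M| / c * μ.real U := by
      refine I1.trans (I2.trans ?_)
      rw [mul_div_assoc', div_mul_eq_mul_div]
      gcongr
    rw [← ENNReal.ofReal_toReal hUfin, ← ENNReal.ofReal_mul (by positivity),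
      ← ENNReal.ofReal_toReal (a := μ.inv k) hk.measure_lt_top.ne]
    exact ENNReal.ofReal_le_ofReal I5
  refine le_antisymm (ENNReal.le_of_forall_pos_le_add fun ε hε _ => ?_) zero_le
  obtain ⟨δ, hδ, hδε⟩ : ∃ δ : ℝ≥0∞, δ ≠ 0 ∧ ENNReal.ofReal (|M| / c) * δ ≤ ε := by
    refine ⟨ε / (ENNReal.ofReal (|M| / c) + 1), ?_, ?_⟩
    · simp [ENNReal.div_eq_zero_iff, hε.ne']
    · rw [← mul_div_assoc, mul_comm, mul_div_assoc]
      refine mul_le_of_le_one_right zero_le (ENNReal.div_le_of_le_mul ?_)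
      rw [one_mul]
      exact le_self_add
  obtain ⟨U, hNU, hU, hUlt⟩ := Set.exists_isOpen_lt_of_lt (μ := μ) N δ
    (by rw [hN]; exact pos_iff_ne_zero.2 hδ)
  calc μ.inv (N ∩ K) ≤ μ.inv (U ∩ interior L) := measure_mono (Set.inter_subset_inter hNU hKL)
    _ ≤ ENNReal.ofReal (|M| / c) * μ (U ∩ interior L) :=
        key _ (hU.inter isOpen_interior) (Set.inter_subset_right.trans interior_subset)
    _ ≤ ENNReal.ofReal (|M| / c) * δ := by
        gcongr
        exact (measure_mono Set.inter_subset_left).trans hUlt.le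
    _ ≤ ε := hδε
    _ ≤ 0 + ε := by simp

theorem ae_inv_mul_notMem {N K : Set G} (hN : μ N = 0) (hK : IsCompact K) (x : G) :
    ∀ᵐ y ∂μ, y ∈ K → y⁻¹ * x ∉ N := by
  have h := inv_null_inter μ hN ((hK.smul x⁻¹).inv)
  rw [Measure.inv_apply] at h
  rw [← measure_preimage_mul μ x⁻¹] at h
  refine measure_mono_null ?_ h
  intro y hy
  simp only [Set.mem_compl_iff, Set.mem_ofPred_eq, not_forall, not_not] at hy
  obtain ⟨hy1, hy2⟩ := hy
  simp only [Set.mem_preimage, Set.mem_inv, Set.mem_inter_iff, inv_inv, mul_inv_rev]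
  exact ⟨hy2, y, hy1, rfl⟩

end Density
end Beurling

namespace Beurling
section Conv
set_option linter.unusedSectionVars false

variable {G : Type*} [Group G] [TopologicalSpace G] [IsTopologicalGroup G] [T2Space G]
  [LocallyCompactSpace G] [MeasurableSpace G] [BorelSpace G]
  (μ : Measure G) [μ.IsHaarMeasure] [μ.Regular] (w : Weight G)
  {A : Type*} [NonUnitalNormedRing A] [NormedSpace ℂ A] [IsScalarTower ℂ A A]
  [SMulCommClass ℂ A A]

/-- Convolution, `(f * g)(x) = ∫ f(x y) g(y⁻¹) dy`. -/
noncomputable def conv {G : Type*} [Group G] [MeasurableSpace G] (μ : Measure G)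
    {A : Type*} [NonUnitalNormedRing A] [NormedSpace ℂ A] (f g : G → A) (x : G) : A :=
  ∫ y, f (x * y) * g y⁻¹ ∂μ

theorem conv_eq (f g : G → A) (x : G) : conv μ f g x = ∫ y, f y * g (y⁻¹ * x) ∂μ := by
  rw [conv, ← integral_mul_left_eq_self (fun y => f y * g (y⁻¹ * x)) x]
  simp [mul_assoc]

/-- The integral of the norms in a convolution. -/
noncomputable def convI {G : Type*} [Group G] [MeasurableSpace G] (μ : Measure G)
    {A : Type*} [NonUnitalNormedRing A] (f g : G → A) (x : G) : ℝ≥0∞ :=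
  ∫⁻ y, ‖f y‖ₑ * ‖g (y⁻¹ * x)‖ₑ ∂μ

theorem enorm_mul_le' (a b : A) : ‖a * b‖ₑ ≤ ‖a‖ₑ * ‖b‖ₑ := by
  rw [← ofReal_norm, ← ofReal_norm, ← ofReal_norm, ← ENNReal.ofReal_mul (norm_nonneg _)]
  exact ENNReal.ofReal_le_ofReal (norm_mul_le a b)

theorem enorm_conv_le (f g : G → A) (x : G) : ‖conv μ f g x‖ₑ ≤ convI μ f g x := by
  rw [conv_eq]
  exact (enorm_integral_le_lintegral_enorm _).trans
    (lintegral_mono fun y => enorm_mul_le' _ _)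

theorem hasCompactSupport_aux {B : Type*} [Zero B] {f g : G → A} (hf : HasCompactSupport f)
    (hg : HasCompactSupport g) (F : G × G → B)
    (hF : ∀ x y, f y = 0 ∨ g (y⁻¹ * x) = 0 → F (x, y) = 0) : HasCompactSupport F := by
  refine HasCompactSupport.intro (K := (tsupport f * tsupport g) ×ˢ tsupport f)
    ((hf.isCompact.mul hg.isCompact).prod hf.isCompact) ?_
  rintro ⟨x, y⟩ hxy
  apply hF
  by_contra! h
  refine hxy ⟨⟨y, subset_tsupport _ h.1, y⁻¹ * x, subset_tsupport _ h.2, by simp⟩,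
    subset_tsupport _ h.1⟩

theorem convI_cc {f g : G → A} (hf : Continuous f) (hf' : HasCompactSupport f)
    (hg : Continuous g) (hg' : HasCompactSupport g) :
    Measurable (convI μ f g) ∧ ∫⁻ x, convI μ f g x ∂(wMeasure μ w) ≤
      eLpNorm f 1 (wMeasure μ w) * eLpNorm g 1 (wMeasure μ w) := by
  set ν := wMeasure μ w with hν
  let F : G × G → ℝ≥0∞ := fun p => ‖f p.2‖ₑ * ‖g (p.2⁻¹ * p.1)‖ₑ
  let F' : G × G → ℝ := fun p => ‖f p.2‖ * ‖g (p.2⁻¹ * p.1)‖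
  have hF' : Continuous F' := by fun_prop
  have hFs : HasCompactSupport F' := hasCompactSupport_aux hf' hg' F' (by
    rintro x y (h | h) <;> simp [F', h])
  have hFm' : Measurable F' := hFs.measurable_of_prod hF'
  have hFF : F = fun p => ENNReal.ofReal (F' p) := by
    funext p
    simp only [F, F']
    rw [ENNReal.ofReal_mul (norm_nonneg _), ofReal_norm, ofReal_norm]
  have hFm : Measurable F := by rw [hFF]; exact hFm'.ennreal_ofReal
  let K := tsupport f
  let L := tsupport f * tsupport g
  have hK : IsCompact K := hf'
  have hL : IsCompact L := hf'.isCompact.mul hg'.isCompact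
  have : IsFiniteMeasure (μ.restrict K) := ⟨by simpa using hK.measure_lt_top⟩
  have : IsFiniteMeasure (ν.restrict L) := ⟨by simpa using hL.measure_lt_top⟩
  have hI : ∀ x, convI μ f g x = ∫⁻ y in K, F (x, y) ∂μ := by
    intro x
    rw [setLIntegral_eq_of_support_subset]
    · rfl
    · intro y hy
      refine subset_tsupport _ (fun h => hy ?_)
      simp [F, h]
  have hIm : Measurable (convI μ f g) := by
    rw [show convI μ f g = fun x => ∫⁻ y in K, F (x, y) ∂μ from funext hI]
    exact hFm.lintegral_prod_right'
  refine ⟨hIm, ?_⟩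
  have hinner : ∀ y, ∫⁻ x, F (x, y) ∂ν ≤ w y * ‖f y‖ₑ * eLpNorm g 1 ν := by
    intro y
    simp only [F]
    rw [lintegral_const_mul' _ _ enorm_ne_top, mul_comm (w y : ℝ≥0∞), mul_assoc]
    gcongr
    rw [hν, lintegral_wMeasure, ← lintegral_mul_left_eq_self _ y, eLpNorm_one_eq_lintegral_enorm,
      lintegral_wMeasure, ← lintegral_const_mul' _ _ ENNReal.coe_ne_top]
    refine lintegral_mono fun x => ?_
    simp only [inv_mul_cancel_left]
    rw [← mul_assoc]
    gcongr
    exact_mod_cast w.mul_le' y x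
  calc ∫⁻ x, convI μ f g x ∂ν = ∫⁻ x in L, convI μ f g x ∂ν := by
        rw [setLIntegral_eq_of_support_subset]
        intro x hx
        by_contra hxL
        apply hx
        rw [convI, lintegral_eq_zero_iff']
        · refine Eventually.of_forall fun y => ?_
          by_contra h
          simp only [Pi.zero_apply, mul_eq_zero, not_or, enorm_eq_zero] at h
          exact hxL ⟨y, subset_tsupport _ h.1, y⁻¹ * x, subset_tsupport _ h.2, by simp⟩
        · exact (show Continuous fun y => ‖f y‖ₑ * ‖g (y⁻¹ * x)‖ₑ by
            have : (fun y => ‖f y‖ₑ * ‖g (y⁻¹ * x)‖ₑ) = fun y => ENNReal.ofReal (F' (x, y)) := by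
              funext y; exact congrFun hFF (x, y)
            rw [this]
            exact ENNReal.continuous_ofReal.comp (hF'.comp (by fun_prop))).measurable.aemeasurable
    _ = ∫⁻ x in L, ∫⁻ y in K, F (x, y) ∂μ ∂ν := by simp_rw [hI]
    _ = ∫⁻ y in K, ∫⁻ x in L, F (x, y) ∂ν ∂μ :=
        lintegral_lintegral_swap hFm.aemeasurable
    _ ≤ ∫⁻ y in K, w y * ‖f y‖ₑ * eLpNorm g 1 ν ∂μ :=
        lintegral_mono fun y => (setLIntegral_le_lintegral _ _).trans (hinner y)
    _ ≤ ∫⁻ y, w y * ‖f y‖ₑ * eLpNorm g 1 ν ∂μ := setLIntegral_le_lintegral _ _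
    _ = eLpNorm f 1 ν * eLpNorm g 1 ν := by
        have hne : eLpNorm g 1 ν ≠ ∞ :=
          (hg.memLp_of_hasCompactSupport (μ := ν) (p := 1) hg').eLpNorm_ne_top
        rw [lintegral_mul_const' _ _ hne, eLpNorm_one_eq_lintegral_enorm (f := f), hν,
          lintegral_wMeasure μ w (fun x => ‖f x‖ₑ)]

/-- Pointwise approximation by compactly supported continuous functions. -/
theorem exists_cc_seq {f : G → A} (hf : MemLp f 1 (wMeasure μ w)) {ε : ℝ≥0} (hε : 0 < ε) :
    ∃ ψ : ℕ → G → A, (∀ n, Continuous (ψ n)) ∧ (∀ n, HasCompactSupport (ψ n)) ∧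
      (∀ n, eLpNorm (f - ψ n) 1 (wMeasure μ w) ≤ ε * 2⁻¹ ^ n) ∧
      (∀ᵐ x ∂μ, Tendsto (fun n => ψ n x) atTop (𝓝 (f x))) := by
  have hpos : ∀ n : ℕ, (ε : ℝ≥0∞) * 2⁻¹ ^ n ≠ 0 := fun n =>
    mul_ne_zero (by exact_mod_cast hε.ne') (pow_ne_zero _ (by simp))
  choose ψ h1 h2 h3 using fun n : ℕ => exists_cc_approx μ w hf (hpos n)
  have ht0 : Tendsto (fun n : ℕ => (ε : ℝ≥0∞) * 2⁻¹ ^ n) atTop (𝓝 0) := by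
    have := ENNReal.Tendsto.const_mul (a := (ε : ℝ≥0∞))
      (ENNReal.tendsto_pow_atTop_nhds_zero_of_lt_one (r := 2⁻¹) (by simp))
      (Or.inr ENNReal.coe_ne_top)
    simpa using this
  have ht : Tendsto (fun n => eLpNorm (ψ n - f) 1 (wMeasure μ w)) atTop (𝓝 0) := by
    refine tendsto_of_tendsto_of_tendsto_of_le_of_le tendsto_const_nhds ht0
      (fun n => zero_le) (fun n => ?_)
    rw [eLpNorm_sub_comm]
    exact h1 n
  obtain ⟨ns, hns, hae⟩ := (tendstoInMeasure_of_tendsto_eLpNorm one_ne_zero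
    (fun n => ((h2 n).stronglyMeasurable_of_hasCompactSupport (h3 n)).aestronglyMeasurable)
    hf.aestronglyMeasurable ht).exists_seq_tendsto_ae
  refine ⟨fun n => ψ (ns n), fun n => h2 _, fun n => h3 _, fun n => (h1 _).trans ?_,
    (ac_wMeasure μ w).ae_le hae⟩
  exact mul_le_mul_right
    (pow_le_pow_right_of_le_one' (show (2⁻¹ : ℝ≥0∞) ≤ 1 by simp) (hns.id_le n)) _

/-- A dominating series of compactly supported continuous functions. -/
theorem exists_cc_series {f : G → A} (hf : MemLp f 1 (wMeasure μ w)) {ε : ℝ≥0} (hε : 0 < ε) :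
    ∃ φ : ℕ → G → A, (∀ n, Continuous (φ n)) ∧ (∀ n, HasCompactSupport (φ n)) ∧
      (∑' n, eLpNorm (φ n) 1 (wMeasure μ w) ≤ eLpNorm f 1 (wMeasure μ w) + ε) ∧
      (∀ᵐ x ∂μ, ‖f x‖ₑ ≤ ∑' n, ‖φ n x‖ₑ) := by
  obtain ⟨ψ, hc, hs, hn, ht⟩ := exists_cc_seq μ w hf (ε := ε / 8) (by positivity)
  have hψ : ∀ n, AEStronglyMeasurable (ψ n) (wMeasure μ w) := fun n =>
    ((hc n).stronglyMeasurable_of_hasCompactSupport (hs n)).aestronglyMeasurable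
  have hfm := hf.aestronglyMeasurable
  let φ : ℕ → G → A := fun n => Nat.casesOn n (ψ 0) (fun n => ψ (n + 1) - ψ n)
  have hsum : ∀ n, ∑ i ∈ Finset.range (n + 1), φ i = ψ n := by
    intro n
    rw [Finset.sum_range_succ']
    simp only [φ]
    rw [Finset.sum_range_sub ψ]
    simp
  refine ⟨φ, ?_, ?_, ?_, ?_⟩
  · rintro (_ | n)
    · exact hc 0
    · exact (hc (n + 1)).sub (hc n)
  · rintro (_ | n)
    · exact hs 0
    · exact (hs (n + 1)).sub (hs n)
  · have e0 : eLpNorm (φ 0) 1 (wMeasure μ w) ≤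
        eLpNorm f 1 (wMeasure μ w) + (ε / 8 : ℝ≥0) := by
      have : φ 0 = f - (f - ψ 0) := by simp [φ]
      rw [this]
      refine (eLpNorm_sub_le hfm (hfm.sub (hψ 0)) le_rfl).trans ?_
      gcongr
      simpa using hn 0
    have e1 : ∀ n, eLpNorm (φ (n + 1)) 1 (wMeasure μ w) ≤ (ε / 4 : ℝ≥0) * 2⁻¹ ^ n := by
      intro n
      have : φ (n + 1) = (f - ψ n) - (f - ψ (n + 1)) := by simp [φ]
      rw [this]
      refine (eLpNorm_sub_le (hfm.sub (hψ _)) (hfm.sub (hψ _)) le_rfl).trans ?_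
      refine (add_le_add (hn n) (hn (n + 1))).trans ?_
      have h2 : (2⁻¹ : ℝ≥0∞) ^ (n + 1) ≤ 2⁻¹ ^ n :=
        pow_le_pow_right_of_le_one' (show (2⁻¹ : ℝ≥0∞) ≤ 1 by simp) (Nat.le_succ n)
      calc _ ≤ ((ε / 8 : ℝ≥0) : ℝ≥0∞) * 2⁻¹ ^ n + (ε / 8 : ℝ≥0) * 2⁻¹ ^ n := by gcongr
        _ = _ := by
          rw [← add_mul, ← ENNReal.coe_add]
          congr 2
          rw [← NNReal.coe_inj]; push_cast; ring
    rw [tsum_eq_zero_add' ENNReal.summable]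
    calc _ ≤ (eLpNorm f 1 (wMeasure μ w) + (ε / 8 : ℝ≥0)) + ∑' n : ℕ, ((ε / 4 : ℝ≥0) : ℝ≥0∞) * 2⁻¹ ^ n :=
          add_le_add e0 (ENNReal.tsum_le_tsum e1)
      _ = eLpNorm f 1 (wMeasure μ w) + (((ε / 8 : ℝ≥0) : ℝ≥0∞) + ((ε / 4 * 2 : ℝ≥0) : ℝ≥0∞)) := by
          rw [ENNReal.tsum_mul_left, ENNReal.tsum_geometric, ENNReal.one_sub_inv_two, inv_inv,
            add_assoc]
          rw [ENNReal.coe_mul]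
          rfl
      _ ≤ _ := by
          rw [← ENNReal.coe_add]
          gcongr
          rw [← NNReal.coe_le_coe]
          push_cast
          have : (0 : ℝ) ≤ ε := ε.2
          linarith
  · filter_upwards [ht] with x hx
    refine le_of_tendsto hx.enorm (Eventually.of_forall fun n => ?_)
    rw [← hsum n, Finset.sum_apply]
    exact (enorm_sum_le _ _).trans (ENNReal.sum_le_tsum _)

end Conv
end Beurling

namespace Beurling
section Conv2
set_option linter.unusedSectionVars false

variable {G : Type*} [Group G] [TopologicalSpace G] [IsTopologicalGroup G] [T2Space G]
  [LocallyCompactSpace G] [MeasurableSpace G] [BorelSpace G]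
  (μ : Measure G) [μ.IsHaarMeasure] [μ.Regular] (w : Weight G)
  {A : Type*} [NonUnitalNormedRing A] [NormedSpace ℂ A] [IsScalarTower ℂ A A]
  [SMulCommClass ℂ A A]

theorem ae_ae_comp {φ : ℕ → G → A} (hφ : ∀ n, HasCompactSupport (φ n)) {p : G → Prop}
    (hp : ∀ᵐ x ∂μ, p x) (x : G) :
    ∀ᵐ y ∂μ, (∀ n, φ n y = 0) ∨ p (y⁻¹ * x) := by
  have h : ∀ n, ∀ᵐ y ∂μ, y ∈ tsupport (φ n) → y⁻¹ * x ∉ {z | ¬ p z} :=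
    fun n => ae_inv_mul_notMem μ hp (hφ n) x
  filter_upwards [ae_all_iff.2 h] with y hy
  by_cases h0 : ∀ n, φ n y = 0
  · exact Or.inl h0
  · right
    push Not at h0
    obtain ⟨n, hn⟩ := h0
    have := hy n (subset_tsupport _ hn)
    simpa using this

theorem exists_convI_le {f g : G → A} (hf : MemLp f 1 (wMeasure μ w))
    (hg : MemLp g 1 (wMeasure μ w)) {ε : ℝ≥0} (hε : 0 < ε) :
    ∃ J : G → ℝ≥0∞, Measurable J ∧ (∀ x, convI μ f g x ≤ J x) ∧
      ∫⁻ x, J x ∂(wMeasure μ w) ≤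
        (eLpNorm f 1 (wMeasure μ w) + ε) * (eLpNorm g 1 (wMeasure μ w) + ε) := by
  obtain ⟨φ, φc, φs, φn, hφ⟩ := exists_cc_series μ w hf hε
  obtain ⟨γ, γc, γs, γn, hγ⟩ := exists_cc_series μ w hg hε
  refine ⟨fun x => ∑' n, ∑' m, convI μ (φ n) (γ m) x, ?_, ?_, ?_⟩
  · exact Measurable.tsum fun n => Measurable.tsum fun m =>
      (convI_cc μ w (φc n) (φs n) (γc m) (γs m)).1
  · intro x
    have hm : ∀ n m, Measurable fun y => ‖φ n y‖ₑ * ‖γ m (y⁻¹ * x)‖ₑ := fun n m =>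
      (φc n).enorm.measurable.mul ((γc m).comp (by fun_prop)).enorm.measurable
    calc convI μ f g x ≤ ∫⁻ y, ∑' n, ∑' m, ‖φ n y‖ₑ * ‖γ m (y⁻¹ * x)‖ₑ ∂μ := by
          refine lintegral_mono_ae ?_
          filter_upwards [hφ, ae_ae_comp μ φs hγ x] with y hy1 hy2
          simp_rw [ENNReal.tsum_mul_left, ENNReal.tsum_mul_right]
          rcases hy2 with h0 | h
          · have : ‖f y‖ₑ = 0 := le_antisymm (hy1.trans (by simp [h0])) zero_le
            simp [this]
          · exact mul_le_mul' hy1 h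
      _ = ∑' n, ∑' m, convI μ (φ n) (γ m) x := by
          rw [lintegral_tsum fun n => (Measurable.tsum fun m => hm n m).aemeasurable]
          congr with n
          rw [lintegral_tsum fun m => (hm n m).aemeasurable]
          rfl
  · rw [lintegral_tsum fun n => (Measurable.tsum fun m =>
      (convI_cc μ w (φc n) (φs n) (γc m) (γs m)).1).aemeasurable]
    calc _ ≤ ∑' n, ∑' m, eLpNorm (φ n) 1 (wMeasure μ w) * eLpNorm (γ m) 1 (wMeasure μ w) := by
          refine ENNReal.tsum_le_tsum fun n => ?_
          rw [lintegral_tsum fun m => (convI_cc μ w (φc n) (φs n) (γc m) (γs m)).1.aemeasurable]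
          exact ENNReal.tsum_le_tsum fun m => (convI_cc μ w (φc n) (φs n) (γc m) (γs m)).2
      _ = (∑' n, eLpNorm (φ n) 1 (wMeasure μ w)) * ∑' m, eLpNorm (γ m) 1 (wMeasure μ w) := by
          simp_rw [ENNReal.tsum_mul_left, ENNReal.tsum_mul_right]
      _ ≤ _ := mul_le_mul' φn γn

/-- For almost every `x` the integral defining `(f * g)(x)` converges absolutely. -/
theorem ae_integrable_conv {f g : G → A} (hf : MemLp f 1 (wMeasure μ w))
    (hg : MemLp g 1 (wMeasure μ w)) :
    ∀ᵐ x ∂μ, Integrable (fun y => f y * g (y⁻¹ * x)) μ := by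
  obtain ⟨φ, φc, φs, -, hφ⟩ := exists_cc_seq μ w hf one_pos
  obtain ⟨γ, γc, γs, -, hγ⟩ := exists_cc_seq μ w hg one_pos
  obtain ⟨J, hJm, hJ, hJi⟩ := exists_convI_le μ w hf hg one_pos
  have hfin : ∀ᵐ x ∂(wMeasure μ w), J x < ∞ := by
    refine ae_lt_top hJm (hJi.trans_lt ?_).ne
    exact ENNReal.mul_lt_top (ENNReal.add_lt_top.2 ⟨hf.eLpNorm_lt_top, by simp⟩)
      (ENNReal.add_lt_top.2 ⟨hg.eLpNorm_lt_top, by simp⟩)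
  filter_upwards [(ac_wMeasure μ w).ae_le hfin] with x hx
  refine ⟨?_, ?_⟩
  · refine aestronglyMeasurable_of_tendsto_ae atTop
      (f := fun n y => φ n y * γ n (y⁻¹ * x)) (fun n => ?_) ?_
    · refine (Continuous.stronglyMeasurable_of_hasCompactSupport ?_ ?_).aestronglyMeasurable
      · exact (φc n).mul ((γc n).comp (by fun_prop))
      · exact (φs n).mul_right
    · filter_upwards [hφ, ae_ae_comp μ φs hγ x] with y hy1 hy2
      rcases hy2 with h0 | h
      · have : f y = 0 := tendsto_nhds_unique hy1 (by simp [h0])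
        simp [h0, this]
      · exact hy1.mul h
  · refine lt_of_le_of_lt (lintegral_mono fun y => enorm_mul_le' _ _) ((hJ x).trans_lt hx)

theorem ae_integrable_conv' {f g : G → A} (hf : MemLp f 1 (wMeasure μ w))
    (hg : MemLp g 1 (wMeasure μ w)) :
    ∀ᵐ x ∂μ, Integrable (fun y => f (x * y) * g y⁻¹) μ := by
  filter_upwards [ae_integrable_conv μ w hf hg] with x hx
  simpa using hx.comp_mul_left x

theorem conv_add_ae {f g h : G → A} (hf : MemLp f 1 (wMeasure μ w))
    (hg : MemLp g 1 (wMeasure μ w)) (hh : MemLp h 1 (wMeasure μ w)) :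
    conv μ f (g + h) =ᵐ[μ] conv μ f g + conv μ f h := by
  filter_upwards [ae_integrable_conv' μ w hf hg, ae_integrable_conv' μ w hf hh] with x h1 h2
  simp only [conv, Pi.add_apply, mul_add]
  exact integral_add h1 h2

theorem add_conv_ae {f g h : G → A} (hf : MemLp f 1 (wMeasure μ w))
    (hg : MemLp g 1 (wMeasure μ w)) (hh : MemLp h 1 (wMeasure μ w)) :
    conv μ (f + g) h =ᵐ[μ] conv μ f h + conv μ g h := by
  filter_upwards [ae_integrable_conv' μ w hf hh, ae_integrable_conv' μ w hg hh] with x h1 h2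
  simp only [conv, Pi.add_apply, add_mul]
  exact integral_add h1 h2

theorem smul_conv (c : ℂ) (f g : G → A) : conv μ (c • f) g = c • conv μ f g := by
  funext x
  simp only [conv, Pi.smul_apply, smul_mul_assoc]
  exact integral_smul c _

theorem conv_smul (c : ℂ) (f g : G → A) : conv μ f (c • g) = c • conv μ f g := by
  funext x
  simp only [conv, Pi.smul_apply, mul_smul_comm]
  exact integral_smul c _

theorem continuous_conv {f g : G → A} (hf : Continuous f) (hf' : HasCompactSupport f)
    (hg : Continuous g) (hg' : HasCompactSupport g) :
    Continuous (conv μ f g) ∧ HasCompactSupport (conv μ f g) := by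
  have he : conv μ f g = fun x => ∫ y, f y * g (y⁻¹ * x) ∂μ := funext (conv_eq μ f g)
  constructor
  · rw [he, ← continuousOn_univ]
    refine continuousOn_integral_of_compact_support hf'.isCompact
      (f := fun x y => f y * g (y⁻¹ * x)) ?_ ?_
    · refine Continuous.continuousOn ?_
      simp only [Function.uncurry_def]
      fun_prop
    · intro x y _ hy
      simp [image_eq_zero_of_notMem_tsupport hy]
  · refine HasCompactSupport.intro (hf'.isCompact.mul hg'.isCompact) fun x hx => ?_
    rw [conv_eq]
    refine integral_eq_zero_of_ae (Eventually.of_forall fun y => ?_)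
    by_contra h
    refine hx ⟨y, subset_tsupport _ (left_ne_zero_of_mul h), y⁻¹ * x,
      subset_tsupport _ (right_ne_zero_of_mul h), by simp⟩

/-- The difference of two convolutions. -/
theorem ae_enorm_conv_sub_le {f g f' g' : G → A} (hf : MemLp f 1 (wMeasure μ w))
    (hg : MemLp g 1 (wMeasure μ w)) (hf' : MemLp f' 1 (wMeasure μ w))
    (hg' : MemLp g' 1 (wMeasure μ w)) {ε : ℝ≥0} (hε : 0 < ε) :
    ∃ J : G → ℝ≥0∞, Measurable J ∧ (∀ᵐ x ∂μ, ‖conv μ f g x - conv μ f' g' x‖ₑ ≤ J x) ∧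
      ∫⁻ x, J x ∂(wMeasure μ w) ≤
        (eLpNorm (f - f') 1 (wMeasure μ w) + ε) * (eLpNorm g 1 (wMeasure μ w) + ε) +
        (eLpNorm f' 1 (wMeasure μ w) + ε) * (eLpNorm (g - g') 1 (wMeasure μ w) + ε) := by
  obtain ⟨J1, m1, h1, i1⟩ := exists_convI_le μ w (hf.sub hf') hg hε
  obtain ⟨J2, m2, h2, i2⟩ := exists_convI_le μ w hf' (hg.sub hg') hε
  refine ⟨J1 + J2, m1.add m2, ?_, ?_⟩
  · filter_upwards [add_conv_ae μ w (hf.sub hf') hf' hg, conv_add_ae μ w hf' (hg.sub hg') hg']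
      with x hx1 hx2
    rw [sub_add_cancel] at hx1 hx2
    have : conv μ f g x - conv μ f' g' x = conv μ (f - f') g x + conv μ f' (g - g') x := by
      rw [hx1, Pi.add_apply]
      have := hx2
      rw [Pi.add_apply] at this
      rw [this]
      abel
    rw [this]
    exact (enorm_add_le _ _).trans (add_le_add ((enorm_conv_le μ _ _ x).trans (h1 x))
      ((enorm_conv_le μ _ _ x).trans (h2 x)))
  · simp only [Pi.add_apply]
    rw [lintegral_add_left m1]
    exact add_le_add i1 i2

theorem conv_congr_ae {f g f' g' : G → A} (hf : MemLp f 1 (wMeasure μ w))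
    (hg : MemLp g 1 (wMeasure μ w)) (hff : f =ᵐ[μ] f') (hgg : g =ᵐ[μ] g') :
    conv μ f g =ᵐ[μ] conv μ f' g' := by
  have hff' := (wMeasure_ac μ w).ae_le hff
  have hgg' := (wMeasure_ac μ w).ae_le hgg
  have hf' : MemLp f' 1 (wMeasure μ w) := hf.ae_eq hff'
  have hg' : MemLp g' 1 (wMeasure μ w) := hg.ae_eq hgg'
  obtain ⟨φ, φc, φs, -, hφ⟩ := exists_cc_seq μ w hf one_pos
  filter_upwards [] with x
  rw [conv_eq, conv_eq]
  refine integral_congr_ae ?_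
  filter_upwards [hφ, hff, ae_ae_comp μ φs hgg x] with y h1 h2 h3
  rcases h3 with h0 | h
  · have : f y = 0 := tendsto_nhds_unique h1 (by simp [h0])
    simp [← h2, this]
  · rw [h2, h]

theorem aestronglyMeasurable_conv {f g : G → A} (hf : MemLp f 1 (wMeasure μ w))
    (hg : MemLp g 1 (wMeasure μ w)) : AEStronglyMeasurable (conv μ f g) (wMeasure μ w) := by
  set ν := wMeasure μ w with hν
  obtain ⟨φ, φc, φs, hφ, -⟩ := exists_cc_seq μ w hf one_pos
  obtain ⟨γ, γc, γs, hγ, -⟩ := exists_cc_seq μ w hg one_pos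
  rw [← hν] at hφ hγ
  have φm : ∀ n, MemLp (φ n) 1 ν := fun n => (φc n).memLp_of_hasCompactSupport (φs n)
  have γm : ∀ n, MemLp (γ n) 1 ν := fun n => (γc n).memLp_of_hasCompactSupport (γs n)
  choose J Jm Jle Ji using fun n : ℕ => ae_enorm_conv_sub_le μ w hf hg (φm n) (γm n)
    (ε := 2⁻¹ ^ n) (by positivity)
  have hc : ∀ n : ℕ, (((2⁻¹ : ℝ≥0) ^ n : ℝ≥0) : ℝ≥0∞) = 2⁻¹ ^ n := by
    intro n
    rw [ENNReal.coe_pow, ENNReal.coe_inv two_ne_zero]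
    rfl
  have hp1 : ∀ n : ℕ, (2⁻¹ : ℝ≥0∞) ^ n ≤ 1 := fun n => pow_le_one' (by simp) n
  let C : ℝ≥0∞ := 2 * (eLpNorm g 1 ν + 1) + (eLpNorm f 1 ν + 2) * 2
  have hC : C ≠ ∞ := by
    refine ENNReal.add_ne_top.2 ⟨ENNReal.mul_ne_top (by simp) ?_, ENNReal.mul_ne_top ?_ (by simp)⟩
    · exact ENNReal.add_ne_top.2 ⟨hg.eLpNorm_ne_top, by simp⟩
    · exact ENNReal.add_ne_top.2 ⟨hf.eLpNorm_ne_top, by simp⟩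
  have hJ : ∀ n, ∫⁻ x, J n x ∂ν ≤ 2⁻¹ ^ n * C := by
    intro n
    refine (Ji n).trans ?_
    rw [hc]
    have a1 := hφ n
    have a2 := hγ n
    rw [ENNReal.coe_one, one_mul] at a1 a2
    have a3 : eLpNorm (φ n) 1 ν ≤ eLpNorm f 1 ν + 1 := by
      have : φ n = f - (f - φ n) := by simp
      rw [this]
      refine (eLpNorm_sub_le hf.1 (hf.1.sub (φm n).1) le_rfl).trans ?_
      gcongr
      exact a1.trans (hp1 n)
    calc _ ≤ (2⁻¹ ^ n + 2⁻¹ ^ n) * (eLpNorm g 1 ν + 1) +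
          ((eLpNorm f 1 ν + 1) + 1) * (2⁻¹ ^ n + 2⁻¹ ^ n) := by
            gcongr
            · exact hp1 n
            · exact hp1 n
      _ = 2⁻¹ ^ n * C := by
          simp only [C]
          rw [add_assoc (eLpNorm f 1 ν), one_add_one_eq_two]
          ring
  have hsum : ∫⁻ x, ∑' n, J n x ∂ν ≠ ∞ := by
    rw [lintegral_tsum fun n => (Jm n).aemeasurable]
    refine ((ENNReal.tsum_le_tsum hJ).trans_lt ?_).ne
    rw [ENNReal.tsum_mul_right, ENNReal.tsum_geometric, ENNReal.one_sub_inv_two, inv_inv]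
    exact ENNReal.mul_lt_top (by simp) hC.lt_top
  have hfin := ae_lt_top (Measurable.tsum Jm) hsum
  have hle : ∀ᵐ x ∂ν, ∀ n, ‖conv μ f g x - conv μ (φ n) (γ n) x‖ₑ ≤ J n x :=
    (wMeasure_ac μ w).ae_le (ae_all_iff.2 Jle)
  refine aestronglyMeasurable_of_tendsto_ae atTop (f := fun n => conv μ (φ n) (γ n))
    (fun n => ?_) ?_
  · obtain ⟨h1, h2⟩ := continuous_conv μ (φc n) (φs n) (γc n) (γs n)
    exact (h1.stronglyMeasurable_of_hasCompactSupport h2).aestronglyMeasurable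
  · filter_upwards [hfin, hle] with x hx hxle
    have h0 : Tendsto (fun n => J n x) atTop (𝓝 0) :=
      ENNReal.tendsto_atTop_zero_of_tsum_ne_top hx.ne
    rw [tendsto_iff_edist_tendsto_0]
    refine tendsto_of_tendsto_of_tendsto_of_le_of_le tendsto_const_nhds h0
      (fun n => zero_le) (fun n => ?_)
    rw [edist_comm, edist_eq_enorm_sub]
    exact hxle n

theorem eLpNorm_conv_le {f g : G → A} (hf : MemLp f 1 (wMeasure μ w))
    (hg : MemLp g 1 (wMeasure μ w)) :
    eLpNorm (conv μ f g) 1 (wMeasure μ w) ≤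
      eLpNorm f 1 (wMeasure μ w) * eLpNorm g 1 (wMeasure μ w) := by
  set a := eLpNorm f 1 (wMeasure μ w) with ha
  set b := eLpNorm g 1 (wMeasure μ w) with hb
  have ha' : a ≠ ∞ := hf.eLpNorm_ne_top
  have hb' : b ≠ ∞ := hg.eLpNorm_ne_top
  have key : ∀ n : ℕ, eLpNorm (conv μ f g) 1 (wMeasure μ w) ≤
      (a + ((n + 1 : ℝ≥0)⁻¹ : ℝ≥0)) * (b + ((n + 1 : ℝ≥0)⁻¹ : ℝ≥0)) := by
    intro n
    obtain ⟨J, -, hJ, hi⟩ := exists_convI_le μ w hf hg (ε := (n + 1 : ℝ≥0)⁻¹) (by positivity)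
    rw [eLpNorm_one_eq_lintegral_enorm]
    exact (lintegral_mono fun x => (enorm_conv_le μ f g x).trans (hJ x)).trans hi
  have ht : Tendsto (fun n : ℕ => (((n + 1 : ℝ≥0)⁻¹ : ℝ≥0) : ℝ≥0∞)) atTop (𝓝 0) := by
    rw [← ENNReal.coe_zero, ENNReal.tendsto_coe]
    simpa using (tendsto_one_div_add_atTop_nhds_zero_nat (𝕜 := ℝ≥0))
  have ht2 : Tendsto (fun n : ℕ => (a + ((n + 1 : ℝ≥0)⁻¹ : ℝ≥0)) * (b + ((n + 1 : ℝ≥0)⁻¹ : ℝ≥0)))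
      atTop (𝓝 (a * b)) := by
    have h1 := (tendsto_const_nhds (x := a)).add ht
    have h2 := (tendsto_const_nhds (x := b)).add ht
    rw [add_zero] at h1 h2
    exact ENNReal.Tendsto.mul h1 (Or.inr hb') h2 (Or.inr ha')
  exact ge_of_tendsto' ht2 key

/-- The weighted `L¹` space is closed under convolution. -/
theorem memLp_conv {f g : G → A} (hf : MemLp f 1 (wMeasure μ w))
    (hg : MemLp g 1 (wMeasure μ w)) : MemLp (conv μ f g) 1 (wMeasure μ w) :=
  ⟨aestronglyMeasurable_conv μ w hf hg, (eLpNorm_conv_le μ w hf hg).trans_lt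
    (ENNReal.mul_lt_top hf.eLpNorm_lt_top hg.eLpNorm_lt_top)⟩

theorem conv_assoc_cc [CompleteSpace A] {f g h : G → A}
    (hf : Continuous f) (hf' : HasCompactSupport f)
    (hg : Continuous g) (hg' : HasCompactSupport g)
    (hh : Continuous h) :
    conv μ (conv μ f g) h = conv μ f (conv μ g h) := by
  have hint : ∀ {p q : G → A}, Continuous p → HasCompactSupport p → Continuous q → ∀ x,
      Integrable (fun y => p y * q (y⁻¹ * x)) μ := by
    intro p q hp hp' hq x
    exact Continuous.integrable_of_hasCompactSupport (hp.mul (hq.comp (by fun_prop)))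
      hp'.mul_right
  funext x
  rw [conv_eq, conv_eq]
  calc ∫ y, conv μ f g y * h (y⁻¹ * x) ∂μ
      = ∫ y, ∫ z, f z * g (z⁻¹ * y) * h (y⁻¹ * x) ∂μ ∂μ := by
        congr with y
        rw [conv_eq, integral_mul_const_of_integrable (hint hf hf' hg y)]
    _ = ∫ z, ∫ y, f z * g (z⁻¹ * y) * h (y⁻¹ * x) ∂μ ∂μ := by
        refine integral_integral_swap_of_hasCompactSupport ?_ ?_
        · simp only [Function.uncurry_def]
          fun_prop
        · refine hasCompactSupport_aux hf' hg' _ ?_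
          rintro y z (h | h) <;> simp [Function.uncurry, h]
    _ = ∫ z, f z * conv μ g h (z⁻¹ * x) ∂μ := by
        congr with z
        rw [conv_eq, ← integral_const_mul_of_integrable (hint hg hg' hh _),
          ← integral_mul_left_eq_self _ z]
        simp [mul_assoc]

end Conv2
end Beurling

namespace Beurling

/-- The space `L¹_w(G, E)` of (classes of) Bochner measurable functions `f : G → E` with
`∫ ‖f(x)‖ w(x) dx < ∞`. -/
def L1w {G : Type*} [Group G] [MeasurableSpace G] (μ : Measure G) (w : Weight G)
    (E : Type*) [NormedAddCommGroup E] : Type _ :=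
  Lp E 1 (wMeasure μ w)

section L1w
set_option linter.unusedSectionVars false

section Space

variable {G : Type*} [Group G] [MeasurableSpace G] (μ : Measure G) (w : Weight G)
  {E : Type*} [NormedAddCommGroup E]

noncomputable instance : NormedAddCommGroup (L1w μ w E) :=
  inferInstanceAs (NormedAddCommGroup (Lp E 1 (wMeasure μ w)))

noncomputable instance [NormedSpace ℂ E] : NormedSpace ℂ (L1w μ w E) :=
  inferInstanceAs (NormedSpace ℂ (Lp E 1 (wMeasure μ w)))

instance [CompleteSpace E] : CompleteSpace (L1w μ w E) :=
  inferInstanceAs (CompleteSpace (Lp E 1 (wMeasure μ w)))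

variable {μ w}

/-- A representative of a class. -/
noncomputable def L1w.toFun : L1w μ w E → G → E :=
  fun f : Lp E 1 (wMeasure μ w) => (f : G → E)

noncomputable instance : CoeFun (L1w μ w E) (fun _ => G → E) := ⟨L1w.toFun⟩

theorem L1w.memLp (f : L1w μ w E) : MemLp (f : G → E) 1 (wMeasure μ w) := Lp.memLp _

/-- The class of a function. -/
noncomputable def L1w.mk (f : G → E) (hf : MemLp f 1 (wMeasure μ w)) : L1w μ w E := hf.toLp f

theorem L1w.coe_mk (f : G → E) (hf : MemLp f 1 (wMeasure μ w)) :
    (L1w.mk f hf : G → E) =ᵐ[μ] f :=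
  (ac_wMeasure μ w).ae_le hf.coeFn_toLp

theorem L1w.ext {f g : L1w μ w E} (h : (f : G → E) =ᵐ[μ] g) : f = g :=
  Lp.ext ((wMeasure_ac μ w).ae_le h)

theorem L1w.coe_add (f g : L1w μ w E) : ((f + g : L1w μ w E) : G → E) =ᵐ[μ] f + g :=
  (ac_wMeasure μ w).ae_le (Lp.coeFn_add _ _)

theorem L1w.coe_smul [NormedSpace ℂ E] (c : ℂ) (f : L1w μ w E) :
    ((c • f : L1w μ w E) : G → E) =ᵐ[μ] c • (f : G → E) :=
  (ac_wMeasure μ w).ae_le (Lp.coeFn_smul c (show Lp E 1 (wMeasure μ w) from f))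

theorem L1w.norm_eq_eLpNorm (f : L1w μ w E) :
    ‖f‖ = (eLpNorm (f : G → E) 1 (wMeasure μ w)).toReal := Lp.norm_def _

/-- The norm is `∫ ‖f(x)‖ w(x) dx`. -/
theorem L1w.norm_eq (f : L1w μ w E) : ‖f‖ = ∫ x, ‖f x‖ * w x ∂μ := by
  have hm : AEStronglyMeasurable (f : G → E) μ :=
    f.memLp.aestronglyMeasurable.mono_ac (ac_wMeasure μ w)
  have hw : AEStronglyMeasurable (fun x => (w x : ℝ)) μ :=
    w.measurable'.coe_nnreal_real.aestronglyMeasurable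
  rw [L1w.norm_eq_eLpNorm, eLpNorm_one_eq_lintegral_enorm, lintegral_wMeasure,
    integral_eq_lintegral_of_nonneg_ae (f := fun x => ‖f x‖ * w x)
      (Eventually.of_forall fun x => by positivity) (hm.norm.mul hw)]
  congr 2
  funext x
  rw [ENNReal.ofReal_mul (norm_nonneg _), ofReal_norm, ENNReal.ofReal_coe_nnreal, mul_comm]

end Space

section Ring

variable {G : Type*} [Group G] [TopologicalSpace G] [IsTopologicalGroup G] [T2Space G]
  [LocallyCompactSpace G] [MeasurableSpace G] [BorelSpace G]
  {μ : Measure G} [μ.IsHaarMeasure] [μ.Regular] {w : Weight G}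
  {A : Type*} [NonUnitalNormedRing A] [NormedSpace ℂ A] [IsScalarTower ℂ A A]
  [SMulCommClass ℂ A A]

/-- The convolution product on `L¹_w(G, A)`. -/
noncomputable def L1w.mul (f g : L1w μ w A) : L1w μ w A :=
  L1w.mk (conv μ f g) (memLp_conv μ w f.memLp g.memLp)

theorem L1w.coe_mul' (f g : L1w μ w A) : (L1w.mul f g : G → A) =ᵐ[μ] conv μ f g :=
  L1w.coe_mk _ _

theorem L1w.norm_mul_le' (f g : L1w μ w A) : ‖L1w.mul f g‖ ≤ ‖f‖ * ‖g‖ := by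
  rw [L1w.norm_eq_eLpNorm, L1w.norm_eq_eLpNorm f, L1w.norm_eq_eLpNorm g, ← ENNReal.toReal_mul,
    eLpNorm_congr_ae ((wMeasure_ac μ w).ae_le (L1w.coe_mul' f g))]
  exact ENNReal.toReal_mono
    (ENNReal.mul_ne_top f.memLp.eLpNorm_ne_top g.memLp.eLpNorm_ne_top)
    (eLpNorm_conv_le μ w f.memLp g.memLp)

theorem L1w.conv_congr {f g : L1w μ w A} {f' g' : G → A} (hf : (f : G → A) =ᵐ[μ] f')
    (hg : (g : G → A) =ᵐ[μ] g') : (L1w.mul f g : G → A) =ᵐ[μ] conv μ f' g' :=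
  (L1w.coe_mul' f g).trans (conv_congr_ae μ w f.memLp g.memLp hf hg)

theorem L1w.mul_add' (f g h : L1w μ w A) :
    L1w.mul f (g + h) = L1w.mul f g + L1w.mul f h :=
  L1w.ext <| (L1w.conv_congr (ae_eq_refl _) (L1w.coe_add g h)).trans <|
    (conv_add_ae μ w f.memLp g.memLp h.memLp).trans <|
      (((L1w.coe_mul' f g).add (L1w.coe_mul' f h)).symm.trans (L1w.coe_add _ _).symm)

theorem L1w.add_mul' (f g h : L1w μ w A) :
    L1w.mul (f + g) h = L1w.mul f h + L1w.mul g h :=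
  L1w.ext <| (L1w.conv_congr (L1w.coe_add f g) (ae_eq_refl _)).trans <|
    (add_conv_ae μ w f.memLp g.memLp h.memLp).trans <|
      (((L1w.coe_mul' f h).add (L1w.coe_mul' g h)).symm.trans (L1w.coe_add _ _).symm)

theorem L1w.smul_mul' (c : ℂ) (f g : L1w μ w A) : L1w.mul (c • f) g = c • L1w.mul f g := by
  refine L1w.ext <| (L1w.conv_congr (L1w.coe_smul c f) (ae_eq_refl _)).trans ?_
  rw [smul_conv]
  exact ((L1w.coe_mul' f g).const_smul c).symm.trans (L1w.coe_smul c _).symm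

theorem L1w.mul_smul' (c : ℂ) (f g : L1w μ w A) : L1w.mul f (c • g) = c • L1w.mul f g := by
  refine L1w.ext <| (L1w.conv_congr (ae_eq_refl _) (L1w.coe_smul c g)).trans ?_
  rw [conv_smul]
  exact ((L1w.coe_mul' f g).const_smul c).symm.trans (L1w.coe_smul c _).symm

theorem L1w.continuous_mul' :
    Continuous fun p : L1w μ w A × L1w μ w A => L1w.mul p.1 p.2 := by
  let B : L1w μ w A →ₗ[ℂ] L1w μ w A →ₗ[ℂ] L1w μ w A :=
    LinearMap.mk₂ ℂ L1w.mul L1w.add_mul' L1w.smul_mul' L1w.mul_add' L1w.mul_smul'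
  let B' := B.mkContinuous₂ 1 fun f g => by
    rw [one_mul]; exact L1w.norm_mul_le' f g
  exact B'.continuous₂

variable (μ w A) in
theorem L1w.denseRange_cc : DenseRange
    (fun f : {f : G → A // Continuous f ∧ HasCompactSupport f} =>
      (L1w.mk f.1 (f.2.1.memLp_of_hasCompactSupport f.2.2) : L1w μ w A)) := by
  intro f
  rw [Metric.mem_closure_range_iff]
  intro ε hε
  obtain ⟨g, hg, hc, hs⟩ := exists_cc_approx μ w f.memLp (ε := ENNReal.ofReal (ε / 2))
    (by simpa using hε)
  refine ⟨⟨g, hc, hs⟩, ?_⟩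
  have hgm : MemLp g 1 (wMeasure μ w) := hc.memLp_of_hasCompactSupport hs
  have h1 : dist f (L1w.mk g hgm) = (eLpNorm ((f : G → A) - g) 1 (wMeasure μ w)).toReal := by
    have : dist f (L1w.mk g hgm) = ‖f - L1w.mk g hgm‖ := dist_eq_norm _ _
    rw [this, L1w.norm_eq_eLpNorm]
    congr 1
    refine eLpNorm_congr_ae ?_
    exact (Lp.coeFn_sub _ _).trans ((ae_eq_refl _).sub hgm.coeFn_toLp)
  have h2 := ENNReal.toReal_mono (by simp) hg
  rw [ENNReal.toReal_ofReal (by positivity)] at h2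
  change dist f (L1w.mk g hgm) < ε
  rw [h1]
  linarith

theorem L1w.mul_assoc' [CompleteSpace A] (f g h : L1w μ w A) :
    L1w.mul (L1w.mul f g) h = L1w.mul f (L1w.mul g h) := by
  refine (L1w.denseRange_cc μ w A).induction_on₃
    (p := fun f g h => L1w.mul (L1w.mul f g) h = L1w.mul f (L1w.mul g h)) ?_ ?_ f g h
  · have hm := L1w.continuous_mul' (μ := μ) (w := w) (A := A)
    refine isClosed_eq ?_ ?_
    · exact hm.comp ((hm.comp (continuous_fst.prodMk (continuous_fst.comp continuous_snd))).prodMk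
        (continuous_snd.comp continuous_snd))
    · exact hm.comp (continuous_fst.prodMk (hm.comp continuous_snd))
  · rintro ⟨f, hf, hf'⟩ ⟨g, hg, hg'⟩ ⟨h, hh, hh'⟩
    refine L1w.ext ?_
    refine (L1w.conv_congr (L1w.conv_congr (L1w.coe_mk _ _) (L1w.coe_mk _ _))
      (L1w.coe_mk _ _)).trans ?_
    refine EventuallyEq.trans ?_ (L1w.conv_congr (L1w.coe_mk _ _)
      (L1w.conv_congr (L1w.coe_mk _ _) (L1w.coe_mk _ _))).symm
    rw [conv_assoc_cc μ hf hf' hg hg' hh]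

/-- `L¹_w(G, A)` is a Banach algebra under convolution. -/
noncomputable instance [CompleteSpace A] : NonUnitalNormedRing (L1w μ w A) :=
  { (inferInstance : NormedAddCommGroup (L1w μ w A)) with
    mul := L1w.mul
    left_distrib := L1w.mul_add'
    right_distrib := L1w.add_mul'
    zero_mul := fun f => by
      have := L1w.smul_mul' 0 (0 : L1w μ w A) f
      rw [zero_smul, zero_smul] at this
      exact this
    mul_zero := fun f => by
      have := L1w.mul_smul' 0 f (0 : L1w μ w A)
      rw [zero_smul, zero_smul] at this
      exact this
    mul_assoc := L1w.mul_assoc'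
    norm_mul_le := L1w.norm_mul_le' }

/-- The product is convolution. -/
theorem L1w.coe_mul [CompleteSpace A] (f g : L1w μ w A) :
    ((f * g : L1w μ w A) : G → A) =ᵐ[μ] conv μ f g :=
  L1w.coe_mul' f g

instance [CompleteSpace A] : IsScalarTower ℂ (L1w μ w A) (L1w μ w A) :=
  ⟨fun c f g => L1w.smul_mul' c f g⟩

instance [CompleteSpace A] : SMulCommClass ℂ (L1w μ w A) (L1w μ w A) :=
  ⟨fun c f g => (L1w.mul_smul' c f g).symm⟩

end Ring
end L1w
end Beurling

namespace Beurling

/-- The algebraic tensor product `E ⊗ F`, to be endowed with the projective seminorm. -/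
def AlgTensor (E F : Type*) [AddCommGroup E] [Module ℂ E] [AddCommGroup F] [Module ℂ F] : Type _ :=
  E ⊗[ℂ] F

section ProjectiveNorm
set_option linter.unusedSectionVars false

variable {E F : Type*} [NormedAddCommGroup E] [NormedSpace ℂ E]
  [NormedAddCommGroup F] [NormedSpace ℂ F]

noncomputable instance : AddCommGroup (AlgTensor E F) := inferInstanceAs (AddCommGroup (E ⊗[ℂ] F))

noncomputable instance : Module ℂ (AlgTensor E F) := inferInstanceAs (Module ℂ (E ⊗[ℂ] F))

/-- The elementary tensor `x ⊗ y`. -/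
noncomputable def AlgTensor.tmul (x : E) (y : F) : AlgTensor E F := x ⊗ₜ[ℂ] y

/-- The costs `∑ ‖xᵢ‖ ‖yᵢ‖` of the representations `u = ∑ xᵢ ⊗ yᵢ`. -/
def AlgTensor.costs (u : AlgTensor E F) : Set ℝ :=
  {r | ∃ l : List (E × F), (l.map fun p => AlgTensor.tmul p.1 p.2).sum = u ∧
    r = (l.map fun p => ‖p.1‖ * ‖p.2‖).sum}

theorem AlgTensor.cost_nonneg (l : List (E × F)) :
    0 ≤ (l.map fun p => ‖p.1‖ * ‖p.2‖).sum := by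
  refine List.sum_nonneg fun a ha => ?_
  obtain ⟨p, -, rfl⟩ := List.mem_map.1 ha
  positivity

theorem AlgTensor.costs_nonneg {u : AlgTensor E F} : ∀ r ∈ u.costs, 0 ≤ r := by
  rintro r ⟨l, -, rfl⟩
  exact AlgTensor.cost_nonneg l

theorem AlgTensor.costs_bddBelow (u : AlgTensor E F) : BddBelow u.costs :=
  ⟨0, AlgTensor.costs_nonneg⟩

theorem AlgTensor.costs_nonempty (u : AlgTensor E F) : u.costs.Nonempty := by
  suffices h : ∃ l : List (E × F), (l.map fun p => AlgTensor.tmul p.1 p.2).sum = u by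
    obtain ⟨l, hl⟩ := h
    exact ⟨_, l, hl, rfl⟩
  induction u using TensorProduct.induction_on with
  | zero => exact ⟨[], rfl⟩
  | tmul x y => exact ⟨[(x, y)], by simp; rfl⟩
  | add u v hu hv =>
    obtain ⟨l, hl⟩ := hu
    obtain ⟨m, hm⟩ := hv
    exact ⟨l ++ m, by rw [List.map_append, List.sum_append, hl, hm]; rfl⟩

/-- The projective seminorm, `‖u‖ = inf {∑ ‖xᵢ‖ ‖yᵢ‖ : u = ∑ xᵢ ⊗ yᵢ}`. -/
noncomputable def AlgTensor.projNorm (u : AlgTensor E F) : ℝ := sInf u.costs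

theorem AlgTensor.projNorm_le {u : AlgTensor E F} (l : List (E × F))
    (hl : (l.map fun p => AlgTensor.tmul p.1 p.2).sum = u) :
    u.projNorm ≤ (l.map fun p => ‖p.1‖ * ‖p.2‖).sum :=
  csInf_le u.costs_bddBelow ⟨l, hl, rfl⟩

theorem AlgTensor.exists_lt (u : AlgTensor E F) {ε : ℝ} (hε : 0 < ε) :
    ∃ l : List (E × F), (l.map fun p => AlgTensor.tmul p.1 p.2).sum = u ∧
      (l.map fun p => ‖p.1‖ * ‖p.2‖).sum < u.projNorm + ε := by
  obtain ⟨r, ⟨l, hl, rfl⟩, hr⟩ := Real.lt_sInf_add_pos u.costs_nonempty hε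
  exact ⟨l, hl, hr⟩

theorem AlgTensor.projNorm_zero : (0 : AlgTensor E F).projNorm = 0 :=
  le_antisymm (AlgTensor.projNorm_le [] rfl) (le_csInf (AlgTensor.costs_nonempty _)
    AlgTensor.costs_nonneg)

theorem AlgTensor.projNorm_add_le (u v : AlgTensor E F) :
    (u + v).projNorm ≤ u.projNorm + v.projNorm := by
  refine le_of_forall_pos_le_add fun ε hε => ?_
  obtain ⟨l, hl, hl'⟩ := u.exists_lt (half_pos hε)
  obtain ⟨m, hm, hm'⟩ := v.exists_lt (half_pos hε)
  refine (AlgTensor.projNorm_le (l ++ m) (by rw [List.map_append, List.sum_append, hl, hm])).trans ?_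
  rw [List.map_append, List.sum_append]
  linarith

theorem AlgTensor.projNorm_smul_le (c : ℂ) (u : AlgTensor E F) :
    (c • u).projNorm ≤ ‖c‖ * u.projNorm := by
  refine le_of_forall_pos_le_add fun ε hε => ?_
  obtain ⟨l, hl, hl'⟩ := u.exists_lt (ε := ε / (‖c‖ + 1)) (by positivity)
  refine (AlgTensor.projNorm_le (l.map fun p => (c • p.1, p.2)) ?_).trans ?_
  · rw [List.map_map, ← hl, List.smul_sum, List.map_map]
    rfl
  · have : (List.map (fun p : E × F => ‖p.1‖ * ‖p.2‖) (l.map fun p => (c • p.1, p.2))).sum =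
        ‖c‖ * (l.map fun p => ‖p.1‖ * ‖p.2‖).sum := by
      rw [List.map_map, ← List.sum_map_mul_left]
      simp [Function.comp_def, norm_smul, mul_assoc]
    rw [this]
    have h1 : ‖c‖ * (ε / (‖c‖ + 1)) ≤ ε := by
      rw [mul_div_assoc', div_le_iff₀ (by positivity)]
      nlinarith [norm_nonneg c]
    nlinarith [norm_nonneg c, mul_le_mul_of_nonneg_left hl'.le (norm_nonneg c)]

noncomputable instance : SeminormedAddCommGroup (AlgTensor E F) :=
  (Seminorm.ofSMulLE (𝕜 := ℂ) AlgTensor.projNorm AlgTensor.projNorm_zero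
    AlgTensor.projNorm_add_le AlgTensor.projNorm_smul_le).toSeminormedAddCommGroup

theorem AlgTensor.norm_eq (u : AlgTensor E F) : ‖u‖ = sInf u.costs := rfl

noncomputable instance : NormedSpace ℂ (AlgTensor E F) :=
  ⟨AlgTensor.projNorm_smul_le⟩

end ProjectiveNorm

/-- The Banach space projective tensor product `E ⊗^γ F`: the completion of `E ⊗ F` in the
projective norm. -/
def ProjTensor (E F : Type*) [NormedAddCommGroup E] [NormedSpace ℂ E]
    [NormedAddCommGroup F] [NormedSpace ℂ F] : Type _ :=
  UniformSpace.Completion (AlgTensor E F)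

section ProjSpace

variable {E F : Type*} [NormedAddCommGroup E] [NormedSpace ℂ E]
  [NormedAddCommGroup F] [NormedSpace ℂ F]

noncomputable instance : NormedAddCommGroup (ProjTensor E F) :=
  inferInstanceAs (NormedAddCommGroup (UniformSpace.Completion (AlgTensor E F)))

noncomputable instance : NormedSpace ℂ (ProjTensor E F) :=
  inferInstanceAs (NormedSpace ℂ (UniformSpace.Completion (AlgTensor E F)))

instance : CompleteSpace (ProjTensor E F) :=
  inferInstanceAs (CompleteSpace (UniformSpace.Completion (AlgTensor E F)))

/-- The canonical isometry of `E ⊗ F` into `E ⊗^γ F`. -/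
noncomputable def ProjTensor.ofAlg : AlgTensor E F →ₗᵢ[ℂ] ProjTensor E F :=
  UniformSpace.Completion.toComplₗᵢ (𝕜 := ℂ) (E := AlgTensor E F)

theorem ProjTensor.denseRange_ofAlg :
    DenseRange (ProjTensor.ofAlg : AlgTensor E F →ₗᵢ[ℂ] ProjTensor E F) :=
  UniformSpace.Completion.denseRange_coe

/-- The elementary tensor `x ⊗ y` in `E ⊗^γ F`. -/
noncomputable def ProjTensor.tmul (x : E) (y : F) : ProjTensor E F :=
  ProjTensor.ofAlg (AlgTensor.tmul x y)

end ProjSpace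

section ProjAlgebra
set_option linter.unusedSectionVars false

variable {A B : Type*}
  [NonUnitalNormedRing A] [NormedSpace ℂ A] [IsScalarTower ℂ A A] [SMulCommClass ℂ A A]
  [NonUnitalNormedRing B] [NormedSpace ℂ B] [IsScalarTower ℂ B B] [SMulCommClass ℂ B B]

/-- The algebra structure of `A ⊗ B`, with `(a ⊗ b) (a' ⊗ b') = a a' ⊗ b b'`. -/
noncomputable instance : NonUnitalRing (AlgTensor A B) :=
  inferInstanceAs (NonUnitalRing (A ⊗[ℂ] B))

theorem AlgTensor.tmul_mul_tmul (a a' : A) (b b' : B) :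
    AlgTensor.tmul a b * AlgTensor.tmul a' b' = AlgTensor.tmul (a * a') (b * b') :=
  Algebra.TensorProduct.tmul_mul_tmul a a' b b'

theorem AlgTensor.list_sum_mul (l : List (A × B)) (v : AlgTensor A B) :
    (l.map fun p => AlgTensor.tmul p.1 p.2).sum * v =
      (l.map fun p => AlgTensor.tmul p.1 p.2 * v).sum := by
  rw [← List.sum_map_mul_right]

theorem AlgTensor.projNorm_mul_le (u v : AlgTensor A B) :
    (u * v).projNorm ≤ u.projNorm * v.projNorm := by
  have key : ∀ (l m : List (A × B)),
      ((l.map fun p => AlgTensor.tmul p.1 p.2).sum *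
        (m.map fun p => AlgTensor.tmul p.1 p.2).sum).projNorm ≤
      (l.map fun p => ‖p.1‖ * ‖p.2‖).sum * (m.map fun p => ‖p.1‖ * ‖p.2‖).sum := by
    intro l m
    induction l with
    | nil => simp [AlgTensor.projNorm_zero]
    | cons p l ih =>
      simp only [List.map_cons, List.sum_cons, add_mul]
      refine (AlgTensor.projNorm_add_le _ _).trans (add_le_add ?_ ih)
      refine (AlgTensor.projNorm_le (m.map fun q => (p.1 * q.1, p.2 * q.2)) ?_).trans ?_
      · rw [List.map_map, ← List.sum_map_mul_left]
        simp only [Function.comp_def, AlgTensor.tmul_mul_tmul]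
      · rw [List.map_map, ← List.sum_map_mul_left]
        refine List.sum_le_sum fun q _ => ?_
        simp only [Function.comp_def]
        calc ‖p.1 * q.1‖ * ‖p.2 * q.2‖ ≤ (‖p.1‖ * ‖q.1‖) * (‖p.2‖ * ‖q.2‖) :=
              mul_le_mul (norm_mul_le _ _) (norm_mul_le _ _) (norm_nonneg _) (by positivity)
          _ = _ := by ring
  have hlim : Tendsto (fun ε : ℝ => (u.projNorm + ε) * (v.projNorm + ε)) (𝓝[>] 0)
      (𝓝 (u.projNorm * v.projNorm)) := by
    have : Continuous fun ε : ℝ => (u.projNorm + ε) * (v.projNorm + ε) := by fun_prop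
    have h := this.tendsto 0
    simp only [add_zero] at h
    exact h.mono_left nhdsWithin_le_nhds
  refine ge_of_tendsto hlim ?_
  filter_upwards [self_mem_nhdsWithin] with ε hε
  obtain ⟨l, hl, hl'⟩ := u.exists_lt hε
  obtain ⟨m, hm, hm'⟩ := v.exists_lt hε
  have := key l m
  rw [hl, hm] at this
  exact this.trans (mul_le_mul hl'.le hm'.le (AlgTensor.cost_nonneg m)
    ((AlgTensor.cost_nonneg l).trans hl'.le))

noncomputable instance : NonUnitalSeminormedRing (AlgTensor A B) :=
  { (inferInstance : SeminormedAddCommGroup (AlgTensor A B)),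
    (inferInstance : NonUnitalRing (AlgTensor A B)) with
    norm_mul_le := AlgTensor.projNorm_mul_le }

instance : IsScalarTower ℂ (AlgTensor A B) (AlgTensor A B) :=
  inferInstanceAs (IsScalarTower ℂ (A ⊗[ℂ] B) (A ⊗[ℂ] B))

instance : SMulCommClass ℂ (AlgTensor A B) (AlgTensor A B) :=
  inferInstanceAs (SMulCommClass ℂ (A ⊗[ℂ] B) (A ⊗[ℂ] B))

/-- The continuous extension of the product of `A ⊗ B` to `A ⊗^γ B`. -/
noncomputable def ProjTensor.mul (u v : ProjTensor A B) : ProjTensor A B :=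
  (UniformSpace.Completion.isDenseInducing_coe.prodMap
    UniformSpace.Completion.isDenseInducing_coe).extend
      (fun p : AlgTensor A B × AlgTensor A B => ProjTensor.ofAlg (p.1 * p.2)) (u, v)

theorem ProjTensor.continuous_mul' :
    Continuous fun p : ProjTensor A B × ProjTensor A B => ProjTensor.mul p.1 p.2 := by
  let m : AlgTensor A B →+ AlgTensor A B →+ ProjTensor A B :=
    (AddMonoidHom.mul : AlgTensor A B →+ _).compr₂
      (ProjTensor.ofAlg : AlgTensor A B →ₗᵢ[ℂ] ProjTensor A B).toLinearMap.toAddMonoidHom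
  have hm : Continuous fun p : AlgTensor A B × AlgTensor A B => m p.1 p.2 :=
    ProjTensor.ofAlg.continuous.comp continuous_mul
  have di : IsDenseInducing
      (UniformSpace.Completion.toCompl : AlgTensor A B → UniformSpace.Completion (AlgTensor A B)) :=
    UniformSpace.Completion.isDenseInducing_coe
  exact (di.extend_Z_bilin di hm :)

theorem ProjTensor.ofAlg_mul' (u v : AlgTensor A B) :
    ProjTensor.mul (ProjTensor.ofAlg u) (ProjTensor.ofAlg v) = ProjTensor.ofAlg (u * v) :=
  (UniformSpace.Completion.isDenseInducing_coe.prodMap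
    UniformSpace.Completion.isDenseInducing_coe).extend_eq
      (f := fun p : AlgTensor A B × AlgTensor A B => ProjTensor.ofAlg (p.1 * p.2))
      (ProjTensor.ofAlg.continuous.comp continuous_mul) (u, v)

theorem ProjTensor.induction₃ {p : ProjTensor A B → ProjTensor A B → ProjTensor A B → Prop}
    (hp : IsClosed {q : ProjTensor A B × ProjTensor A B × ProjTensor A B | p q.1 q.2.1 q.2.2})
    (h : ∀ u v w, p (ProjTensor.ofAlg u) (ProjTensor.ofAlg v) (ProjTensor.ofAlg w))
    (u v w : ProjTensor A B) : p u v w :=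
  ProjTensor.denseRange_ofAlg.induction_on₃ hp h u v w

/-- `A ⊗^γ B` is a Banach algebra. -/
noncomputable instance : NonUnitalNormedRing (ProjTensor A B) :=
  { (inferInstance : NormedAddCommGroup (ProjTensor A B)) with
    mul := ProjTensor.mul
    left_distrib := by
      have hm := ProjTensor.continuous_mul' (A := A) (B := B)
      refine ProjTensor.induction₃ (p := fun u v w =>
        ProjTensor.mul u (v + w) = ProjTensor.mul u v + ProjTensor.mul u w) ?_ ?_
      · refine isClosed_eq (hm.comp (f := fun q : _ × _ × _ => (q.1, q.2.1 + q.2.2)) (by fun_prop))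
          ((hm.comp (f := fun q : _ × _ × _ => (q.1, q.2.1)) (by fun_prop)).add
            (hm.comp (f := fun q : _ × _ × _ => (q.1, q.2.2)) (by fun_prop)))
      · intro u v w
        rw [← map_add, ProjTensor.ofAlg_mul', ProjTensor.ofAlg_mul', ProjTensor.ofAlg_mul',
          mul_add, map_add]
    right_distrib := by
      have hm := ProjTensor.continuous_mul' (A := A) (B := B)
      refine ProjTensor.induction₃ (p := fun u v w =>
        ProjTensor.mul (u + v) w = ProjTensor.mul u w + ProjTensor.mul v w) ?_ ?_
      · refine isClosed_eq (hm.comp (f := fun q : _ × _ × _ => (q.1 + q.2.1, q.2.2)) (by fun_prop))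
          ((hm.comp (f := fun q : _ × _ × _ => (q.1, q.2.2)) (by fun_prop)).add
            (hm.comp (f := fun q : _ × _ × _ => (q.2.1, q.2.2)) (by fun_prop)))
      · intro u v w
        rw [← map_add, ProjTensor.ofAlg_mul', ProjTensor.ofAlg_mul', ProjTensor.ofAlg_mul',
          add_mul, map_add]
    zero_mul := fun u => by
      have hm := ProjTensor.continuous_mul' (A := A) (B := B)
      refine ProjTensor.induction₃ (p := fun u _ _ => ProjTensor.mul 0 u = 0) ?_ ?_ u u u
      · exact isClosed_eq (hm.comp (f := fun q : _ × _ × _ => (0, q.1)) (by fun_prop))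
          continuous_const
      · intro u _ _
        rw [← map_zero ProjTensor.ofAlg, ProjTensor.ofAlg_mul', zero_mul]
    mul_zero := fun u => by
      have hm := ProjTensor.continuous_mul' (A := A) (B := B)
      refine ProjTensor.induction₃ (p := fun u _ _ => ProjTensor.mul u 0 = 0) ?_ ?_ u u u
      · exact isClosed_eq (hm.comp (f := fun q : _ × _ × _ => (q.1, 0)) (by fun_prop))
          continuous_const
      · intro u _ _
        rw [← map_zero ProjTensor.ofAlg, ProjTensor.ofAlg_mul', mul_zero]
    mul_assoc := by
      have hm := ProjTensor.continuous_mul' (A := A) (B := B)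
      refine ProjTensor.induction₃ (p := fun u v w =>
        ProjTensor.mul (ProjTensor.mul u v) w = ProjTensor.mul u (ProjTensor.mul v w)) ?_ ?_
      · refine isClosed_eq
          (hm.comp ((hm.comp (f := fun q : _ × _ × _ => (q.1, q.2.1)) (by fun_prop)).prodMk
            (continuous_snd.comp continuous_snd)))
          (hm.comp (continuous_fst.prodMk
            (hm.comp (f := fun q : _ × _ × _ => (q.2.1, q.2.2)) (by fun_prop))))
      · intro u v w
        rw [ProjTensor.ofAlg_mul', ProjTensor.ofAlg_mul', ProjTensor.ofAlg_mul',
          ProjTensor.ofAlg_mul', mul_assoc]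
    norm_mul_le := fun u v => by
      have hm := ProjTensor.continuous_mul' (A := A) (B := B)
      refine ProjTensor.induction₃ (p := fun u v _ => ‖ProjTensor.mul u v‖ ≤ ‖u‖ * ‖v‖) ?_ ?_ u v v
      · exact isClosed_le (hm.comp (f := fun q : _ × _ × _ => (q.1, q.2.1)) (by fun_prop)).norm
          (by fun_prop)
      · intro u v _
        rw [ProjTensor.ofAlg_mul', LinearIsometry.norm_map, LinearIsometry.norm_map,
          LinearIsometry.norm_map]
        exact norm_mul_le u v }

theorem ProjTensor.tmul_mul_tmul (a a' : A) (b b' : B) :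
    ProjTensor.tmul a b * ProjTensor.tmul a' b' = ProjTensor.tmul (a * a') (b * b') := by
  rw [ProjTensor.tmul, ProjTensor.tmul, ProjTensor.tmul, ← AlgTensor.tmul_mul_tmul]
  exact ProjTensor.ofAlg_mul' _ _

end ProjAlgebra
end Beurling

namespace Beurling

/-- The group `G` is an `[IN]` group: the identity has a compact neighbourhood which is invariant
under all inner automorphisms. -/
def IsINGroup (G : Type*) [Group G] [TopologicalSpace G] : Prop :=
  ∃ U : Set G, IsCompact U ∧ U ∈ 𝓝 (1 : G) ∧ ∀ y : G, (fun x => y * x * y⁻¹) '' U = U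

/-- The weight is constant on conjugacy classes. -/
def Weight.IsClassFunction {G : Type*} [Group G] [MeasurableSpace G] (w : Weight G) : Prop :=
  ∀ x y : G, w (y * x * y⁻¹) = w x

/-- The `σ`-algebra of the conjugation invariant measurable sets. -/
@[reducible] def invMeasurableSpace (G : Type*) [Group G] [MeasurableSpace G] : MeasurableSpace G where
  MeasurableSet' s := MeasurableSet s ∧ ∀ y : G, (fun x => y * x * y⁻¹) ⁻¹' s = s
  measurableSet_empty := ⟨MeasurableSet.empty, fun _ => rfl⟩
  measurableSet_compl := fun s hs => ⟨hs.1.compl, fun y => by rw [Set.preimage_compl, hs.2 y]⟩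
  measurableSet_iUnion := fun f hf => ⟨MeasurableSet.iUnion fun i => (hf i).1, fun y => by
    rw [Set.preimage_iUnion]
    exact Set.iUnion_congr fun i => (hf i).2 y⟩

/-- The space `L¹_{w,inv}(G, E)`: the elements of `L¹_w(G, E)` which are represented by a
(Bochner) measurable function for the `σ`-algebra of conjugation invariant measurable sets. -/
noncomputable def L1inv {G : Type*} [Group G] [MeasurableSpace G] (μ : Measure G) (w : Weight G)
    (E : Type*) [NormedAddCommGroup E] [NormedSpace ℂ E] : Submodule ℂ (L1w μ w E) where
  carrier := {f | ∃ g : G → E, StronglyMeasurable[invMeasurableSpace G] g ∧ (f : G → E) =ᵐ[μ] g}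
  zero_mem' := ⟨0, stronglyMeasurable_zero, (ac_wMeasure μ w).ae_le (Lp.coeFn_zero _ _ _)⟩
  add_mem' := by
    rintro f f' ⟨g, hg, hfg⟩ ⟨g', hg', hfg'⟩
    exact ⟨g + g', hg.add hg', (L1w.coe_add f f').trans (hfg.add hfg')⟩
  smul_mem' := by
    rintro c f ⟨g, hg, hfg⟩
    exact ⟨c • g, hg.const_smul c, (L1w.coe_smul c f).trans (hfg.const_smul c)⟩

section Center

variable (A : Type*) [NonUnitalNormedRing A] [NormedSpace ℂ A] [IsScalarTower ℂ A A]
  [SMulCommClass ℂ A A]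

/-- The center `Z(A)` of a Banach algebra. -/
abbrev Z : NonUnitalSubalgebra ℂ A := NonUnitalSubalgebra.center ℂ A

noncomputable instance : NormedSpace ℂ (Z A) :=
  ⟨fun c x => norm_smul_le c (x : A)⟩

theorem mem_Z_iff (z : A) : z ∈ Z A ↔ ∀ a : A, a * z = z * a := by
  change z ∈ Set.center A ↔ _
  rw [Semigroup.mem_center_iff]

instance [CompleteSpace A] : CompleteSpace (Z A) := by
  have h : IsClosed ((Z A : Set A)) := by
    have : (Z A : Set A) = ⋂ a : A, {z | a * z = z * a} := by
      ext z
      simp [mem_Z_iff]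
    rw [this]
    exact isClosed_iInter fun a => isClosed_eq (by fun_prop) (by fun_prop)
  exact h.completeSpace_coe

end Center

/-- A bounded `Z(A)`-approximate identity of `A`: a bounded net `(a_α)` in `A` such that
`a_α z → z` for every `z ∈ Z(A)`. -/
structure IsBoundedCenterApproxIdentity {A : Type*} [NonUnitalNormedRing A] [NormedSpace ℂ A]
    [IsScalarTower ℂ A A] [SMulCommClass ℂ A A] {ι : Type*} [Preorder ι] (a : ι → A) : Prop where
  bounded : ∃ M : ℝ, ∀ i, ‖a i‖ ≤ M
  tendsto : ∀ z ∈ Z A, Tendsto (fun i => a i * z) atTop (𝓝 z)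

end Beurling

/-! Let F be central in L¹_w(G, A). Commutation with the functions x ↦ φ(x) a, for φ continuous with
compact support and a in A, is an equality of two continuous functions of x, hence it holds at every
point. Evaluation at 1 gives ∫ ψ(y) (F(y) a - a F(y)) dy = 0 for all test functions ψ, so F is
almost everywhere Z(A)-valued (`ae_mem_center_of_mem_center`). Evaluation at z⁻¹ gives ∫ ψ(y) a (F(z
y z⁻¹) - F(y)) dy = 0; the approximate identity cancels a, and F is invariant under conjugation by z
almost everywhere (`ae_comp_conj_eq_of_mem_center`).

The exceptional null set depends on z, and G may be uncountable; the main point is to find a genuine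
class function in the class of F. Suppose that w is a class function. Then y ↦ ‖F(y⁻¹ ·) - F‖ is
constant on conjugacy classes, so its sublevel sets are invariant neighbourhoods of 1. Intersecting
one with the invariant compact neighbourhood of an [IN] group gives an invariant relatively compact
W on which F moves little. The average of the translates of F over W is close to F, and a change of
variable in the average makes it invariant at every point (`translationAverage_conj`). The classes
with an invariantly measurable representative form a closed subspace, which therefore contains F. If
instead w ≥ 1, then L¹_w is contained in L¹ and the same argument runs with the weight 1.

Conversely a class function with central values commutes with everything, by a substitution in the
convolution integral that uses unimodularity (`conv_comm_of_class`).

For the tensor product, L¹_inv(G, E) is the L¹ space of the restriction of w(x) dx to the invariant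
σ-algebra. Grothendieck's isometry L¹(ρ) ⊗^γ E ≅ L¹(ρ, E) holds for every measure ρ, and the case A
= ℂ of the first part identifies L¹(ρ) with the centre of L¹_w(G). Multiplicativity is checked on
elementary tensors.

Since G need not be σ-compact or second countable, Fubini is used only for continuous functions with
compact support; the general case follows by approximation. -/

namespace Beurling
set_option linter.unusedSectionVars false

/-! ### Unimodularity of [IN] groups -/

section Group

variable {G : Type*} [Group G] [TopologicalSpace G] [IsTopologicalGroup G] [T2Space G]
  [LocallyCompactSpace G] [MeasurableSpace G] [BorelSpace G]
  {μ : Measure G} [μ.IsHaarMeasure] [μ.Regular]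

/-- An `[IN]` group is unimodular. -/
theorem IsINGroup.isMulRightInvariant (hG : IsINGroup G) : μ.IsMulRightInvariant := by
  obtain ⟨V, hV, hV1, hVi⟩ := hG
  refine ⟨fun y => ?_⟩
  have hreg : (μ.map (· * y)).Regular := Measure.Regular.map (Homeomorph.mulRight y)
  have hc := Measure.isMulLeftInvariant_eq_smul_of_regular (μ.map (· * y)) μ
  set c := Measure.haarScalarFactor (μ.map (· * y)) μ
  have hpos : μ V ≠ 0 := (Measure.measure_pos_of_mem_nhds μ hV1).ne'
  have hfin : μ V ≠ ∞ := hV.measure_lt_top.ne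
  -- Up to a left translation, which μ does not see, right translation by y is a conjugation, and V
  -- is invariant under conjugations. Hence the modular factor c is 1.
  have h1 : (μ.map (· * y)) V = μ V := by
    rw [Measure.map_apply (measurable_mul_const y) hV.measurableSet, ← measure_preimage_mul μ y⁻¹]
    congr 1
    conv_rhs => rw [← hVi y]
    ext x
    simp only [Set.mem_preimage, Set.mem_image]
    constructor
    · intro h
      exact ⟨y⁻¹ * x * y, h, by group⟩
    · rintro ⟨v, hv, rfl⟩
      simpa [mul_assoc] using hv
  rw [hc, Measure.smul_apply] at h1
  have hc1 : c = 1 := by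
    have : (c : ℝ≥0∞) * μ V = 1 * μ V := by simpa using h1
    exact_mod_cast (ENNReal.mul_left_inj hpos hfin).1 this
  rw [hc, hc1, one_smul]

/-- A left and right invariant regular Haar measure is inversion invariant. -/
theorem isInvInvariant_of_isMulRightInvariant [μ.IsMulRightInvariant] : μ.IsInvInvariant := by
  refine ⟨?_⟩
  have hc := Measure.isMulLeftInvariant_eq_smul_of_regular μ.inv μ
  set c := Measure.haarScalarFactor μ.inv μ
  obtain ⟨K, hK, hK1⟩ := exists_compact_mem_nhds (1 : G)
  -- By uniqueness `μ.inv` is a multiple of μ; a symmetric set of finite positive measure shows that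
  -- the factor is 1.
  let S := K ∪ K⁻¹
  have hS : IsCompact S := hK.union hK.inv
  have hS1 : S ∈ 𝓝 (1 : G) := Filter.mem_of_superset hK1 Set.subset_union_left
  have hSi : S⁻¹ = S := by simp [S, Set.union_comm]
  have h1 : μ.inv S = μ S := by rw [Measure.inv_apply, hSi]
  rw [hc, Measure.smul_apply] at h1
  have hc1 : c = 1 := by
    have : (c : ℝ≥0∞) * μ S = 1 * μ S := by simpa using h1
    exact_mod_cast (ENNReal.mul_left_inj (Measure.measure_pos_of_mem_nhds μ hS1).ne'
      hS.measure_lt_top.ne).1 this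
  rw [hc, hc1, one_smul]

variable (μ) in
theorem measurePreserving_conj [μ.IsMulRightInvariant] (y : G) :
    MeasurePreserving (fun x => y * x * y⁻¹) μ μ :=
  (measurePreserving_mul_right μ y⁻¹).comp (measurePreserving_mul_left μ y)

theorem measurableEmbedding_conj (y : G) : MeasurableEmbedding (fun x : G => y * x * y⁻¹) :=
  ((Homeomorph.mulLeft y).trans (Homeomorph.mulRight y⁻¹)).measurableEmbedding

variable (μ) in
theorem measurePreserving_inv_mul [μ.IsMulRightInvariant] (x : G) :
    MeasurePreserving (fun y => y⁻¹ * x) μ μ :=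
  have : μ.IsInvInvariant := isInvInvariant_of_isMulRightInvariant
  (measurePreserving_mul_right μ x).comp (Measure.measurePreserving_inv μ)

theorem measurableEmbedding_inv_mul (x : G) : MeasurableEmbedding (fun y : G => y⁻¹ * x) :=
  ((Homeomorph.inv G).trans (Homeomorph.mulRight x)).measurableEmbedding

end Group

/-! ### Vanishing criteria for vector-valued functions -/

section Fundamental

/-- A set of finite measure is compact up to a set of small measure, on which the integral of f is
small by absolute continuity. -/
theorem ae_eq_zero_of_forall_setIntegral_isCompact {X E : Type*} [TopologicalSpace X] [T2Space X]
    [MeasurableSpace X] [BorelSpace X] {ρ : Measure X} [ρ.InnerRegularCompactLTTop]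
    [NormedAddCommGroup E] [NormedSpace ℝ E] [CompleteSpace E]
    {f : X → E} (hf : Integrable f ρ) (h : ∀ K, IsCompact K → ∫ x in K, f x ∂ρ = 0) :
    f =ᵐ[ρ] 0 := by
  refine hf.ae_eq_zero_of_forall_setIntegral_eq_zero fun s hs hsfin => ?_
  rw [← norm_le_zero_iff]
  refine le_of_forall_pos_le_add fun ε hε => ?_
  obtain ⟨δ, hδ, hδ'⟩ := exists_pos_setLIntegral_lt_of_measure_lt (μ := ρ)
    (f := fun x => ‖f x‖ₑ) hf.2.ne (ε := ENNReal.ofReal ε) (by simpa using hε)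
  obtain ⟨K, hKs, hK, hKd⟩ := hs.exists_isCompact_sdiff_lt hsfin.ne hδ.ne'
  have h1 : ∫ x in s, f x ∂ρ = ∫ x in s \ K, f x ∂ρ := by
    have := setIntegral_sdiff hK.measurableSet hf.integrableOn hKs
    rw [h K hK, sub_zero] at this
    exact this.symm
  rw [h1, zero_add]
  have h2 := (enorm_integral_le_lintegral_enorm (μ := ρ.restrict (s \ K)) f).trans (hδ' _ hKd).le
  rw [← ofReal_norm] at h2
  exact (ENNReal.ofReal_le_ofReal_iff hε.le).1 h2

variable {G : Type*} [Group G] [TopologicalSpace G] [IsTopologicalGroup G] [T2Space G]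
  [LocallyCompactSpace G] [MeasurableSpace G] [BorelSpace G]
  (μ : Measure G) [μ.IsHaarMeasure] [μ.Regular] (w : Weight G)
  {E : Type*} [NormedAddCommGroup E]

/-- From 1 ≤ w(1) ≤ w(x⁻¹) w(x), an upper bound of w on K⁻¹ is a lower bound of w on K. Consequently
convergence in L¹_w implies convergence in L¹(dx) on compact sets. -/
theorem Weight.exists_one_le_mul {K : Set G} (hK : IsCompact K) :
    ∃ C : ℝ≥0, ∀ x ∈ K, 1 ≤ C * w x := by
  obtain ⟨C, hC⟩ := w.exists_bound hK.inv
  have h1 : 1 ≤ w 1 := by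
    have := w.mul_le' 1 1
    rw [mul_one] at this
    exact le_of_mul_le_mul_right (by simpa using this) (w.pos' 1)
  refine ⟨C, fun x hx => ?_⟩
  calc 1 ≤ w 1 := h1
    _ = w (x⁻¹ * x) := by simp
    _ ≤ w x⁻¹ * w x := w.mul_le' _ _
    _ ≤ C * w x := by gcongr; exact hC _ (by simpa using hx)

variable {μ w}

/-- A bound for the integral of the norm over a set on which the weight is bounded below. -/
theorem setLIntegral_enorm_le {K : Set G} {C : ℝ≥0} (hC : ∀ x ∈ K, 1 ≤ C * w x)
    (hK : MeasurableSet K) (f : G → E) :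
    ∫⁻ x in K, ‖f x‖ₑ ∂μ ≤ C * eLpNorm f 1 (wMeasure μ w) := by
  rw [eLpNorm_one_eq_lintegral_enorm, lintegral_wMeasure,
    ← lintegral_const_mul' _ _ ENNReal.coe_ne_top]
  calc ∫⁻ x in K, ‖f x‖ₑ ∂μ ≤ ∫⁻ x in K, C * (w x * ‖f x‖ₑ) ∂μ := by
        refine setLIntegral_mono' hK fun x hx => ?_
        rw [← mul_assoc]
        exact le_mul_of_one_le_left zero_le (by exact_mod_cast hC x hx)
    _ ≤ _ := setLIntegral_le_lintegral _ _

theorem integrableOn_isCompact {f : G → E} (hf : MemLp f 1 (wMeasure μ w)) {K : Set G}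
    (hK : IsCompact K) : IntegrableOn f K μ := by
  obtain ⟨C, hC⟩ := w.exists_one_le_mul hK
  exact ⟨(hf.1.mono_ac (ac_wMeasure μ w)).restrict,
    (setLIntegral_enorm_le hC hK.measurableSet f).trans_lt
      (ENNReal.mul_lt_top ENNReal.coe_lt_top hf.2)⟩

variable [NormedSpace ℂ E] [CompleteSpace E]

/-- The indicator of K is replaced by a Urysohn function φ supported in an open U ⊇ K with U \ K of
small measure; the integral over K is then minus that of φ f over U \ K. -/
theorem setIntegral_isCompact_eq_zero {f : G → E} (hf : MemLp f 1 (wMeasure μ w))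
    (h : ∀ ψ : G → ℂ, Continuous ψ → HasCompactSupport ψ → ∫ x, ψ x • f x ∂μ = 0)
    {K : Set G} (hK : IsCompact K) : ∫ x in K, f x ∂μ = 0 := by
  obtain ⟨L, hL, hKL⟩ := exists_compact_superset hK
  have hfL := integrableOn_isCompact hf hL
  rw [← norm_le_zero_iff]
  refine le_of_forall_pos_le_add fun ε hε => ?_
  obtain ⟨δ, hδ, hδ'⟩ := exists_pos_setLIntegral_lt_of_measure_lt (μ := μ.restrict L)
    (f := fun x => ‖f x‖ₑ) hfL.2.ne (ε := ENNReal.ofReal ε) (by simpa using hε)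
  obtain ⟨U₀, hKU₀, hU₀, hU₀lt⟩ := hK.exists_isOpen_lt_add (μ := μ) hδ.ne'
  -- The function f is only locally integrable for μ, so U is kept inside the compact L, where
  -- absolute continuity is available.
  set U := U₀ ∩ interior L
  have hU : IsOpen U := hU₀.inter isOpen_interior
  have hKU : K ⊆ U := Set.subset_inter hKU₀ hKL
  have hUL : U ⊆ L := Set.inter_subset_right.trans interior_subset
  have hUd : μ (U \ K) < δ := by
    refine (measure_mono (Set.sdiff_subset_sdiff_left Set.inter_subset_left)).trans_lt ?_
    rw [measure_sdiff hKU₀ hK.measurableSet.nullMeasurableSet hK.measure_lt_top.ne]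
    exact ENNReal.sub_lt_of_lt_add (measure_mono hKU₀) (by rwa [add_comm] at hU₀lt)
  obtain ⟨φ, h1, h0, hφs, hφ⟩ := exists_continuous_one_zero_of_isCompact hK
      hU.isClosed_compl (Set.disjoint_compl_right_iff_subset.2 hKU)
  have hz := h (fun x => (φ x : ℂ)) (by fun_prop) (hφs.comp_left (g := ((↑) : ℝ → ℂ)) (by simp))
  have hm : MeasurableSet (U \ K) := hU.measurableSet.diff hK.measurableSet
  have hsupp : ∀ x, x ∉ U → (φ x : ℂ) • f x = 0 := fun x hx => by
    have : φ x = 0 := h0 hx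
    simp [this]
  have hint : IntegrableOn (fun x => (φ x : ℂ) • f x) U μ := by
    refine Integrable.mono (hfL.mono_set hUL) ?_ (Eventually.of_forall fun x => ?_)
    · have : Continuous fun x => (φ x : ℂ) := by fun_prop
      exact (this.measurable.aestronglyMeasurable).smul (hfL.mono_set hUL).1
    · rw [norm_smul]
      refine mul_le_of_le_one_left (norm_nonneg _) ?_
      rw [Complex.norm_real, Real.norm_eq_abs, abs_of_nonneg (hφ x).1]
      exact (hφ x).2
  rw [← setIntegral_eq_integral_of_forall_compl_eq_zero hsupp] at hz
  have hKe : ∫ x in K, (φ x : ℂ) • f x ∂μ = ∫ x in K, f x ∂μ :=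
    setIntegral_congr_fun hK.measurableSet fun x hx => by simp [h1 hx]
  have hd := setIntegral_sdiff hK.measurableSet hint hKU
  rw [hz, hKe, zero_sub] at hd
  rw [← norm_neg, ← hd, zero_add]
  have hUL' : (μ.restrict L) (U \ K) < δ := (Measure.restrict_apply_le _ _).trans_lt hUd
  have h2 := hδ' _ hUL'
  rw [Measure.restrict_restrict hm, Set.inter_eq_left.2 (Set.sdiff_subset.trans hUL)] at h2
  have h3 : ‖∫ x in U \ K, (φ x : ℂ) • f x ∂μ‖ₑ ≤ ENNReal.ofReal ε := by
    refine (enorm_integral_le_lintegral_enorm _).trans ((lintegral_mono fun x => ?_).trans h2.le)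
    rw [enorm_smul]
    refine mul_le_of_le_one_left zero_le ?_
    rw [← ofReal_norm, Complex.norm_real, Real.norm_eq_abs, abs_of_nonneg (hφ x).1]
    exact ENNReal.ofReal_le_one.2 (hφ x).2
  rw [← ofReal_norm] at h3
  exact (ENNReal.ofReal_le_ofReal_iff hε.le).1 h3

/-- The fundamental lemma of the calculus of variations in `L¹_w(G, E)`. -/
theorem ae_eq_zero_of_forall_integral_smul_eq_zero {f : G → E} (hf : MemLp f 1 (wMeasure μ w))
    (h : ∀ ψ : G → ℂ, Continuous ψ → HasCompactSupport ψ → ∫ x, ψ x • f x ∂μ = 0) :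
    f =ᵐ[μ] 0 := by
  have hK : ∀ K, IsCompact K → f =ᵐ[μ.restrict K] 0 := fun K hK =>
    ae_eq_zero_of_forall_setIntegral_isCompact (integrableOn_isCompact hf hK) fun K' hK' => by
      rw [Measure.restrict_restrict hK'.measurableSet]
      exact setIntegral_isCompact_eq_zero hf h (hK'.inter hK)
  -- Countably many compact sets need not cover G, so vanishing on each of them does not suffice
  -- directly. But f is globally integrable for w(x) dx, and the criterion by compact sets is
  -- applied again to that measure.
  refine (ac_wMeasure μ w).ae_le (ae_eq_zero_of_forall_setIntegral_isCompact
    (memLp_one_iff_integrable.1 hf) fun K hK' => integral_eq_zero_of_ae ?_)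
  exact ((wMeasure_ac μ w).restrict K).ae_le (hK K hK')

end Fundamental

/-- If `T i (f x) = 0` for almost every `x`, for every `i`, then almost every `f x` lies in the
intersection of the kernels. -/
theorem ae_forall_clm_eq_zero {X I E F : Type*} [MeasurableSpace X] {ρ : Measure X}
    [NormedAddCommGroup E] [NormedSpace ℂ E] [CompleteSpace E]
    [NormedAddCommGroup F] [NormedSpace ℂ F] [CompleteSpace F]
    (T : I → E →L[ℂ] F) {f : X → E} (hf : Integrable f ρ)
    (h : ∀ i, ∀ᵐ x ∂ρ, T i (f x) = 0) : ∀ᵐ x ∂ρ, ∀ i, T i (f x) = 0 := by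
  -- The index set may be uncountable, so the null sets cannot be united. In place of this f is
  -- projected to the quotient by the common kernel S.
  let S : Submodule ℂ E := ⨅ i, (T i).toLinearMap.ker
  have hmem : ∀ z, z ∈ S ↔ ∀ i, T i z = 0 := fun z => by simp [S]
  have hS : IsClosed (S : Set E) := by
    have : (S : Set E) = ⋂ i, {z | T i z = 0} := by ext z; simp [hmem]
    rw [this]
    exact isClosed_iInter fun i => isClosed_eq (by fun_prop) (by fun_prop)
  let π : E →L[ℂ] E ⧸ S := S.mkQL
  have hπ : (fun x => π (f x)) =ᵐ[ρ] 0 := by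
    refine (π.integrable_comp hf).ae_eq_zero_of_forall_setIntegral_eq_zero fun s hs _ => ?_
    rw [π.integral_comp_comm hf.integrableOn]
    -- Each integral of f over a measurable set lies in S, because this is tested one index at a
    -- time and `T i` commutes with the integral.
    refine (Submodule.Quotient.mk_eq_zero S).2 ((hmem _).2 fun i => ?_)
    rw [← (T i).integral_comp_comm hf.integrableOn]
    exact integral_eq_zero_of_ae (ae_restrict_of_ae (h i))
  filter_upwards [hπ] with x hx
  exact (hmem _).1 ((Submodule.Quotient.mk_eq_zero S).1 hx)

/-! ### Values and conjugation invariance of central elements -/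

section Central

variable {G : Type*} [Group G] [TopologicalSpace G] [IsTopologicalGroup G] [T2Space G]
  [LocallyCompactSpace G] [MeasurableSpace G] [BorelSpace G]
  {μ : Measure G} [μ.IsHaarMeasure] [μ.Regular] {w : Weight G}

/-- Applied to the convolutions of an element of L¹_w with a test function: equalities between them
can then be evaluated at a given point. -/
theorem continuous_integral_smul_of_locally_compact_support {E : Type*} [NormedAddCommGroup E]
    [NormedSpace ℂ E] {h : G → E} (hh : MemLp h 1 (wMeasure μ w)) {κ : G → G → ℂ}
    (hκ : Continuous κ.uncurry)
    (hs : ∀ s, IsCompact s → ∃ k, IsCompact k ∧ ∀ x y, x ∈ s → y ∉ k → κ x y = 0) :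
    Continuous fun x => ∫ y, κ x y • h y ∂μ := by
  refine continuous_iff_continuousAt.2 fun x₀ => ?_
  obtain ⟨s, hsc, hs1⟩ := exists_compact_mem_nhds x₀
  obtain ⟨k, hk, hk0⟩ := hs s hsc
  have h1 : ContinuousOn (fun x => ∫ y, κ x y • h y ∂μ) s :=
    continuousOn_integral_bilinear_of_locally_integrable_of_compact_support
      (ContinuousLinearMap.lsmul ℂ ℂ).flip hk hκ.continuousOn hk0 (integrableOn_isCompact hh hk)
  exact h1.continuousAt hs1

theorem integrable_smul_cc {E : Type*} [NormedAddCommGroup E] [NormedSpace ℂ E] {h : G → E}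
    (hh : MemLp h 1 (wMeasure μ w)) {ψ : G → ℂ} (hψ : Continuous ψ) (hψ' : HasCompactSupport ψ) :
    Integrable (fun y => ψ y • h y) μ := by
  refine (integrableOn_iff_integrable_of_support_subset (s := tsupport ψ) ?_).1
    ((integrableOn_isCompact hh hψ').continuousOn_smul hψ.continuousOn hψ')
  exact (Function.support_smul_subset_left _ _).trans (subset_tsupport _)

variable {A : Type*} [NonUnitalNormedRing A] [NormedSpace ℂ A] [IsScalarTower ℂ A A]
  [SMulCommClass ℂ A A]

theorem memLp_mul_const {h : G → A} (hh : MemLp h 1 (wMeasure μ w)) (a : A) :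
    MemLp (fun x => h x * a) 1 (wMeasure μ w) :=
  ((ContinuousLinearMap.mul ℂ A).flip a).comp_memLp' hh

theorem memLp_const_mul {h : G → A} (hh : MemLp h 1 (wMeasure μ w)) (a : A) :
    MemLp (fun x => a * h x) 1 (wMeasure μ w) :=
  (ContinuousLinearMap.mul ℂ A a).comp_memLp' hh

variable [CompleteSpace A] [μ.IsMulRightInvariant]

/-- The two sides are the convolutions of F with x ↦ φ(x) a in the two orders. They agree almost
everywhere because F is central, and everywhere because they are continuous and μ charges open sets.
-/
theorem integral_comm_of_mem_center {F : L1w μ w A} (hF : F ∈ Z (L1w μ w A)) {φ : G → ℂ}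
    (hφ : Continuous φ) (hφ' : HasCompactSupport φ) (a : A) (x : G) :
    ∫ y, φ (y⁻¹ * x) • (F y * a) ∂μ = ∫ y, φ (x * y⁻¹) • (a * F y) ∂μ := by
  have : μ.IsInvInvariant := isInvInvariant_of_isMulRightInvariant
  let g : G → A := fun x => φ x • a
  have hg : Continuous g := by fun_prop
  have hg' : HasCompactSupport g := hφ'.smul_right
  have hgm : MemLp g 1 (wMeasure μ w) := hg.memLp_of_hasCompactSupport hg'
  have hcomm := (mem_Z_iff _ F).1 hF (L1w.mk g hgm)
  have h1 : conv μ (F : G → A) g =ᵐ[μ] conv μ g F :=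
    ((L1w.conv_congr (ae_eq_refl _) (L1w.coe_mk g hgm)).symm.trans
      (Eventually.of_forall fun x => by exact congrArg (fun f : L1w μ w A => f x) hcomm.symm)).trans
      (L1w.conv_congr (L1w.coe_mk g hgm) (ae_eq_refl _))
  have h2 : conv μ (F : G → A) g = fun x => ∫ y, φ (y⁻¹ * x) • (F y * a) ∂μ := by
    funext x
    rw [conv_eq]
    simp only [g, mul_smul_comm]
  have h3 : conv μ g (F : G → A) = fun x => ∫ y, φ (x * y⁻¹) • (a * F y) ∂μ := by
    funext x
    rw [conv, ← integral_inv_eq_self]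
    simp only [g, smul_mul_assoc, inv_inv]
  rw [h2, h3] at h1
  refine congrFun ((Continuous.ae_eq_iff_eq μ ?_ ?_).1 h1) x
  · refine continuous_integral_smul_of_locally_compact_support (κ := fun x y => φ (y⁻¹ * x))
      (memLp_mul_const F.memLp a) (by simp only [Function.uncurry_def]; fun_prop) fun s hs =>
        ⟨s * (tsupport φ)⁻¹, hs.mul hφ'.isCompact.inv, fun x y hx hy => ?_⟩
    by_contra h
    exact hy ⟨x, hx, x⁻¹ * y, by simpa using subset_tsupport _ h, by simp⟩
  · refine continuous_integral_smul_of_locally_compact_support (κ := fun x y => φ (x * y⁻¹))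
      (memLp_const_mul F.memLp a) (by simp only [Function.uncurry_def]; fun_prop) fun s hs =>
        ⟨(tsupport φ)⁻¹ * s, hφ'.isCompact.inv.mul hs, fun x y hx hy => ?_⟩
    by_contra h
    exact hy ⟨y * x⁻¹, by simpa using subset_tsupport _ h, x, hx, by simp⟩

/-- The central elements of `L¹_w(G, A)` take their values in the center of `A`. -/
theorem ae_mem_center_of_mem_center {F : L1w μ w A} (hF : F ∈ Z (L1w μ w A)) :
    ∀ᵐ x ∂μ, F x ∈ Z A := by
  let T : A → A →L[ℂ] A := fun a => ContinuousLinearMap.mul ℂ A a -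
    (ContinuousLinearMap.mul ℂ A).flip a
  have hT : ∀ a z, T a z = a * z - z * a := fun a z => by simp [T]
  have h := ae_forall_clm_eq_zero T (memLp_one_iff_integrable.1 F.memLp) fun a => by
    refine (wMeasure_ac μ w).ae_le (ae_eq_zero_of_forall_integral_smul_eq_zero (w := w)
      (f := fun x => T a (F x)) ((T a).comp_memLp' F.memLp) fun ψ hψ hψ' => ?_)
    have hc : HasCompactSupport fun x => ψ x⁻¹ := hψ'.comp_homeomorph (Homeomorph.inv G)
    -- At the point 1 both kernels φ(y⁻¹ x) and φ(x y⁻¹) become ψ(y).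
    have h1 := integral_comm_of_mem_center hF (φ := fun x => ψ x⁻¹) (by fun_prop) hc a 1
    simp only [mul_one, one_mul, inv_inv] at h1
    simp only [hT, smul_sub]
    rw [integral_sub (integrable_smul_cc (memLp_const_mul F.memLp a) hψ hψ')
      (integrable_smul_cc (memLp_mul_const F.memLp a) hψ hψ'), h1,
      sub_self]
  filter_upwards [(ac_wMeasure μ w).ae_le h] with x hx
  exact (mem_Z_iff _ _).2 fun a => sub_eq_zero.1 ((hT a _).symm.trans (hx a))

/-- Without any invariance of w, conjugation by z changes the weight by at most the constant factor
w(z⁻¹) w(z). -/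
theorem memLp_comp_conj {E : Type*} [NormedAddCommGroup E] {h : G → E}
    (hh : MemLp h 1 (wMeasure μ w)) (z : G) :
    MemLp (fun y => h (z * y * z⁻¹)) 1 (wMeasure μ w) := by
  have hc := measurePreserving_conj μ z
  refine ⟨((hh.1.mono_ac (ac_wMeasure μ w)).comp_measurePreserving hc).mono_ac
    (wMeasure_ac μ w), ?_⟩
  have h2 := hh.2
  rw [eLpNorm_one_eq_lintegral_enorm, lintegral_wMeasure] at h2 ⊢
  rw [← hc.lintegral_comp_emb (measurableEmbedding_conj z)] at h2
  calc ∫⁻ x, w x * ‖h (z * x * z⁻¹)‖ₑ ∂μ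
      ≤ ∫⁻ x, (w z⁻¹ * w z : ℝ≥0) * (w (z * x * z⁻¹) * ‖h (z * x * z⁻¹)‖ₑ) ∂μ := by
        refine lintegral_mono fun x => ?_
        rw [← mul_assoc]
        gcongr
        rw [← ENNReal.coe_mul]
        refine ENNReal.coe_le_coe.2 ?_
        calc w x = w (z⁻¹ * (z * x * z⁻¹) * z) := by congr 1; group
          _ ≤ w z⁻¹ * w (z * x * z⁻¹) * w z :=
            (w.mul_le' _ _).trans (mul_le_mul_left (w.mul_le' _ _) _)
          _ = _ := by ring
    _ < ∞ := by
        rw [lintegral_const_mul' _ _ ENNReal.coe_ne_top]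
        exact ENNReal.mul_lt_top ENNReal.coe_lt_top h2

/-- The central elements of `L¹_w(G, A)` are invariant under each conjugation. -/
theorem ae_comp_conj_eq_of_mem_center (hA : ∀ z ∈ Z A, (∀ a, a * z = 0) → z = 0)
    {F : L1w μ w A} (hF : F ∈ Z (L1w μ w A)) (z : G) :
    ∀ᵐ x ∂μ, F (z * x * z⁻¹) = F x := by
  have hc := measurePreserving_conj μ z
  have hZ := ae_mem_center_of_mem_center hF
  have hZ' := hc.quasiMeasurePreserving.ae hZ
  have hm := memLp_comp_conj F.memLp z
  have h := ae_forall_clm_eq_zero (ContinuousLinearMap.mul ℂ A)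
    (memLp_one_iff_integrable.1 (hm.sub F.memLp)) fun a => by
    refine (wMeasure_ac μ w).ae_le (ae_eq_zero_of_forall_integral_smul_eq_zero (w := w)
      (f := fun x => ContinuousLinearMap.mul ℂ A a (F (z * x * z⁻¹) - F x))
      ((ContinuousLinearMap.mul ℂ A a).comp_memLp' (hm.sub F.memLp)) fun ψ hψ hψ' => ?_)
    have hcs : HasCompactSupport fun t => ψ (z⁻¹ * t⁻¹) :=
      hψ'.comp_homeomorph ((Homeomorph.inv G).trans (Homeomorph.mulLeft z⁻¹))
    -- At the point z⁻¹ the left kernel is ψ(y) and the right one ψ(z⁻¹ y z). The substitution y ↦ z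
    -- y z⁻¹ on the right restores ψ(y) and turns F(y) into F(z y z⁻¹).
    have h1 := integral_comm_of_mem_center hF (φ := fun t => ψ (z⁻¹ * t⁻¹)) (by fun_prop) hcs a z⁻¹
    rw [← hc.integral_comp (measurableEmbedding_conj z) fun y =>
      ψ (z⁻¹ * (z⁻¹ * y⁻¹)⁻¹) • (a * F y)] at h1
    have e1 : ∀ y : G, z⁻¹ * (y⁻¹ * z⁻¹)⁻¹ = y := fun y => by group
    have e2 : ∀ y : G, z⁻¹ * (z⁻¹ * (z * y * z⁻¹)⁻¹)⁻¹ = y := fun y => by group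
    simp only [e1, e2] at h1
    have h2 : ∫ y, ψ y • (F y * a) ∂μ = ∫ y, ψ y • (a * F y) ∂μ := by
      refine integral_congr_ae ?_
      filter_upwards [hZ] with y hy
      rw [(mem_Z_iff _ _).1 hy a]
    rw [h2] at h1
    simp only [ContinuousLinearMap.mul_apply', mul_sub, smul_sub]
    rw [integral_sub (integrable_smul_cc (memLp_const_mul hm a) hψ hψ')
      (integrable_smul_cc (memLp_const_mul F.memLp a) hψ hψ'), h1, sub_self]
  filter_upwards [(ac_wMeasure μ w).ae_le h, hZ, hZ'] with x hx h1 h2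
  -- The difference of the two values is central in A and annihilated by every a, so cancellation in
  -- Z(A) applies.
  exact sub_eq_zero.1 (hA _ (sub_mem h2 h1) hx)

end Central
-- Continuity of translation in L¹_w
section Translation

variable {G : Type*} [Group G] [TopologicalSpace G] [IsTopologicalGroup G] [T2Space G]
  [LocallyCompactSpace G] [MeasurableSpace G] [BorelSpace G]
  (μ : Measure G) [μ.IsHaarMeasure] [μ.Regular] (w : Weight G)
  {A : Type*} [NonUnitalNormedRing A] [NormedSpace ℂ A] [IsScalarTower ℂ A A]
  [SMulCommClass ℂ A A]

/-- The distance in `L¹_w` of `f` and its left translate by `y`. -/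
noncomputable def translationDist {G : Type*} [Group G] [MeasurableSpace G] (μ : Measure G)
    (w : Weight G) {E : Type*} [NormedAddCommGroup E] (f : G → E) (y : G) : ℝ≥0∞ :=
  eLpNorm (fun x => f (y⁻¹ * x) - f x) 1 (wMeasure μ w)

variable {μ w}

theorem eLpNorm_translate_le {E : Type*} [NormedAddCommGroup E] (h : G → E) (y : G) :
    eLpNorm (fun x => h (y⁻¹ * x)) 1 (wMeasure μ w) ≤ w y * eLpNorm h 1 (wMeasure μ w) := by
  simp only [eLpNorm_one_eq_lintegral_enorm, lintegral_wMeasure]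
  rw [← lintegral_mul_left_eq_self _ y, ← lintegral_const_mul' _ _ ENNReal.coe_ne_top]
  refine lintegral_mono fun x => ?_
  simp only [inv_mul_cancel_left]
  rw [← mul_assoc]
  gcongr
  exact_mod_cast w.mul_le' y x

theorem aestronglyMeasurable_translate {E : Type*} [NormedAddCommGroup E] {h : G → E}
    (hh : AEStronglyMeasurable h (wMeasure μ w)) (y : G) :
    AEStronglyMeasurable (fun x => h (y⁻¹ * x)) (wMeasure μ w) :=
  ((hh.mono_ac (ac_wMeasure μ w)).comp_measurePreserving
    (measurePreserving_mul_left μ y⁻¹)).mono_ac (wMeasure_ac μ w)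

/-- Replacing f by g costs the norm of f - g and of its translate, and translation by y has norm at
most w(y) on L¹_w. -/
theorem translationDist_le_add {E : Type*} [NormedAddCommGroup E] {f g : G → E}
    (hf : AEStronglyMeasurable f (wMeasure μ w)) (hg : AEStronglyMeasurable g (wMeasure μ w))
    (y : G) : translationDist μ w f y ≤
      translationDist μ w g y + (w y + 1) * eLpNorm (f - g) 1 (wMeasure μ w) := by
  have h1 : (fun x => f (y⁻¹ * x) - f x) =
      (fun x => g (y⁻¹ * x) - g x) + ((fun x => (f - g) (y⁻¹ * x)) - (f - g)) := by
    funext x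
    simp only [Pi.add_apply, Pi.sub_apply]
    abel
  have m1 := (aestronglyMeasurable_translate hg y).sub hg
  have m2 := aestronglyMeasurable_translate (hf.sub hg) y
  rw [translationDist, h1]
  refine (eLpNorm_add_le m1 (m2.sub (hf.sub hg)) le_rfl).trans ?_
  gcongr
  · exact le_rfl
  · refine (eLpNorm_sub_le m2 (hf.sub hg) le_rfl).trans ?_
    rw [add_mul, one_mul]
    gcongr
    exact eLpNorm_translate_le (f - g) y

theorem eventually_translationDist_cc_le {E : Type*} [NormedAddCommGroup E]
    {g : G → E} (hg : Continuous g) (hg' : HasCompactSupport g) {ε : ℝ≥0∞} (hε : ε ≠ 0) :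
    ∀ᶠ y in 𝓝 (1 : G), translationDist μ w g y ≤ ε := by
  rcases eq_or_ne ε ∞ with rfl | hε'
  · simp
  obtain ⟨s, hs, hs1⟩ := exists_compact_mem_nhds (1 : G)
  set k := s * tsupport g ∪ tsupport g
  have hk : IsCompact k := (hs.mul hg'.isCompact).union hg'.isCompact
  have h0 : ∀ y x, y ∈ s → x ∉ k → ‖g (y⁻¹ * x) - g x‖ = 0 := by
    intro y x hy hx
    have h1 : g x = 0 := by
      by_contra h
      exact hx (Or.inr (subset_tsupport _ h))
    have h2 : g (y⁻¹ * x) = 0 := by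
      by_contra h
      exact hx (Or.inl ⟨y, hy, y⁻¹ * x, subset_tsupport _ h, by simp⟩)
    simp [h1, h2]
  have hc : ContinuousOn (fun y => ∫ x, ‖g (y⁻¹ * x) - g x‖ ∂(wMeasure μ w)) s :=
    continuousOn_integral_of_compact_support hk
      (f := fun y x => ‖g (y⁻¹ * x) - g x‖)
      (Continuous.continuousOn (by simp only [Function.uncurry_def]; fun_prop)) h0
  have ht := (hc.continuousAt hs1).tendsto
  simp only [inv_one, one_mul, sub_self, norm_zero, integral_zero] at ht
  filter_upwards [hs1, ht.eventually (gt_mem_nhds (ENNReal.toReal_pos hε hε'))] with y hy hlt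
  have hint : Integrable (fun x => g (y⁻¹ * x) - g x) (wMeasure μ w) :=
    Continuous.integrable_of_hasCompactSupport (by fun_prop)
      (HasCompactSupport.intro hk fun x hx => norm_eq_zero.1 (h0 y x hy hx))
  rw [translationDist, eLpNorm_one_eq_lintegral_enorm, ← ofReal_integral_norm_eq_lintegral_enorm hint]
  exact ENNReal.ofReal_le_of_le_toReal hlt.le

theorem eventually_translationDist_le {f : G → A} (hf : MemLp f 1 (wMeasure μ w)) {ε : ℝ≥0∞}
    (hε : ε ≠ 0) : ∀ᶠ y in 𝓝 (1 : G), translationDist μ w f y ≤ ε := by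
  obtain ⟨U, hU, C, hC⟩ := w.exists_nhds_one_bound
  have hε2 : ε / 2 ≠ 0 := by simpa using hε
  have hC0 : ((C : ℝ≥0∞) + 1) ≠ ∞ := by simp
  obtain ⟨g, hg, gc, gs⟩ := exists_cc_approx μ w hf (ε := ε / 2 / (C + 1))
    (by simp [ENNReal.div_eq_zero_iff, hε])
  filter_upwards [hU, eventually_translationDist_cc_le (μ := μ) (w := w) gc gs hε2] with y hy h
  calc translationDist μ w f y
      ≤ translationDist μ w g y + (w y + 1) * eLpNorm (f - g) 1 (wMeasure μ w) :=
        translationDist_le_add hf.1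
          (gc.stronglyMeasurable_of_hasCompactSupport gs).aestronglyMeasurable y
    _ ≤ ε / 2 + (C + 1) * (ε / 2 / (C + 1)) := by
        gcongr
        exact_mod_cast hC y hy
    _ ≤ ε / 2 + ε / 2 := by gcongr; exact ENNReal.mul_div_le
    _ = ε := ENNReal.add_halves ε

theorem measurePreserving_conj_wMeasure [μ.IsMulRightInvariant] (hw : w.IsClassFunction) (z : G) :
    MeasurePreserving (fun x => z * x * z⁻¹) (wMeasure μ w) (wMeasure μ w) := by
  refine ⟨(measurableEmbedding_conj z).measurable, ?_⟩
  ext s hs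
  have hc := measurePreserving_conj μ z
  rw [(measurableEmbedding_conj z).map_apply, wMeasure, withDensity_apply _ hs,
    withDensity_apply _ ((measurableEmbedding_conj z).measurable hs),
    ← hc.setLIntegral_comp_preimage_emb (measurableEmbedding_conj z) (fun x => (w x : ℝ≥0∞)) s]
  have h : ∀ x, w (z * x * z⁻¹) = w x := fun x => hw x z
  simp only [h]

/-- The measure w(x) dx is conjugation invariant, so x may be replaced by z x z⁻¹; the translate by
z y z⁻¹ then becomes f(z y⁻¹ x z⁻¹), which is f(y⁻¹ x) for almost every x. -/
theorem translationDist_conj [μ.IsMulRightInvariant] (hw : w.IsClassFunction) {E : Type*}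
    [NormedAddCommGroup E] {f : G → E} (hfm : AEStronglyMeasurable f (wMeasure μ w))
    (hf : ∀ z, ∀ᵐ x ∂μ, f (z * x * z⁻¹) = f x) (z y : G) :
    translationDist μ w f (z * y * z⁻¹) = translationDist μ w f y := by
  have hc := measurePreserving_conj_wMeasure (μ := μ) hw z
  have h0 := eLpNorm_comp_measurePreserving (p := 1)
    ((aestronglyMeasurable_translate hfm (z * y * z⁻¹)).sub hfm) hc
  refine h0.symm.trans ?_
  refine eLpNorm_congr_ae ((wMeasure_ac μ w).ae_le ?_)
  filter_upwards [hf z, (measurePreserving_mul_left μ y⁻¹).quasiMeasurePreserving.ae (hf z)]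
    with x h1 h2
  simp only [Function.comp_apply, Pi.sub_apply]
  rw [h1, ← h2]
  congr 2
  group

end Translation

/-! ### Averages of translates -/

section Average

variable {G : Type*} [Group G] [TopologicalSpace G] [IsTopologicalGroup G] [T2Space G]
  [LocallyCompactSpace G] [MeasurableSpace G] [BorelSpace G]
  {μ : Measure G} [μ.IsHaarMeasure] [μ.Regular] {w : Weight G}
  {E : Type*} [NormedAddCommGroup E] [NormedSpace ℂ E] [CompleteSpace E]

/-- The average of the translates of `f` by the elements of `W`. -/
noncomputable def translationAverage {G : Type*} [Group G] [MeasurableSpace G] (μ : Measure G)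
    {E : Type*} [NormedAddCommGroup E] [NormedSpace ℂ E] (W : Set G) (f : G → E) (x : G) : E :=
  ⨍ y in W, f (y⁻¹ * x) ∂μ

/-- The passage from invariance almost everywhere to invariance at every point. After the
substitution y ↦ z y z⁻¹ in W the integrand is f(z y⁻¹ x z⁻¹); for each fixed x the exceptional y
form a null set, since y ↦ y⁻¹ x preserves μ, and the integral ignores them. -/
theorem translationAverage_conj [μ.IsMulRightInvariant] {W : Set G}
    (hWc : ∀ z : G, (fun x => z * x * z⁻¹) ⁻¹' W = W) {f : G → E}
    (hf : ∀ z, ∀ᵐ x ∂μ, f (z * x * z⁻¹) = f x) (x z : G) :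
    translationAverage μ W f (z * x * z⁻¹) = translationAverage μ W f x := by
  have hc := measurePreserving_conj μ z
  rw [translationAverage, translationAverage, setAverage_eq, setAverage_eq,
    ← hc.setIntegral_preimage_emb (measurableEmbedding_conj z), hWc]
  congr 1
  refine integral_congr_ae (ae_restrict_of_ae ?_)
  filter_upwards [(measurePreserving_inv_mul μ x).quasiMeasurePreserving.ae (hf z)] with y h
  rw [← h]
  congr 1
  group

theorem continuous_translationAverage {W : Set G} (hW : IsCompact (closure W))
    {g : G → E} (hg : Continuous g) (hg' : HasCompactSupport g) :
    Continuous (translationAverage μ W g) ∧ HasCompactSupport (translationAverage μ W g) := by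
  have he : translationAverage μ W g = fun x => (μ.real W)⁻¹ • ∫ y in W, g (y⁻¹ * x) ∂μ :=
    funext fun x => setAverage_eq _ _ _
  constructor
  · rw [he]
    refine Continuous.const_smul (continuous_iff_continuousAt.2 fun x₀ => ?_) _
    obtain ⟨s, hs, hs1⟩ := exists_compact_mem_nhds x₀
    refine (continuousOn_integral_of_compact_support (hs.mul hg'.isCompact.inv)
      (f := fun x y => g (y⁻¹ * x)) (Continuous.continuousOn ?_) ?_).continuousAt hs1
    · simp only [Function.uncurry_def]
      fun_prop
    · intro x y hx hy
      by_contra h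
      exact hy ⟨x, hx, x⁻¹ * y, by simpa using subset_tsupport _ h, by simp⟩
  · refine HasCompactSupport.intro (hW.mul hg'.isCompact) fun x hx => ?_
    rw [translationAverage, setAverage_eq, setIntegral_eq_zero_of_forall_eq_zero, smul_zero]
    intro y hy
    by_contra h
    exact hx ⟨y, subset_closure hy, y⁻¹ * x, subset_tsupport _ h, by simp⟩

/-- For y in W the points y⁻¹ x stay in a compact set, on which convergence in L¹_w implies
convergence in L¹(dx). Hence the averages converge at each x without exception. -/
theorem tendsto_translationAverage [μ.IsMulRightInvariant] {W : Set G}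
    (hW : IsCompact (closure W)) {f : G → E} {g : ℕ → G → E}
    (hf : MemLp f 1 (wMeasure μ w)) (hgc : ∀ n, Continuous (g n))
    (hgs : ∀ n, HasCompactSupport (g n))
    (hg : Tendsto (fun n => eLpNorm (f - g n) 1 (wMeasure μ w)) atTop (𝓝 0)) (x : G) :
    Tendsto (fun n => translationAverage μ W (g n) x) atTop (𝓝 (translationAverage μ W f x)) := by
  simp only [translationAverage, setAverage_eq]
  refine Tendsto.const_smul ?_ _
  set K : Set G := (fun t : G => t⁻¹ * x) '' closure W
  have hK : IsCompact K := hW.image (by fun_prop)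
  have hWK : W ⊆ (fun y : G => y⁻¹ * x) ⁻¹' K := fun y hy =>
    Set.mem_image_of_mem _ (subset_closure hy)
  obtain ⟨C, hC⟩ := w.exists_one_le_mul hK
  have hp := measurePreserving_inv_mul μ x
  have he := measurableEmbedding_inv_mul x
  have hint : ∀ {h : G → E}, MemLp h 1 (wMeasure μ w) →
      Integrable (fun y => h (y⁻¹ * x)) (μ.restrict W) := fun hh =>
    ((hp.integrableOn_comp_preimage he).2 (integrableOn_isCompact hh hK)).mono_set hWK
  refine tendsto_integral_of_L1' _ (hint hf).1 (Eventually.of_forall fun n =>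
    hint ((hgc n).memLp_of_hasCompactSupport (hgs n))) ?_
  have h0 : Tendsto (fun n => C * eLpNorm (f - g n) 1 (wMeasure μ w)) atTop (𝓝 0) := by
    simpa using ENNReal.Tendsto.const_mul hg (Or.inr ENNReal.coe_ne_top)
  refine tendsto_of_tendsto_of_tendsto_of_le_of_le tendsto_const_nhds h0 (fun _ => zero_le)
    fun n => ?_
  rw [eLpNorm_sub_comm]
  refine le_trans ?_ (setLIntegral_enorm_le (μ := μ) hC hK.measurableSet (f - g n))
  rw [eLpNorm_one_eq_lintegral_enorm, ← hp.setLIntegral_comp_preimage_emb he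
    (fun x => ‖(f - g n) x‖ₑ) K]
  exact lintegral_mono_set hWK

/-- Minkowski's inequality: the norm of an average is at most the average of the norms. Continuity
and compact support of g justify the exchange of integrals. -/
theorem eLpNorm_translationAverage_sub_cc_le {W : Set G} (hW : IsCompact (closure W))
    (hWm : MeasurableSet W) (hW0 : μ W ≠ 0) {g : G → E} (hg : Continuous g)
    (hg' : HasCompactSupport g) {c : ℝ≥0∞} (hc : ∀ y ∈ W, translationDist μ w g y ≤ c) :
    eLpNorm (translationAverage μ W g - g) 1 (wMeasure μ w) ≤ c := by
  set ν := wMeasure μ w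
  have hWfin : μ W ≠ ∞ := ((measure_mono subset_closure).trans_lt hW.measure_lt_top).ne
  obtain ⟨χ, h1, -, hχs, -⟩ := exists_continuous_one_zero_of_isCompact hW isClosed_empty
    (Set.disjoint_empty _)
  set L := closure W * tsupport g ∪ tsupport g
  have hL : IsCompact L := (hW.mul hg'.isCompact).union hg'.isCompact
  have hL0 : ∀ x y, y ∈ W → x ∉ L → g (y⁻¹ * x) - g x = 0 := by
    intro x y hy hx
    have h1 : g x = 0 := by
      by_contra h
      exact hx (Or.inr (subset_tsupport _ h))
    have h2 : g (y⁻¹ * x) = 0 := by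
      by_contra h
      exact hx (Or.inl ⟨y, subset_closure hy, y⁻¹ * x, subset_tsupport _ h, by simp⟩)
    simp [h1, h2]
  -- The cutoff χ is 1 on the closure of W and makes F compactly supported in both variables. This
  -- gives measurability for the product σ-algebra, which may be smaller than the Borel σ-algebra of
  -- G × G.
  let F : G × G → E := fun p => χ p.2 • (g (p.2⁻¹ * p.1) - g p.1)
  have hFs : HasCompactSupport F := by
    refine HasCompactSupport.intro (K := (tsupport χ * tsupport g ∪ tsupport g) ×ˢ tsupport χ)
      (((hχs.isCompact.mul hg'.isCompact).union hg'.isCompact).prod hχs.isCompact) ?_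
    rintro ⟨x, y⟩ hxy
    by_contra h
    have hy := subset_tsupport _ (left_ne_zero_of_smul h)
    have h2 := right_ne_zero_of_smul h
    refine hxy ⟨?_, hy⟩
    by_contra hx
    have e1 : g x = 0 := by
      by_contra h
      exact hx (Or.inr (subset_tsupport _ h))
    have e2 : g (y⁻¹ * x) = 0 := by
      by_contra h
      exact hx (Or.inl ⟨y, hy, y⁻¹ * x, subset_tsupport _ h, by simp⟩)
    exact h2 (by simp [e1, e2])
  have hFm : Measurable fun p => ‖F p‖ₑ := by
    have : Measurable fun p => ‖F p‖ := hFs.norm.measurable_of_prod (by fun_prop)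
    simpa only [ofReal_norm] using this.ennreal_ofReal
  have hFe : ∀ x, ∀ y ∈ W, ‖g (y⁻¹ * x) - g x‖ₑ = ‖F (x, y)‖ₑ := fun x y hy => by
    simp [F, h1 (subset_closure hy)]
  have : IsFiniteMeasure (ν.restrict L) := ⟨by simpa using hL.measure_lt_top⟩
  have : IsFiniteMeasure (μ.restrict W) := ⟨by simpa using hWfin.lt_top⟩
  have hpt : ∀ x, ‖translationAverage μ W g x - g x‖ₑ ≤
      (μ W)⁻¹ * ∫⁻ y in W, ‖g (y⁻¹ * x) - g x‖ₑ ∂μ := by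
    intro x
    have hi : IntegrableOn (fun y => g (y⁻¹ * x)) W μ :=
      Integrable.integrableOn (Continuous.integrable_of_hasCompactSupport (by fun_prop)
        (hg'.comp_homeomorph ((Homeomorph.inv G).trans (Homeomorph.mulRight x))))
    have : translationAverage μ W g x - g x =
        (μ.real W)⁻¹ • ∫ y in W, (g (y⁻¹ * x) - g x) ∂μ := by
      rw [integral_sub hi (integrable_const _), smul_sub, translationAverage, setAverage_eq,
        setIntegral_const, smul_smul, inv_mul_cancel₀, one_smul]
      exact (ENNReal.toReal_pos hW0 hWfin).ne'
    rw [this, enorm_smul]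
    refine mul_le_mul' (le_of_eq ?_) (enorm_integral_le_lintegral_enorm _)
    rw [Measure.real, ← ENNReal.toReal_inv, Real.enorm_eq_ofReal ENNReal.toReal_nonneg,
      ENNReal.ofReal_toReal (by simpa using hW0)]
  calc eLpNorm (translationAverage μ W g - g) 1 ν
      ≤ ∫⁻ x, (μ W)⁻¹ * ∫⁻ y in W, ‖g (y⁻¹ * x) - g x‖ₑ ∂μ ∂ν := by
        rw [eLpNorm_one_eq_lintegral_enorm]
        exact lintegral_mono hpt
    _ = (μ W)⁻¹ * ∫⁻ x, ∫⁻ y in W, ‖g (y⁻¹ * x) - g x‖ₑ ∂μ ∂ν :=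
        lintegral_const_mul' _ _ (by simpa using hW0)
    _ = (μ W)⁻¹ * ∫⁻ x in L, ∫⁻ y in W, ‖g (y⁻¹ * x) - g x‖ₑ ∂μ ∂ν := by
        congr 1
        rw [setLIntegral_eq_of_support_subset]
        intro x hx
        by_contra hxL
        refine hx ((setLIntegral_congr_fun hWm fun y hy => ?_).trans lintegral_zero)
        simp [hL0 x y hy hxL]
    _ = (μ W)⁻¹ * ∫⁻ x in L, ∫⁻ y in W, ‖F (x, y)‖ₑ ∂μ ∂ν := by
        congr 1
        refine lintegral_congr fun x => setLIntegral_congr_fun hWm fun y hy => hFe x y hy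
    _ = (μ W)⁻¹ * ∫⁻ y in W, ∫⁻ x in L, ‖F (x, y)‖ₑ ∂ν ∂μ := by
        rw [lintegral_lintegral_swap hFm.aemeasurable]
    _ ≤ (μ W)⁻¹ * ∫⁻ y in W, c ∂μ := by
        refine mul_le_mul' le_rfl ?_
        refine setLIntegral_mono' hWm fun y hy => le_trans ?_ (hc y hy)
        rw [translationDist, eLpNorm_one_eq_lintegral_enorm]
        refine (setLIntegral_le_lintegral _ _).trans (lintegral_mono fun x => ?_)
        exact (hFe x y hy).ge
    _ = c := by
        rw [setLIntegral_const, mul_comm c, ← mul_assoc, ENNReal.inv_mul_cancel hW0 hWfin, one_mul]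

variable {A : Type*} [NonUnitalNormedRing A] [NormedSpace ℂ A] [IsScalarTower ℂ A A]
  [SMulCommClass ℂ A A] [CompleteSpace A]

/-- Both claims pass from continuous compactly supported approximants to f: measurability because
the averages converge at every point, the bound by Fatou's lemma. -/
theorem exists_translationAverage [μ.IsMulRightInvariant] {W : Set G} (hW : IsCompact (closure W))
    (hWm : MeasurableSet W) (hW0 : μ W ≠ 0) {f : G → A} (hf : MemLp f 1 (wMeasure μ w))
    {c : ℝ≥0∞} (hc : ∀ y ∈ W, translationDist μ w f y ≤ c) :
    StronglyMeasurable (translationAverage μ W f) ∧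
      eLpNorm (translationAverage μ W f - f) 1 (wMeasure μ w) ≤ c := by
  obtain ⟨g, gc, gs, gn, gt⟩ := exists_cc_seq μ w hf one_pos
  obtain ⟨C, hC⟩ := w.exists_bound hW
  have hpow : Tendsto (fun n : ℕ => (2⁻¹ : ℝ≥0∞) ^ n) atTop (𝓝 0) :=
    ENNReal.tendsto_pow_atTop_nhds_zero_of_lt_one (by simp)
  simp only [ENNReal.coe_one, one_mul] at gn
  have ht := tendsto_translationAverage hW hf gc gs
    (tendsto_of_tendsto_of_tendsto_of_le_of_le tendsto_const_nhds hpow (fun _ => zero_le) gn)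
  have hgm : ∀ n, StronglyMeasurable (g n) := fun n =>
    (gc n).stronglyMeasurable_of_hasCompactSupport (gs n)
  have hm : ∀ n, StronglyMeasurable (translationAverage μ W (g n)) := fun n =>
    have h := continuous_translationAverage (μ := μ) hW (gc n) (gs n)
    h.1.stronglyMeasurable_of_hasCompactSupport h.2
  refine ⟨stronglyMeasurable_of_tendsto atTop hm (tendsto_pi_nhds.2 ht), ?_⟩
  have hle : ∀ n, eLpNorm (translationAverage μ W (g n) - g n) 1 (wMeasure μ w) ≤
      c + (C + 1) * 2⁻¹ ^ n := fun n =>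
    eLpNorm_translationAverage_sub_cc_le hW hWm hW0 (gc n) (gs n) fun y hy => by
      refine (translationDist_le_add (hgm n).aestronglyMeasurable hf.1 y).trans ?_
      gcongr
      · exact hc y hy
      · exact_mod_cast hC y (subset_closure hy)
      · rw [eLpNorm_sub_comm]
        exact gn n
  have hlim : Tendsto (fun n : ℕ => c + (C + 1) * (2⁻¹ : ℝ≥0∞) ^ n) atTop (𝓝 c) := by
    have := (tendsto_const_nhds (x := c)).add (ENNReal.Tendsto.const_mul (a := (C : ℝ≥0∞) + 1)
      hpow (Or.inr (by simp)))
    simpa using this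
  refine (Lp.eLpNorm_lim_le_liminf_eLpNorm
    (f := fun n => translationAverage μ W (g n) - g n)
    (fun n => ((hm n).sub (hgm n)).aestronglyMeasurable) _
    ((wMeasure_ac μ w).ae_le ?_)).trans ?_
  · filter_upwards [gt] with x hx
    exact (ht x).sub hx
  · rw [← hlim.liminf_eq]
    exact liminf_le_liminf (Eventually.of_forall hle)

end Average
-- Measurability with respect to the invariant sets
section InvMeasurable

variable {G : Type*} [Group G] [MeasurableSpace G] {E : Type*}

theorem invMeasurableSpace_le : invMeasurableSpace G ≤ (inferInstance : MeasurableSpace G) :=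
  fun _ hs => hs.1

/-- Points are closed in E, so the level sets of an invariantly measurable function are invariant;
conversely all preimages under a class function are invariant. This is assertion (1) at the level of
functions. -/
theorem stronglyMeasurable_inv_iff [NormedAddCommGroup E] {h : G → E} :
    StronglyMeasurable[invMeasurableSpace G] h ↔
      StronglyMeasurable h ∧ ∀ x y : G, h (y * x * y⁻¹) = h x := by
  borelize E
  constructor
  · intro hh
    refine ⟨hh.mono invMeasurableSpace_le, fun x y => ?_⟩
    have h1 := (hh.measurable (measurableSet_singleton (h x))).2 y
    have h2 : x ∈ (fun x => y * x * y⁻¹) ⁻¹' (h ⁻¹' {h x}) := by rw [h1]; rfl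
    exact h2
  · rintro ⟨hh, hc⟩
    refine stronglyMeasurable_iff_measurable_separable.2 ⟨fun s hs => ⟨hh.measurable hs,
      fun y => ?_⟩, hh.isSeparable_range⟩
    ext x
    simp only [Set.mem_preimage, hc]

end InvMeasurable

/-! ### From invariance almost everywhere to class functions -/

section Strict

variable {G : Type*} [Group G] [TopologicalSpace G] [IsTopologicalGroup G] [T2Space G]
  [LocallyCompactSpace G] [MeasurableSpace G] [BorelSpace G]
  {μ : Measure G} [μ.IsHaarMeasure] [μ.Regular] {w : Weight G}
  {A : Type*} [NonUnitalNormedRing A] [NormedSpace ℂ A] [IsScalarTower ℂ A A]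
  [SMulCommClass ℂ A A] [CompleteSpace A]

theorem preimage_conj_interior {S : Set G} (hS : ∀ z : G, (fun x => z * x * z⁻¹) ⁻¹' S = S) (z : G) :
    (fun x => z * x * z⁻¹) ⁻¹' interior S = interior S := by
  conv_rhs => rw [← hS z]
  exact ((Homeomorph.mulLeft z).trans (Homeomorph.mulRight z⁻¹)).preimage_interior S

/-- The sublevel set of the translation distance is an invariant neighbourhood of 1, but need not be
relatively compact; the [IN] hypothesis supplies an invariant compact set to intersect it with. -/
theorem IsINGroup.exists_translationDist_le (hG : IsINGroup G) [μ.IsMulRightInvariant]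
    (hw : w.IsClassFunction) {f : G → A} (hf : MemLp f 1 (wMeasure μ w))
    (hfc : ∀ z, ∀ᵐ x ∂μ, f (z * x * z⁻¹) = f x) {ε : ℝ≥0∞} (hε : ε ≠ 0) :
    ∃ W : Set G, IsOpen W ∧ (1 : G) ∈ W ∧ IsCompact (closure W) ∧
      (∀ z : G, (fun x => z * x * z⁻¹) ⁻¹' W = W) ∧ ∀ y ∈ W, translationDist μ w f y ≤ ε := by
  obtain ⟨V, hV, hV1, hVc⟩ := hG
  set P : Set G := {y | translationDist μ w f y ≤ ε}
  have hVc' : ∀ z : G, (fun x => z * x * z⁻¹) ⁻¹' V = V := fun z => by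
    conv_lhs => rw [← hVc z]
    exact Set.preimage_image_eq _ (measurableEmbedding_conj z).injective
  have hP : ∀ z : G, (fun x => z * x * z⁻¹) ⁻¹' P = P := fun z => by
    ext y
    simp only [P, Set.mem_preimage, Set.mem_ofPred_eq, translationDist_conj hw hf.1 hfc]
  refine ⟨interior P ∩ interior V, isOpen_interior.inter isOpen_interior,
    ⟨mem_interior_iff_mem_nhds.2 (eventually_translationDist_le hf hε),
      mem_interior_iff_mem_nhds.2 hV1⟩,
    hV.closure_of_subset (Set.inter_subset_right.trans interior_subset), fun z => ?_,
    fun y hy => (interior_subset hy.1 : y ∈ P)⟩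
  rw [Set.preimage_inter, preimage_conj_interior hP, preimage_conj_interior hVc']

/-- For a weight which is a class function, an element of `L¹_w(G, A)` which is invariant under
each conjugation is represented by a class function. -/
theorem IsINGroup.exists_stronglyMeasurable_inv (hG : IsINGroup G) [μ.IsMulRightInvariant]
    (hw : w.IsClassFunction) {f : G → A} (hf : MemLp f 1 (wMeasure μ w))
    (hfc : ∀ z, ∀ᵐ x ∂μ, f (z * x * z⁻¹) = f x) :
    ∃ g : G → A, StronglyMeasurable[invMeasurableSpace G] g ∧ f =ᵐ[μ] g := by
  -- The classes with an invariantly measurable representative are closed in L¹_w, so it suffices to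
  -- approximate f by averages over small invariant sets.
  have hcl := isClosed_aestronglyMeasurable (F := A) (p := 1) (μ := wMeasure μ w)
    (invMeasurableSpace_le (G := G))
  have hmem : hf.toLp f ∈ closure {f : Lp A 1 (wMeasure μ w) |
      AEStronglyMeasurable[invMeasurableSpace G] f (wMeasure μ w)} := by
    refine EMetric.mem_closure_iff.2 fun ε hε => ?_
    obtain ⟨δ, hδ, hδε⟩ := exists_between hε
    obtain ⟨W, hWo, hW1, hWc, hWi, hWd⟩ := hG.exists_translationDist_le hw hf hfc hδ.ne'
    obtain ⟨h1, h2⟩ := exists_translationAverage hWc hWo.measurableSet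
      (hWo.measure_pos μ ⟨1, hW1⟩).ne' hf hWd
    have h3 : StronglyMeasurable[invMeasurableSpace G] (translationAverage μ W f) :=
      stronglyMeasurable_inv_iff.2 ⟨h1, fun x z => translationAverage_conj hWi hfc x z⟩
    have h4 : MemLp (translationAverage μ W f) 1 (wMeasure μ w) := by
      have h5 : MemLp (translationAverage μ W f - f) 1 (wMeasure μ w) :=
        ⟨h1.aestronglyMeasurable.sub hf.1, h2.trans_lt (hδε.trans_le le_top)⟩
      simpa using h5.add hf
    refine ⟨h4.toLp _, ⟨_, h3, h4.coeFn_toLp⟩, ?_⟩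
    rw [Lp.edist_toLp_toLp, eLpNorm_sub_comm]
    exact h2.trans_lt hδε
  rw [hcl.closure_eq] at hmem
  obtain ⟨g, hg, hfg⟩ := hmem
  exact ⟨g, hg, (ac_wMeasure μ w).ae_le (hf.coeFn_toLp.symm.trans hfg)⟩

/-- The constant weight `1`. -/
def Weight.one (G : Type*) [Group G] [MeasurableSpace G] : Weight G where
  toFun _ := 1
  measurable' := measurable_const
  pos' _ := one_pos
  mul_le' _ _ := by simp

/-- The existence of a class function equal to f almost everywhere does not refer to the weight.
When w ≥ 1, f also lies in L¹(G), and the constant weight 1 is a class function. -/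
theorem IsINGroup.mem_L1inv (hG : IsINGroup G) (hw : w.IsClassFunction ∨ ∀ x : G, 1 ≤ w x)
    (f : L1w μ w A) (hfc : ∀ z, ∀ᵐ x ∂μ, f (z * x * z⁻¹) = f x) : f ∈ L1inv μ w A := by
  have := hG.isMulRightInvariant (μ := μ)
  rcases hw with hw | hw
  · exact hG.exists_stronglyMeasurable_inv hw f.memLp hfc
  · refine hG.exists_stronglyMeasurable_inv (w := Weight.one G) (fun _ _ => rfl) ?_ hfc
    refine ⟨(f.memLp.1.mono_ac (ac_wMeasure μ w)).mono_ac (wMeasure_ac μ _),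
      lt_of_le_of_lt ?_ f.memLp.2⟩
    rw [eLpNorm_one_eq_lintegral_enorm, eLpNorm_one_eq_lintegral_enorm, lintegral_wMeasure,
      lintegral_wMeasure]
    refine lintegral_mono fun x => ?_
    gcongr
    exact hw x

end Strict

/-! ### Class functions with central values are central -/

section ClassCentral

variable {G : Type*} [Group G] [TopologicalSpace G] [IsTopologicalGroup G] [T2Space G]
  [LocallyCompactSpace G] [MeasurableSpace G] [BorelSpace G]
  {μ : Measure G} [μ.IsHaarMeasure] [μ.Regular] {w : Weight G}
  {A : Type*} [NonUnitalNormedRing A] [NormedSpace ℂ A] [IsScalarTower ℂ A A]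
  [SMulCommClass ℂ A A] [CompleteSpace A] [μ.IsMulRightInvariant]

/-- Inverting y and then substituting x⁻¹ y x turns f(x y) g(y⁻¹) into f(y⁻¹ x) g(x⁻¹ y x), which
equals g(y) f(y⁻¹ x); both substitutions preserve μ because G is unimodular. -/
theorem conv_comm_of_class {f g : G → A} (hg : ∀ x y : G, g (y * x * y⁻¹) = g x)
    (hgA : ∀ x, g x ∈ Z A) : conv μ f g = conv μ g f := by
  have : μ.IsInvInvariant := isInvInvariant_of_isMulRightInvariant
  funext x
  rw [conv_eq μ g f, conv, ← integral_inv_eq_self,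
    ← (measurePreserving_conj μ x⁻¹).integral_comp (measurableEmbedding_conj x⁻¹)]
  congr with y
  rw [(mem_Z_iff _ _).1 (hgA _), inv_inv, hg]
  congr 2
  group

theorem mem_center_of_class {F : L1w μ w A} {g : G → A} (hFg : (F : G → A) =ᵐ[μ] g)
    (hg : ∀ x y : G, g (y * x * y⁻¹) = g x) (hgA : ∀ x, g x ∈ Z A) : F ∈ Z (L1w μ w A) := by
  refine (mem_Z_iff _ _).2 fun f => L1w.ext ?_
  refine (L1w.conv_congr (ae_eq_refl _) hFg).trans ?_
  rw [conv_comm_of_class hg hgA]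
  exact (L1w.conv_congr hFg (ae_eq_refl _)).symm

end ClassCentral
-- The universal property of the projective tensor product
section ProjUniversal

variable {E F K : Type*} [NormedAddCommGroup E] [NormedSpace ℂ E]
  [NormedAddCommGroup F] [NormedSpace ℂ F] [NormedAddCommGroup K] [NormedSpace ℂ K]

theorem ProjTensor.norm_tmul_le (x : E) (y : F) : ‖ProjTensor.tmul x y‖ ≤ ‖x‖ * ‖y‖ := by
  rw [ProjTensor.tmul, LinearIsometry.norm_map]
  have h : (AlgTensor.tmul x y).projNorm ≤ ‖x‖ * ‖y‖ := by
    simpa using AlgTensor.projNorm_le (u := AlgTensor.tmul x y) [(x, y)] (by simp)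
  exact h

/-- The canonical bilinear map `E × F → E ⊗^γ F`. -/
noncomputable def ProjTensor.tmulL : E →L[ℂ] F →L[ℂ] ProjTensor E F :=
  LinearMap.mkContinuous₂ (LinearMap.mk₂ ℂ ProjTensor.tmul
    (fun x x' y => by
      simp only [ProjTensor.tmul, ← map_add]
      exact congrArg _ (TensorProduct.add_tmul x x' y))
    (fun c x y => by
      simp only [ProjTensor.tmul, ← map_smul]
      exact congrArg _ (TensorProduct.smul_tmul' c x y).symm)
    (fun x y y' => by
      simp only [ProjTensor.tmul, ← map_add]
      exact congrArg _ (TensorProduct.tmul_add x y y'))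
    (fun c x y => by
      simp only [ProjTensor.tmul, ← map_smul]
      exact congrArg _ (TensorProduct.tmul_smul c x y))) 1
    fun x y => by rw [one_mul]; exact ProjTensor.norm_tmul_le x y

theorem ProjTensor.tmulL_apply (x : E) (y : F) : ProjTensor.tmulL x y = ProjTensor.tmul x y := rfl

/-- A closed additive property of the elementary tensors holds on all of `E ⊗^γ F`. -/
theorem ProjTensor.induction_on {p : ProjTensor E F → Prop} (hp : IsClosed {u | p u})
    (h0 : p 0) (htmul : ∀ x y, p (ProjTensor.tmul x y)) (hadd : ∀ u v, p u → p v → p (u + v))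
    (u : ProjTensor E F) : p u := by
  refine ProjTensor.denseRange_ofAlg.induction_on u hp fun v => ?_
  induction v using TensorProduct.induction_on with
  | zero => exact (congrArg p (map_zero ProjTensor.ofAlg)).mpr h0
  | tmul x y => exact htmul x y
  | add u v hu hv => exact (congrArg p (map_add ProjTensor.ofAlg u v)).mpr (hadd _ _ hu hv)

/-- By the triangle inequality the norm of the image is at most the cost of each representation of
u, hence at most the infimum of the costs. -/
theorem AlgTensor.exists_lift (b : E →ₗ[ℂ] F →ₗ[ℂ] K) (hb : ∀ x y, ‖b x y‖ ≤ ‖x‖ * ‖y‖) :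
    ∃ t : AlgTensor E F →L[ℂ] K, (∀ x y, t (AlgTensor.tmul x y) = b x y) ∧ ∀ u, ‖t u‖ ≤ ‖u‖ := by
  let t : AlgTensor E F →ₗ[ℂ] K := (TensorProduct.lift b : E ⊗[ℂ] F →ₗ[ℂ] K)
  have ht : ∀ x y, t (AlgTensor.tmul x y) = b x y := fun x y => TensorProduct.lift.tmul x y
  have hl : ∀ l : List (E × F), ‖t (l.map fun p => AlgTensor.tmul p.1 p.2).sum‖ ≤
      (l.map fun p => ‖p.1‖ * ‖p.2‖).sum := by
    intro l
    induction l with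
    | nil => simp
    | cons p l ih =>
      rw [List.map_cons, List.map_cons, List.sum_cons, List.sum_cons, map_add, ht]
      exact (norm_add_le _ _).trans (add_le_add (hb _ _) ih)
  have htn : ∀ u : AlgTensor E F, ‖t u‖ ≤ u.projNorm := by
    intro u
    refine le_of_forall_pos_le_add fun ε hε => ?_
    obtain ⟨l, rfl, hl'⟩ := u.exists_lt hε
    exact (hl l).trans hl'.le
  exact ⟨t.mkContinuous 1 fun u => (htn u).trans (one_mul ‖u‖).ge, ht, htn⟩

/-- The universal property of the projective tensor product. -/
theorem ProjTensor.exists_lift [CompleteSpace K] (b : E →ₗ[ℂ] F →ₗ[ℂ] K)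
    (hb : ∀ x y, ‖b x y‖ ≤ ‖x‖ * ‖y‖) : ∃ T : ProjTensor E F →L[ℂ] K,
      (∀ x y, T (ProjTensor.tmul x y) = b x y) ∧ ∀ u, ‖T u‖ ≤ ‖u‖ := by
  obtain ⟨t, ht, htn⟩ := AlgTensor.exists_lift b hb
  let T : ProjTensor E F →L[ℂ] K := t.extend ProjTensor.ofAlg.toContinuousLinearMap
  have h1 : IsUniformInducing (ProjTensor.ofAlg (E := E) (F := F)).toContinuousLinearMap :=
    ProjTensor.ofAlg.isometry.isUniformInducing
  have h2 : DenseRange (ProjTensor.ofAlg (E := E) (F := F)).toContinuousLinearMap :=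
    ProjTensor.denseRange_ofAlg
  have hT : ∀ u, T (ProjTensor.ofAlg u) = t u := t.extend_eq h2 h1
  refine ⟨T, fun x y => (hT _).trans (ht x y), fun u => ?_⟩
  refine ProjTensor.denseRange_ofAlg.induction_on (p := fun u => ‖T u‖ ≤ ‖u‖) u
    (isClosed_le T.continuous.norm continuous_norm) fun v => ?_
  rw [hT, LinearIsometry.norm_map]
  exact htn v

end ProjUniversal

/-! ### The isometry of L¹(ρ) ⊗^γ E with L¹(ρ, E) -/

section ProjL1

variable {X : Type*} [MeasurableSpace X] {ρ : Measure X} {Y E : Type*}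
  [NormedAddCommGroup Y] [NormedSpace ℂ Y] [NormedAddCommGroup E] [NormedSpace ℂ E]

open Classical in
/-- The vector measure `s ↦ (z ↦ 1_s ⊗ z)`. -/
noncomputable def indicatorTensor (e : Lp ℂ 1 ρ ≃ₗᵢ[ℂ] Y) (s : Set X) : E →L[ℝ] ProjTensor Y E :=
  if h : MeasurableSet s ∧ ρ s ≠ ∞ then
    (ProjTensor.tmulL (e (indicatorConstLp 1 h.1 h.2 (1 : ℂ)))).restrictScalars ℝ else 0

theorem indicatorTensor_apply (e : Lp ℂ 1 ρ ≃ₗᵢ[ℂ] Y) {s : Set X} (hs : MeasurableSet s)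
    (hs' : ρ s ≠ ∞) (z : E) : indicatorTensor e s z =
      ProjTensor.tmul (e (indicatorConstLp 1 hs hs' (1 : ℂ))) z := by
  rw [indicatorTensor, dif_pos ⟨hs, hs'⟩]
  rfl

/-- Since ‖1_s ⊗ z‖ ≤ ρ(s) ‖z‖, the constant is 1, and integration against this vector measure is a
contraction from L¹(ρ, E) to the tensor product. -/
theorem dominatedFinMeasAdditive_indicatorTensor (e : Lp ℂ 1 ρ ≃ₗᵢ[ℂ] Y) :
    DominatedFinMeasAdditive ρ (indicatorTensor e : Set X → E →L[ℝ] ProjTensor Y E) 1 := by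
  refine ⟨fun s t hs ht hs' ht' hst => ?_, fun s hs hs' => ?_⟩
  · ext z
    rw [_root_.add_apply, indicatorTensor_apply e hs hs',
      indicatorTensor_apply e ht ht', indicatorTensor_apply e (hs.union ht)
        (measure_union_ne_top hs' ht'), indicatorConstLp_disjoint_union hs ht hs' ht' hst,
      map_add, ← ProjTensor.tmulL_apply, map_add]
    rfl
  · refine ContinuousLinearMap.opNorm_le_bound _ (by positivity) fun z => ?_
    rw [indicatorTensor_apply e hs hs'.ne]
    refine (ProjTensor.norm_tmul_le _ _).trans (le_of_eq ?_)
    rw [e.norm_map, norm_indicatorConstLp one_ne_zero ENNReal.one_ne_top]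
    simp

variable [CompleteSpace E]

/-- The Banach space isometry `L¹(ρ) ⊗^γ E ≅ L¹(ρ, E)`. -/
theorem exists_projTensor_L1_equiv (e : Lp ℂ 1 ρ ≃ₗᵢ[ℂ] Y) :
    ∃ Θ : ProjTensor Y E ≃ₗᵢ[ℂ] Lp E 1 ρ,
      ∀ (f : Lp ℂ 1 ρ) (z : E), Θ (ProjTensor.tmul (e f) z) =ᵐ[ρ] fun x => f x • z := by
  let b : Y →ₗ[ℂ] E →ₗ[ℂ] Lp E 1 ρ := LinearMap.mk₂ ℂ
    (fun y z => (ContinuousLinearMap.toSpanSingleton ℂ z).compLp (e.symm y))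
    (fun y y' z => by
      rw [map_add]
      exact ((ContinuousLinearMap.toSpanSingleton ℂ z).compLpₗ 1 ρ).map_add _ _)
    (fun c y z => by
      rw [map_smul]
      exact ((ContinuousLinearMap.toSpanSingleton ℂ z).compLpₗ 1 ρ).map_smul _ _)
    (fun y z z' => by
      rw [← ContinuousLinearMap.add_compLp]
      congr 1
      ext
      simp)
    (fun c y z => by
      rw [← ContinuousLinearMap.smul_compLp]
      congr 1
      ext
      simp)
  have hb : ∀ f z, b (e f) z =ᵐ[ρ] fun x => f x • z := fun f z => by
    have : b (e f) z = (ContinuousLinearMap.toSpanSingleton ℂ z).compLp f := by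
      simp [b]
    rw [this]
    exact (ContinuousLinearMap.coeFn_compLp _ _).trans (by simp)
  obtain ⟨T, hT, hTn⟩ := ProjTensor.exists_lift b fun y z => by
    refine (ContinuousLinearMap.norm_compLp_le _ _).trans ?_
    rw [ContinuousLinearMap.norm_toSpanSingleton, e.symm.norm_map, mul_comm]
  -- S sends the function 1_s z to 1_s ⊗ z. Real linearity is enough: S serves only as a contractive
  -- two-sided inverse of the complex linear contraction T.
  let S : Lp E 1 ρ →L[ℝ] ProjTensor Y E :=
    L1.setToL1 (dominatedFinMeasAdditive_indicatorTensor e)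
  have hSn : ∀ f, ‖S f‖ ≤ ‖f‖ := fun f => by
    simpa using L1.norm_setToL1_le_mul_norm (dominatedFinMeasAdditive_indicatorTensor e)
      zero_le_one f
  have hS : ∀ {s : Set X} (hs : MeasurableSet s) (hs' : ρ s ≠ ∞) (z : E),
      S (indicatorConstLp 1 hs hs' z) =
        ProjTensor.tmul (e (indicatorConstLp 1 hs hs' (1 : ℂ))) z := fun hs hs' z =>
    (L1.setToL1_indicatorConstLp _ hs hs' z).trans (indicatorTensor_apply e hs hs' z)
  have hTi : ∀ {s : Set X} (hs : MeasurableSet s) (hs' : ρ s ≠ ∞) (c : ℂ) (z : E),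
      T (ProjTensor.tmul (e (indicatorConstLp 1 hs hs' c)) z) =
        indicatorConstLp 1 hs hs' (c • z) := fun {s} hs hs' c z => by
    rw [hT]
    refine Lp.ext ((hb _ _).trans ?_)
    filter_upwards [indicatorConstLp_coeFn (p := 1) (hs := hs) (hμs := hs') (c := c),
      indicatorConstLp_coeFn (p := 1) (hs := hs) (hμs := hs') (c := c • z)] with x h1 h2
    rw [h1, h2]
    by_cases hx : x ∈ s <;> simp [hx]
  have hTS : ∀ f, T (S f) = f := by
    refine Lp.induction ENNReal.one_ne_top _ ?_ ?_ ?_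
    · intro c s hs hs'
      rw [Lp.simpleFunc.coe_indicatorConst, hS, hTi, one_smul]
    · intro f g hf hg _ h1 h2
      rw [map_add, map_add, h1, h2]
    · exact isClosed_eq (by fun_prop) (by fun_prop)
  have hST : ∀ u, S (T u) = u := by
    refine ProjTensor.induction_on (isClosed_eq (by fun_prop) (by fun_prop)) (by simp) ?_
      fun u v hu hv => by rw [map_add, map_add, hu, hv]
    intro y z
    obtain ⟨f, rfl⟩ := e.surjective y
    refine Lp.induction ENNReal.one_ne_top
      (fun f => S (T (ProjTensor.tmul (e f) z)) = ProjTensor.tmul (e f) z) ?_ ?_ ?_ f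
    · intro c s hs hs'
      rw [Lp.simpleFunc.coe_indicatorConst, hTi, hS, ← ProjTensor.tmulL_apply,
        ← ProjTensor.tmulL_apply, map_smul]
      -- S returns 1_s ⊗ c z, so the scalar is moved to the other factor.
      have : indicatorConstLp 1 hs hs'.ne c = c • indicatorConstLp 1 hs hs'.ne (1 : ℂ) := by
        refine Lp.ext ?_
        filter_upwards [indicatorConstLp_coeFn (p := 1) (hs := hs) (hμs := hs'.ne) (c := c),
          indicatorConstLp_coeFn (p := 1) (hs := hs) (hμs := hs'.ne) (c := (1 : ℂ)),
          Lp.coeFn_smul c (indicatorConstLp 1 hs hs'.ne (1 : ℂ))] with x h1 h2 h3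
        rw [h1, h3, Pi.smul_apply, h2]
        by_cases hx : x ∈ s <;> simp [hx]
      rw [this, map_smul, map_smul]
      rfl
    · intro f g hf hg _ h1 h2
      simp only [← ProjTensor.tmulL_apply] at h1 h2 ⊢
      simp only [map_add, _root_.add_apply, h1, h2]
    · simp only [← ProjTensor.tmulL_apply]
      exact isClosed_eq (by fun_prop) (by fun_prop)
  let I : ProjTensor Y E →ₗᵢ[ℂ] Lp E 1 ρ :=
    -- T is isometric since ‖u‖ = ‖S (T u)‖ ≤ ‖T u‖ ≤ ‖u‖.
    ⟨T.toLinearMap, fun u => le_antisymm (hTn u) (by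
      conv_lhs => rw [← hST u]
      exact hSn _)⟩
  exact ⟨LinearIsometryEquiv.ofSurjective I fun f => ⟨S f, hTS f⟩, fun f z =>
    (hT (e f) z) ▸ hb f z⟩

end ProjL1
-- The form in which the approximate identity enters the proof: if A annihilates z, the net a_α z is
-- constantly 0 and tends to z.
theorem IsBoundedCenterApproxIdentity.eq_zero {A : Type*} [NonUnitalNormedRing A] [NormedSpace ℂ A]
    [IsScalarTower ℂ A A] [SMulCommClass ℂ A A] {ι : Type*} [Preorder ι] [IsDirectedOrder ι]
    [Nonempty ι] {a : ι → A} (ha : IsBoundedCenterApproxIdentity a) :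
    ∀ z ∈ Z A, (∀ b, b * z = 0) → z = 0 := fun z hz h => by
  have := ha.tendsto z hz
  simp only [h] at this
  exact (tendsto_nhds_unique tendsto_const_nhds this).symm

/-- A continuous linear map on `B ⊗^γ C` is multiplicative if it is so on elementary tensors. -/
theorem ProjTensor.map_mul_of_tmul {B C K : Type*}
    [NonUnitalNormedRing B] [NormedSpace ℂ B] [IsScalarTower ℂ B B] [SMulCommClass ℂ B B]
    [NonUnitalNormedRing C] [NormedSpace ℂ C] [IsScalarTower ℂ C C] [SMulCommClass ℂ C C]
    [NonUnitalNormedRing K] [NormedSpace ℂ K] (T : ProjTensor B C →L[ℂ] K)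
    (hT : ∀ b b' c c', T (ProjTensor.tmul (b * b') (c * c')) =
      T (ProjTensor.tmul b c) * T (ProjTensor.tmul b' c')) (u v : ProjTensor B C) :
    T (u * v) = T u * T v := by
  have hc := T.continuous
  refine ProjTensor.induction_on (p := fun u => T (u * v) = T u * T v)
    (isClosed_eq (hc.comp (continuous_mul_const v)) (hc.mul continuous_const)) ?_ ?_ ?_ u
  · rw [zero_mul, map_zero, zero_mul]
  · intro b c
    refine ProjTensor.induction_on
      (p := fun v => T (ProjTensor.tmul b c * v) = T (ProjTensor.tmul b c) * T v)
      (isClosed_eq (hc.comp (continuous_const_mul _)) (continuous_const.mul hc)) ?_ ?_ ?_ v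
    · rw [mul_zero, map_zero, mul_zero]
    · intro b' c'
      rw [ProjTensor.tmul_mul_tmul, hT]
    · intro u v hu hv
      rw [mul_add, map_add, map_add, hu, hv, mul_add]
  · intro u v hu hv
    rw [add_mul, map_add, map_add, hu, hv, add_mul]

/-! ### Identification of the invariant space with the centre and the tensor product -/

section TrimEquiv

variable {G : Type*} [Group G] [MeasurableSpace G] (μ : Measure G) (w : Weight G)
  (E : Type*) [NormedAddCommGroup E] [NormedSpace ℂ E]

/-- `L¹_{w,inv}(G, E)` is the `L¹` space of the restriction of `w(x) dx` to the conjugation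
invariant sets. -/
theorem exists_L1inv_equiv : ∃ e : L1inv μ w E ≃ₗᵢ[ℂ]
    Lp E 1 ((wMeasure μ w).trim (invMeasurableSpace_le (G := G))),
      ∀ f, (e f : G → E) =ᵐ[μ] f.1 := by
  let e₀ : L1inv μ w E ≃ₗᵢ[ℂ] lpMeas E ℂ (invMeasurableSpace G) 1 (wMeasure μ w) :=
    { toFun := fun f => ⟨f.1, f.2.imp fun g hg => ⟨hg.1, (wMeasure_ac μ w).ae_le hg.2⟩⟩
      invFun := fun f => ⟨f.1, f.2.imp fun g hg => ⟨hg.1, (ac_wMeasure μ w).ae_le hg.2⟩⟩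
      left_inv := fun _ => rfl
      right_inv := fun _ => rfl
      map_add' := fun _ _ => rfl
      map_smul' := fun _ _ => rfl
      norm_map' := fun _ => rfl }
  exact ⟨e₀.trans (lpMeasToLpTrimLie E ℂ 1 (wMeasure μ w) invMeasurableSpace_le), fun f =>
    (ac_wMeasure μ w).ae_le (lpMeasToLpTrim_ae_eq invMeasurableSpace_le (e₀ f))⟩

end TrimEquiv

section CompIsometry

variable {G : Type*} [Group G] [MeasurableSpace G] {μ : Measure G} {w : Weight G}
  {E F : Type*} [NormedAddCommGroup E] [NormedSpace ℂ E] [NormedAddCommGroup F] [NormedSpace ℂ F]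

variable (μ w) in
/-- The composition of the elements of `L¹_w(G, E)` with an isometry of `E` into `F`. -/
noncomputable def L1w.compIsometry (L : E →ₗᵢ[ℂ] F) : L1w μ w E →ₗᵢ[ℂ] L1w μ w F where
  toLinearMap := L.toContinuousLinearMap.compLpₗ 1 (wMeasure μ w)
  norm_map' f := by
    change ‖L.toContinuousLinearMap.compLp (show Lp E 1 (wMeasure μ w) from f)‖ =
      ‖(show Lp E 1 (wMeasure μ w) from f)‖
    rw [Lp.norm_def, Lp.norm_def]
    congr 1
    refine (eLpNorm_congr_ae (ContinuousLinearMap.coeFn_compLp _ _)).trans ?_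
    exact eLpNorm_congr_norm_ae (Eventually.of_forall fun _ => L.norm_map _)

theorem L1w.coe_compIsometry (L : E →ₗᵢ[ℂ] F) (f : L1w μ w E) :
    (L1w.compIsometry μ w L f : G → F) =ᵐ[μ] fun x => L (f x) :=
  (ac_wMeasure μ w).ae_le (ContinuousLinearMap.coeFn_compLp _ _)

end CompIsometry

section CenterInclusion

variable {G : Type*} [Group G] [TopologicalSpace G] [IsTopologicalGroup G] [T2Space G]
  [LocallyCompactSpace G] [MeasurableSpace G] [BorelSpace G]
  {μ : Measure G} [μ.IsHaarMeasure] [μ.Regular] {w : Weight G}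
  {A : Type*} [NonUnitalNormedRing A] [NormedSpace ℂ A] [IsScalarTower ℂ A A]
  [SMulCommClass ℂ A A]

variable (A) in
/-- The inclusion of the center. -/
noncomputable def centerIncl : Z A →ₗᵢ[ℂ] A where
  toFun z := z
  map_add' _ _ := rfl
  map_smul' _ _ := rfl
  norm_map' _ := rfl

theorem centerIncl_apply (z : Z A) : centerIncl A z = z := rfl

variable (μ w A) in
/-- The inclusion of the `Z(A)`-valued functions into the `A`-valued ones. -/
noncomputable def L1w.centerIncl : L1w μ w (Z A) →ₗᵢ[ℂ] L1w μ w A :=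
  L1w.compIsometry μ w (Beurling.centerIncl A)

theorem L1w.coe_centerIncl (f : L1w μ w (Z A)) :
    (L1w.centerIncl μ w A f : G → A) =ᵐ[μ] fun x => (f x : A) :=
  L1w.coe_compIsometry (Beurling.centerIncl A) f

variable [CompleteSpace A]

theorem L1w.centerIncl_mul (f g : L1w μ w (Z A)) :
    L1w.centerIncl μ w A (f * g) = L1w.centerIncl μ w A f * L1w.centerIncl μ w A g := by
  refine L1w.ext ?_
  refine EventuallyEq.trans ?_ (L1w.conv_congr (L1w.coe_centerIncl f) (L1w.coe_centerIncl g)).symm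
  filter_upwards [L1w.coe_centerIncl (f * g), L1w.coe_mul f g] with x h1 h2
  rw [h1, h2, conv, ← centerIncl_apply, ← (Beurling.centerIncl A).integral_comp_comm]
  rfl

theorem exists_centerIncl_eq {F : L1w μ w A} (hF : ∀ᵐ x ∂μ, F x ∈ Z A) :
    ∃ f : L1w μ w (Z A), L1w.centerIncl μ w A f = F := by
  classical
  -- The default value 0 is taken only on a null set. Measurability into the subspace comes from the
  -- embedding of Z(A) in A.
  let f : G → Z A := fun x => if h : F x ∈ Z A then ⟨F x, h⟩ else 0
  have hf : (fun x => (f x : A)) =ᵐ[wMeasure μ w] F := by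
    filter_upwards [(wMeasure_ac μ w).ae_le hF] with x hx
    simp [f, hx]
  have hm : MemLp (fun x => (f x : A)) 1 (wMeasure μ w) := (memLp_congr_ae hf).2 F.memLp
  have hfm : MemLp f 1 (wMeasure μ w) :=
    ⟨(Topology.IsEmbedding.subtypeVal.aestronglyMeasurable_comp_iff).1 hm.1, hm.2⟩
  refine ⟨L1w.mk f hfm, L1w.ext ?_⟩
  filter_upwards [L1w.coe_centerIncl (L1w.mk f hfm), L1w.coe_mk f hfm, (ac_wMeasure μ w).ae_le hf]
    with x h1 h2 h3
  rw [h1, h2, h3]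

theorem IsINGroup.exists_centerEquiv (hG : IsINGroup G)
    (hw : w.IsClassFunction ∨ ∀ x : G, 1 ≤ w x)
    (hA : ∀ z ∈ Z A, (∀ a, a * z = 0) → z = 0) :
    ∃ Ψ : L1inv μ w (Z A) ≃ₗᵢ[ℂ] Z (L1w μ w A), ∀ g, (Ψ g).1 = L1w.centerIncl μ w A g.1 := by
  have := hG.isMulRightInvariant (μ := μ)
  let I : L1inv μ w (Z A) →ₗᵢ[ℂ] Z (L1w μ w A) :=
    { toFun := fun g => ⟨L1w.centerIncl μ w A g.1, by
        obtain ⟨h, hm, hg⟩ := g.2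
        have hc := (stronglyMeasurable_inv_iff.1 hm).2
        refine mem_center_of_class (g := fun x => (h x : A)) ?_ (fun x y => by rw [hc])
          fun x => (h x).2
        filter_upwards [L1w.coe_centerIncl g.1, hg] with x h1 h2
        rw [h1, h2]⟩
      map_add' := fun f g => Subtype.ext ((L1w.centerIncl μ w A).map_add f.1 g.1)
      map_smul' := fun c f => Subtype.ext ((L1w.centerIncl μ w A).map_smul c f.1)
      norm_map' := fun f => (L1w.centerIncl μ w A).norm_map f.1 }
  have hI : Function.Surjective I := by
    rintro ⟨F, hF⟩
    -- The values are made central first, so that the averaging argument is applied to f in the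
    -- algebra Z(A) and yields a Z(A)-valued class function.
    obtain ⟨f, rfl⟩ := exists_centerIncl_eq (ae_mem_center_of_mem_center hF)
    refine ⟨⟨f, hG.mem_L1inv hw f fun z => ?_⟩, rfl⟩
    have hf := L1w.coe_centerIncl f
    filter_upwards [ae_comp_conj_eq_of_mem_center hA hF z, hf,
      (measurePreserving_conj μ z).quasiMeasurePreserving.ae hf] with x h1 h2 h3
    exact Subtype.ext (h3.symm.trans (h1.trans h2))
  exact ⟨LinearIsometryEquiv.ofSurjective I hI, fun _ => rfl⟩

variable (μ) in
theorem IsINGroup.exists_scalarCenterEquiv (hG : IsINGroup G)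
    (hw : w.IsClassFunction ∨ ∀ x : G, 1 ≤ w x) :
    ∃ e : L1inv μ w ℂ ≃ₗᵢ[ℂ] Z (L1w μ w ℂ), ∀ f, (e f).1 = f.1 := by
  have := hG.isMulRightInvariant (μ := μ)
  let I : L1inv μ w ℂ →ₗᵢ[ℂ] Z (L1w μ w ℂ) :=
    { toFun := fun g => ⟨g.1, by
        obtain ⟨h, hm, hg⟩ := g.2
        exact mem_center_of_class hg (stronglyMeasurable_inv_iff.1 hm).2
          fun x => (mem_Z_iff _ _).2 fun a => mul_comm _ _⟩
      map_add' := fun f g => rfl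
      map_smul' := fun c f => rfl
      norm_map' := fun f => rfl }
  have hI : Function.Surjective I := by
    rintro ⟨F, hF⟩
    -- In ℂ cancellation needs no approximate identity: take the factor 1.
    exact ⟨⟨F, hG.mem_L1inv hw F fun z => ae_comp_conj_eq_of_mem_center
      (fun z _ h => by simpa using h 1) hF z⟩, rfl⟩
  exact ⟨LinearIsometryEquiv.ofSurjective I hI, fun _ => rfl⟩

theorem IsINGroup.exists_tensorEquiv (hG : IsINGroup G)
    (hw : w.IsClassFunction ∨ ∀ x : G, 1 ≤ w x) (E : Type*) [NormedAddCommGroup E]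
    [NormedSpace ℂ E] [CompleteSpace E] :
    ∃ Θ : ProjTensor (Z (L1w μ w ℂ)) E ≃ₗᵢ[ℂ] L1inv μ w E,
      ∀ (f : Z (L1w μ w ℂ)) (z : E), ∀ᵐ x ∂μ, (Θ (ProjTensor.tmul f z)).1 x = f.1 x • z := by
  obtain ⟨e₁, he₁⟩ := exists_L1inv_equiv μ w ℂ
  obtain ⟨e₂, he₂⟩ := exists_L1inv_equiv μ w E
  obtain ⟨c, hc⟩ := hG.exists_scalarCenterEquiv μ hw
  -- The isometry is used for the σ-algebra of invariant sets and the restriction of w(x) dx to it,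
  -- whose scalar L¹ space is the centre of L¹_w(G).
  obtain ⟨Θ, hΘ⟩ := @exists_projTensor_L1_equiv G (invMeasurableSpace G) _ _ E _ _ _ _ _
    (e₁.symm.trans c)
  refine ⟨Θ.trans e₂.symm, fun f z => ?_⟩
  obtain ⟨g, rfl⟩ := c.surjective f
  have h1 := (ac_wMeasure μ w).ae_le (ae_eq_of_ae_eq_trim (hΘ (e₁ g) z))
  have h2 := he₂ (e₂.symm (Θ (ProjTensor.tmul (c g) z)))
  rw [LinearIsometryEquiv.apply_symm_apply] at h2
  rw [LinearIsometryEquiv.trans_apply, LinearIsometryEquiv.symm_apply_apply] at h1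
  filter_upwards [h1, h2, he₁ g] with x h1 h2 h3
  rw [LinearIsometryEquiv.trans_apply, ← h2, h1, h3, hc]

/-- In the convolution of f z with g z' the factor z z' comes out of the integral; this is
multiplicativity on elementary tensors. -/
theorem L1w.eq_mul_of_ae_eq_smul {f g : L1w μ w ℂ} {z z' : A} {F F' H : L1w μ w A}
    (hF : (F : G → A) =ᵐ[μ] fun x => f x • z) (hF' : (F' : G → A) =ᵐ[μ] fun x => g x • z')
    (hH : (H : G → A) =ᵐ[μ] fun x => (f * g) x • (z * z')) : H = F * F' := by
  refine L1w.ext (hH.trans (EventuallyEq.trans ?_ (L1w.conv_congr hF hF').symm))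
  filter_upwards [L1w.coe_mul f g] with x hx
  simp only [hx, conv, smul_mul_smul_comm]
  exact (integral_smul_const _ _).symm

end CenterInclusion
end Beurling

/-! ### The main theorem -/

theorem mainTheorem1
    {G : Type*} [Group G] [TopologicalSpace G] [IsTopologicalGroup G] [T2Space G]
    [LocallyCompactSpace G] [MeasurableSpace G] [BorelSpace G]
    (μ : Measure G) [μ.IsHaarMeasure] [μ.Regular]
    (hG : Beurling.IsINGroup G)
    (w : Beurling.Weight G) (hw : w.IsClassFunction ∨ ∀ x : G, 1 ≤ w x)
    {A : Type*} [NonUnitalNormedRing A] [NormedSpace ℂ A] [IsScalarTower ℂ A A]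
    [SMulCommClass ℂ A A] [CompleteSpace A]
    {ι : Type*} [Preorder ι] [IsDirectedOrder ι] [Nonempty ι] (a : ι → A)
    (ha : Beurling.IsBoundedCenterApproxIdentity a) :
    ∃ (Θ : Beurling.ProjTensor (Beurling.Z (Beurling.L1w μ w ℂ)) (Beurling.Z A) ≃ₗᵢ[ℂ]
          Beurling.L1inv μ w (Beurling.Z A))
      (Ψ : Beurling.L1inv μ w (Beurling.Z A) ≃ₗᵢ[ℂ] Beurling.Z (Beurling.L1w μ w A)),
      -- `Θ (f ⊗ z)` is the function `x ↦ f(x) z`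
      (∀ (f : Beurling.Z (Beurling.L1w μ w ℂ)) (z : Beurling.Z A),
        ∀ᵐ x ∂μ, (Θ (Beurling.ProjTensor.tmul f z)).1 x = f.1 x • z) ∧
      -- `Ψ` is the inclusion of the `Z(A)`-valued functions into the `A`-valued ones
      (∀ g : Beurling.L1inv μ w (Beurling.Z A), ∀ᵐ x ∂μ, (Ψ g).1 x = (g.1 x : A)) ∧
      -- both maps are multiplicative
      (∀ u v, (Θ (u * v)).1 = (Θ u).1 * (Θ v).1) ∧
      (∀ u v, Ψ (Θ (u * v)) = Ψ (Θ u) * Ψ (Θ v)) ∧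
      -- `L¹_{w,inv}(G, Z(A))` consists of the functions constant on conjugacy classes
      (∀ g : Beurling.L1w μ w (Beurling.Z A), g ∈ Beurling.L1inv μ w (Beurling.Z A) ↔
        ∃ h : G → Beurling.Z A, StronglyMeasurable h ∧ (∀ x y : G, h (y * x * y⁻¹) = h x) ∧
          ∀ᵐ x ∂μ, g x = h x) := by
  obtain ⟨Ψ, hΨ⟩ := hG.exists_centerEquiv (μ := μ) hw ha.eq_zero
  obtain ⟨Θ, hΘ⟩ := hG.exists_tensorEquiv (μ := μ) hw (Beurling.Z A)
  -- Products in the invariant space are formed in the ambient algebra L¹_w(G, Z(A)), so Θ is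
  -- composed with the inclusion before multiplicativity is reduced to elementary tensors.
  have hmul : ∀ u v, (Θ (u * v)).1 = (Θ u).1 * (Θ v).1 :=
    Beurling.ProjTensor.map_mul_of_tmul (B := Beurling.Z (Beurling.L1w μ w ℂ)) (C := Beurling.Z A)
      ((Beurling.L1inv μ w (Beurling.Z A)).subtypeL.comp
        Θ.toContinuousLinearEquiv.toContinuousLinearMap) fun f f' z z' =>
        Beurling.L1w.eq_mul_of_ae_eq_smul (hΘ f z) (hΘ f' z') (hΘ (f * f') (z * z'))
  refine ⟨Θ, Ψ, hΘ, fun g => ?_, hmul, fun u v => Subtype.ext ?_, fun g => ?_⟩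
  · rw [hΨ]
    exact Beurling.L1w.coe_centerIncl g.1
  · rw [hΨ, hmul, Beurling.L1w.centerIncl_mul, ← hΨ, ← hΨ]
    rfl
  · constructor
    · rintro ⟨h, hm, hg⟩
      obtain ⟨h1, h2⟩ := Beurling.stronglyMeasurable_inv_iff.1 hm
      exact ⟨h, h1, h2, hg⟩
    · rintro ⟨h, h1, h2, hg⟩
      exact ⟨h, Beurling.stronglyMeasurable_inv_iff.2 ⟨h1, h2⟩, hg⟩
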